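/- Let $\Omega\subset\mathbb{R}^3$ be a bounded domain with smooth boundary $\Gamma$. Write $(w_1,w_2)=\int_\Omega w_1\overline{w_2}\,dx$ (and $(\nabla w_1,\nabla w_2)=\int_\Omega \nabla w_1\cdot\overline{\nabla w_2}\,dx$), let $L^2$ and $H^1_0$ denote the Lebesgue and Sobolev spaces of complex-valued functions on $\Omega$, and let $H^{-1}$ be the dual of $H^1_0$. Assume that (A1) $f,h\in H^1_0$ are independent of time; (A2) $a,b,c,g,m,U,\gamma,\nu,\mu$ are real with $U>0$, $b>0$, $c>0$, $m>0$, $\gamma>0$ and $aU<1$; (A3) $d\in\mathbb{C}$ with $\operatorname{Im} d>0$. Consider the initial boundary value problem $$d v_t-\Big(a-\frac1U\Big)iv-\frac{ig}{U}\phi-\frac{ic}{4m}\Delta v+ib|v|^2v=f,$$ $$\phi_t+\gamma\phi-\frac{ig}{U}v+\frac{ig^2}{U}\phi+i(2\nu-2\mu)\phi-\frac{i}{4m}\Delta\phi=h$$ in $\Omega\times\mathbb{R}_+$, with $v=\phi=0$ on $\Gamma\times\mathbb{R}_+$ and $v|_{t=0}=v_0$, $\phi|_{t=0}=\phi_0$.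 **Definition.** For $T>0$, a pair $(v,\phi)$ is a weak solution on $\Omega\times[0,T]$ if $v,\phi\in C([0,T];H^1_0)$, $v_t\in L^2((0,T);L^2)$, $\phi_t\in L^2((0,T);H^{-1})$, and for all $\psi\in H^1_0$ and all complex-valued $\xi\in C^1[0,T]$ with $\xi(T)=0$, $$\int_0^T\Big[-d(v,\xi_t\psi)-i\Big(a-\frac1U\Big)(v,\xi\psi)-\frac{ig}{U}(\phi,\xi\psi)+\frac{ic}{4m}(\nabla v,\xi\nabla\psi)+ib(|v|^2v,\xi\psi)\Big]dt=\int_0^T(f,\xi\psi)\,dt+d\,(v_0,\xi(0)\psi),$$ $$\int_0^T\Big[-(\phi,\xi_t\psi)-\frac{ig}{U}(v,\xi\psi)+i\Big(\frac{g^2}{U}+2\nu-2\mu\Big)(\phi,\xi\psi)+\frac{i}{4m}(\nabla\phi,\xi\nabla\psi)+\gamma(\phi,\xi\psi)\Big]dt=\int_0^T(h,\xi\psi)\,dt+(\phi_0,\xi(0)\psi).$$ **Theorem.** For any $(v_0,\phi_0)\in H^1_0\times H^1_0$ the problem admits a global weak solution: there is a pair $(v,\phi)$ of functions of $t\ge 0$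 with $v(0)=v_0$ and $\phi(0)=\phi_0$ whose restriction to $[0,T]$ is a weak solution on $\Omega\times[0,T]$ for every $T>0$. -/

import Mathlib

open MeasureTheory Set Filter Topology
open scoped ContDiff ComplexConjugate

noncomputable section

namespace GinzburgLandau

/-- Three-dimensional Euclidean space. -/
abbrev R3 : Type := EuclideanSpace ℝ (Fin 3)

/-- `Ω` is a bounded domain (nonempty, open, connected) with smooth boundary: near each of its
boundary points, `Ω` is the set where a smooth function with nonvanishing differential at that
point is negative. -/
structure IsBoundedSmoothDomain (Ω : Set R3) : Prop where
  isOpen : IsOpen Ω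
  isConnected : IsConnected Ω
  isBounded : Bornology.IsBounded Ω
  smooth_boundary : ∀ x ∈ frontier Ω, ∃ ρ : R3 → ℝ,
    ContDiff ℝ ∞ ρ ∧ fderiv ℝ ρ x ≠ 0 ∧ ∀ᶠ y in 𝓝 x, (y ∈ Ω ↔ ρ y < 0)

/-- The complex space `L²(Ω)`. In Mathlib `inner ℂ w u` is linear in its second argument, so it is
`∫_Ω u * conj w`, which is written `(u, w)` in the usual PDE convention. -/
abbrev L2 (Ω : Set R3) : Type := Lp ℂ 2 (volume.restrict Ω)

/-- The space `L²(Ω; ℂ³)` of complex square-integrable vector fields. -/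
abbrev L2Vec (Ω : Set R3) : Type := Lp (EuclideanSpace ℂ (Fin 3)) 2 (volume.restrict Ω)

/-- The classical gradient `(∂₁ θ, ∂₂ θ, ∂₃ θ)` of a complex function. -/
def classicalGrad (θ : R3 → ℂ) (x : R3) : EuclideanSpace ℂ (Fin 3) :=
  WithLp.toLp 2 fun i => fderiv ℝ θ x (EuclideanSpace.single i (1 : ℝ))

/-- Complex test functions in `Ω`: smooth, with compact support contained in `Ω`. -/
structure IsTestFunction (Ω : Set R3) (θ : R3 → ℂ) : Prop where
  smooth : ContDiff ℝ ∞ θ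
  compact : HasCompactSupport θ
  support_subset : tsupport θ ⊆ Ω

theorem IsTestFunction.zero (Ω : Set R3) : IsTestFunction Ω 0 where
  smooth := contDiff_const
  compact := HasCompactSupport.zero
  support_subset := by simp

theorem IsTestFunction.add {Ω : Set R3} {θ η : R3 → ℂ} (hθ : IsTestFunction Ω θ)
    (hη : IsTestFunction Ω η) : IsTestFunction Ω (θ + η) where
  smooth := hθ.smooth.add hη.smooth
  compact := hθ.compact.add hη.compact
  support_subset :=
    (tsupport_add θ η).trans (union_subset hθ.support_subset hη.support_subset)

theorem IsTestFunction.smul {Ω : Set R3} {θ : R3 → ℂ} (z : ℂ) (hθ : IsTestFunction Ω θ) :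
    IsTestFunction Ω (z • θ) where
  smooth := contDiff_const.smul hθ.smooth
  compact := hθ.compact.smul_left (f := fun _ => z)
  support_subset := (tsupport_smul_subset_right (fun _ => z) θ).trans hθ.support_subset

theorem classicalGrad_zero : classicalGrad (0 : R3 → ℂ) = 0 := by
  funext x
  ext i
  have : fderiv ℝ (0 : R3 → ℂ) x = 0 := by
    simp
  simp [classicalGrad, this]

theorem classicalGrad_add {θ η : R3 → ℂ} (hθ : ContDiff ℝ ∞ θ) (hη : ContDiff ℝ ∞ η) :
    classicalGrad (θ + η) = classicalGrad θ + classicalGrad η := by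
  funext x
  ext i
  simp [classicalGrad, fderiv_add (hθ.differentiable (by simp) x) (hη.differentiable (by simp) x)]

theorem classicalGrad_smul {θ : R3 → ℂ} (z : ℂ) (hθ : ContDiff ℝ ∞ θ) :
    classicalGrad (z • θ) = z • classicalGrad θ := by
  funext x
  ext i
  simp [classicalGrad, fderiv_const_smul (hθ.differentiable (by simp) x)]

/-- The test functions, each recorded as the pair `(θ, ∇θ)` in the Hilbert space
`L²(Ω) × L²(Ω; ℂ³)`. -/
def testPairs (Ω : Set R3) : Submodule ℂ (WithLp 2 (L2 Ω × L2Vec Ω)) where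
  carrier := {p | ∃ θ : R3 → ℂ, IsTestFunction Ω θ ∧
    (p.fst : R3 → ℂ) =ᵐ[volume.restrict Ω] θ ∧
    (p.snd : R3 → EuclideanSpace ℂ (Fin 3)) =ᵐ[volume.restrict Ω] classicalGrad θ}
  zero_mem' := by
    refine ⟨0, IsTestFunction.zero Ω, ?_, ?_⟩
    · exact Lp.coeFn_zero _ _ _
    · rw [classicalGrad_zero]
      exact Lp.coeFn_zero _ _ _
  add_mem' := by
    rintro p q ⟨θ, hθ, hp1, hp2⟩ ⟨η, hη, hq1, hq2⟩
    refine ⟨θ + η, hθ.add hη, ?_, ?_⟩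
    · exact (Lp.coeFn_add _ _).trans (hp1.add hq1)
    · rw [classicalGrad_add hθ.smooth hη.smooth]
      exact (Lp.coeFn_add _ _).trans (hp2.add hq2)
  smul_mem' := by
    rintro z p ⟨θ, hθ, hp1, hp2⟩
    refine ⟨z • θ, hθ.smul z, ?_, ?_⟩
    · exact (Lp.coeFn_smul _ _).trans (hp1.const_smul z)
    · rw [classicalGrad_smul z hθ.smooth]
      exact (Lp.coeFn_smul _ _).trans (hp2.const_smul z)

/-- The complex Sobolev space `H¹₀(Ω)`: the closure of the test functions in the `H¹` norm
`(‖u‖² + ‖∇u‖²)^(1/2)`. A function `u` of `H¹₀(Ω)` is recorded with its weak gradient as the pair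
`(u, ∇u)`; the norm and inner product are those of `H¹(Ω)`. -/
def H10 (Ω : Set R3) : Submodule ℂ (WithLp 2 (L2 Ω × L2Vec Ω)) :=
  (testPairs Ω).topologicalClosure

/-- The embedding of `H¹₀(Ω)` in `L²(Ω)`. -/
def toL2 (Ω : Set R3) : H10 Ω →L[ℂ] L2 Ω :=
  (WithLp.fstL 2 ℂ (L2 Ω) (L2Vec Ω)).comp (H10 Ω).subtypeL

/-- The weak gradient on `H¹₀(Ω)`. -/
def grad (Ω : Set R3) : H10 Ω →L[ℂ] L2Vec Ω :=
  (WithLp.sndL 2 ℂ (L2 Ω) (L2Vec Ω)).comp (H10 Ω).subtypeL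

/-- `H⁻¹(Ω)`, the dual of `H¹₀(Ω)`: bounded antilinear functionals, with the operator norm. -/
abbrev Hm1 (Ω : Set R3) : Type := H10 Ω →L⋆[ℂ] ℂ

/-- The embedding of `H¹₀(Ω)` in `H⁻¹(Ω)` through `L²(Ω)`: `u` acts as
`ψ ↦ ∫_Ω u * conj ψ`. -/
def toHm1 (Ω : Set R3) (u : H10 Ω) : Hm1 Ω :=
  (innerSLFlip ℂ (toL2 Ω u)).comp (toL2 Ω)

/-- `u` has the weak (distributional) time derivative `w` on `(0, T)`, and
`w ∈ L²((0, T); X)`. -/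
structure HasL2WeakTimeDeriv {X : Type*} [NormedAddCommGroup X] [NormedSpace ℝ X]
    (T : ℝ) (u w : ℝ → X) : Prop where
  integrableOn : IntegrableOn u (Ioo 0 T)
  memLp : MemLp w 2 (volume.restrict (Ioo 0 T))
  integral_eq : ∀ η : ℝ → ℝ, ContDiff ℝ ∞ η → HasCompactSupport η → tsupport η ⊆ Ioo 0 T →
    ∫ t in Ioo 0 T, deriv η t • u t = -∫ t in Ioo 0 T, η t • w t

/-- The coefficients of the system. -/
structure Coefficients where
  (a b c g m U γ ν μ : ℝ)
  d : ℂ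

/-- The cubic term `(|v|² v, ψ) = ∫_Ω |v|² v * conj ψ`. -/
def cubicPairing (Ω : Set R3) (v ψ : H10 Ω) : ℂ :=
  ∫ x in Ω, ((‖toL2 Ω v x‖ ^ 2 : ℝ) : ℂ) * toL2 Ω v x * conj (toL2 Ω ψ x)

/-- `(v, φ)` is a weak solution on `Ω × [0, T]`, with initial data `(v₀, φ₀)`, of the damped system
* `d v_t - (a - 1/U) i v - (i g/U) φ - (i c/(4m)) Δv + i b |v|² v = f`,
* `φ_t + γ φ - (i g/U) v + (i g²/U) φ + i (2ν - 2μ) φ - (i/(4m)) Δφ = h`,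
with homogeneous Dirichlet boundary conditions (built into `H¹₀`). Here `inner ℂ ψ v` is
`(v, ψ) = ∫_Ω v * conj ψ`, and `ξ ∈ C¹[0, T]` is complex valued. -/
structure IsWeakSolution (Ω : Set R3) (P : Coefficients) (f h v₀ φ₀ : H10 Ω) (T : ℝ)
    (v φ : ℝ → H10 Ω) : Prop where
  continuousOn_v : ContinuousOn v (Icc 0 T)
  continuousOn_φ : ContinuousOn φ (Icc 0 T)
  deriv_v : ∃ w : ℝ → L2 Ω, HasL2WeakTimeDeriv T (fun t => toL2 Ω (v t)) w
  deriv_φ : ∃ w : ℝ → Hm1 Ω, HasL2WeakTimeDeriv T (fun t => toHm1 Ω (φ t)) w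
  weak_v : ∀ (ψ : H10 Ω) (ξ : ℝ → ℂ), ContDiffOn ℝ 1 ξ (Icc 0 T) → ξ T = 0 →
    ∫ t in (0 : ℝ)..T,
      (-P.d * inner ℂ (derivWithin ξ (Icc 0 T) t • toL2 Ω ψ) (toL2 Ω (v t))
        - Complex.I * ((P.a : ℂ) - 1 / P.U) * inner ℂ (ξ t • toL2 Ω ψ) (toL2 Ω (v t))
        - Complex.I * P.g / P.U * inner ℂ (ξ t • toL2 Ω ψ) (toL2 Ω (φ t))
        + Complex.I * P.c / (4 * P.m) * inner ℂ (ξ t • grad Ω ψ) (grad Ω (v t))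
        + Complex.I * P.b * cubicPairing Ω (v t) (ξ t • ψ))
    = (∫ t in (0 : ℝ)..T, inner ℂ (ξ t • toL2 Ω ψ) (toL2 Ω f))
        + P.d * inner ℂ (ξ 0 • toL2 Ω ψ) (toL2 Ω v₀)
  weak_φ : ∀ (ψ : H10 Ω) (ξ : ℝ → ℂ), ContDiffOn ℝ 1 ξ (Icc 0 T) → ξ T = 0 →
    ∫ t in (0 : ℝ)..T,
      (-inner ℂ (derivWithin ξ (Icc 0 T) t • toL2 Ω ψ) (toL2 Ω (φ t))
        - Complex.I * P.g / P.U * inner ℂ (ξ t • toL2 Ω ψ) (toL2 Ω (v t))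
        + Complex.I * ((P.g : ℂ) ^ 2 / P.U + 2 * P.ν - 2 * P.μ)
            * inner ℂ (ξ t • toL2 Ω ψ) (toL2 Ω (φ t))
        + Complex.I / (4 * P.m) * inner ℂ (ξ t • grad Ω ψ) (grad Ω (φ t))
        + P.γ * inner ℂ (ξ t • toL2 Ω ψ) (toL2 Ω (φ t)))
    = (∫ t in (0 : ℝ)..T, inner ℂ (ξ t • toL2 Ω ψ) (toL2 Ω h))
        + inner ℂ (ξ 0 • toL2 Ω ψ) (toL2 Ω φ₀)

end GinzburgLandau

end

/-! Existence of global weak solutions for a coupled Ginzburg–Landau system.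

Write `V = H¹₀(Ω)`, `H = L²(Ω)` and let `J : V → H` be the embedding. Everything about the
Dirichlet Laplacian is encoded in the bounded positive operator `B = J† J` on `V`: since
`⟨B x, y⟩_V = ⟨J x, J y⟩_H`, it is the restriction to `V` of the inverse of `1 - Δ`. Solving the
first equation for `v_t` and the second one for `φ_t`, both become abstract linear evolution
equations `u_t + α B⁻¹ u = F`, with `α = i c / (4 m d)` and `Re α > 0` for `v` (a parabolic
equation, because `Im d > 0`) and `α = i / (4 m)`, `Re α = 0` for `φ` (a Schrödinger equation).

*Linear theory.* No semigroup theory is used. For data in the range of `B³` the equation is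
solved by the Yosida regularisations `(B + ε)⁻¹` of `B⁻¹`, whose solutions are Cauchy with rate
`ε` (`exists_isRegularSolution`). An energy estimate bounds the solution in `V` by the data: by
`‖F‖` in `L²(0, t; V)` in general, and, if `Re α > 0`, by `‖F‖` in `L²(0, t; H)`
(`stabilityEstimate_id`, `stabilityEstimate_parabolic`). Density then gives solutions for all
continuous `F` (`exists_isLinearSolution`), as limits of regular ones; the weak equation and the
weak time derivative pass to the limit.

*Nonlinear problem.* By the Sobolev embedding `H¹₀ ⊆ L⁶` the cubic term `N v = |v|² v` is locally
Lipschitz from `V` to `H` (`exists_cubicNonlinearity`). With `N` truncated outside a ball whose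
radius grows with time, Picard iteration solves the coupled system for all times
(`exists_truncated_solution`). Testing the first equation with `v_t` controls
`‖v‖_V² + (l / 2) ∫ |v|⁴`, because `b`, `c` and `m` are positive and `N` is the differential of
the potential `¼ ∫ |v|⁴` (`IsLinearSolution.energy_le`); Gronwall's inequality then bounds
`(v, φ)` on every bounded time interval (`a_priori_bound`). With the truncation radius equal to
this bound, the truncation is never active (`exists_coupled_solution`). An integration by parts
in time turns the equations, tested against `ψ ∈ V` and integrated from `0` to `t`, into the weak
formulation. -/

noncomputable section

namespace GinzburgLandau

/-! ### Differential inequalities, linear equations and the Yosida regularisation -/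

section Evolution

variable {V : Type*} [NormedAddCommGroup V] [InnerProductSpace ℂ V] [CompleteSpace V]

theorem hasDerivAt_re_inner_self {E : Type*} [NormedAddCommGroup E] [InnerProductSpace ℂ E]
    {z : ℝ → E} {z' : E} {t : ℝ} (hz : HasDerivAt z z' t) :
    HasDerivAt (fun s => ‖z s‖ ^ 2) (2 * (inner ℂ (z t) z').re) t := by
  have h := hz.inner ℂ hz
  have h2 := Complex.reCLM.hasFDerivAt.comp_hasDerivAt t h
  have e : (fun s => ‖z s‖ ^ 2) = Complex.reCLM ∘ fun s => inner ℂ (z s) (z s) := by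
    funext s
    simp [← inner_self_eq_norm_sq (𝕜 := ℂ)]
  rw [e]
  have e2 : Complex.reCLM (inner ℂ (z t) z' + inner ℂ z' (z t)) = 2 * (inner ℂ (z t) z').re := by
    rw [Complex.reCLM_apply, Complex.add_re, ← inner_conj_symm z' (z t), Complex.conj_re]
    ring
  rw [e2] at h2
  exact h2

/-- Gronwall's inequality for `y' ≤ y + r`, with a forcing `r ≥ 0`. -/
theorem le_exp_mul_of_hasDerivAt_le {y y' r : ℝ → ℝ} (hr : Continuous r) (hr0 : ∀ t, 0 ≤ r t)
    (hy : ∀ t, 0 ≤ t → HasDerivAt y (y' t) t) (hle : ∀ t, 0 ≤ t → y' t ≤ y t + r t)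
    {t : ℝ} (ht : 0 ≤ t) : y t ≤ Real.exp t * (y 0 + ∫ s in (0 : ℝ)..t, r s) := by
  let k : ℝ → ℝ := fun t => Real.exp (-t) * y t - ∫ s in (0 : ℝ)..t, r s
  have hk : ∀ t, 0 ≤ t → HasDerivAt k
      (-Real.exp (-t) * y t + Real.exp (-t) * y' t - r t) t := by
    intro t ht
    have h1 : HasDerivAt (fun t => Real.exp (-t)) (-Real.exp (-t)) t := by
      simpa using (hasDerivAt_neg t).exp
    exact (h1.mul (hy t ht)).sub (hr.integral_hasStrictDerivAt 0 t).hasDerivAt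
  have hanti : AntitoneOn k (Ici 0) := by
    refine antitoneOn_of_deriv_nonpos (convex_Ici 0)
      (fun t ht => (hk t ht).continuousAt.continuousWithinAt)
      (fun t ht => ((hk t (interior_subset ht)).differentiableAt).differentiableWithinAt) ?_
    intro t ht
    have ht0 : 0 ≤ t := interior_subset ht
    rw [(hk t ht0).deriv]
    have h1 : Real.exp (-t) ≤ 1 := Real.exp_le_one_iff.2 (by linarith)
    have h2 := mul_le_mul_of_nonneg_left (hle t ht0) (Real.exp_pos (-t)).le
    have h3 := mul_le_mul_of_nonneg_right h1 (hr0 t)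
    linarith
  have h := hanti (mem_Ici.2 le_rfl) (mem_Ici.2 ht) ht
  simp only [k, neg_zero, Real.exp_zero, one_mul, intervalIntegral.integral_same, sub_zero] at h
  have h2 : Real.exp (-t) * y t ≤ y 0 + ∫ s in (0 : ℝ)..t, r s := by linarith
  calc y t = Real.exp t * (Real.exp (-t) * y t) := by
        rw [← mul_assoc, ← Real.exp_add]; simp
    _ ≤ _ := mul_le_mul_of_nonneg_left h2 (Real.exp_pos t).le

theorem norm_sq_le_of_inner_le {E : Type*} [NormedAddCommGroup E] [InnerProductSpace ℂ E]
    {z z' : ℝ → E} {r : ℝ → ℝ} (hr : Continuous r) (hr0 : ∀ t, 0 ≤ r t)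
    (hz : ∀ t, 0 ≤ t → HasDerivAt z (z' t) t)
    (hle : ∀ t, 0 ≤ t → 2 * (inner ℂ (z t) (z' t)).re ≤ ‖z t‖ ^ 2 + r t)
    {t : ℝ} (ht : 0 ≤ t) :
    ‖z t‖ ^ 2 ≤ Real.exp t * (‖z 0‖ ^ 2 + ∫ s in (0 : ℝ)..t, r s) :=
  le_exp_mul_of_hasDerivAt_le (y := fun s => ‖z s‖ ^ 2) hr hr0
    (fun s hs => hasDerivAt_re_inner_self (hz s hs)) hle ht

/-- Duhamel's formula for a bounded operator `A`, on the whole real line. -/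
theorem exists_hasDerivAt_linear {E : Type*} [NormedAddCommGroup E] [NormedSpace ℝ E]
    [CompleteSpace E] (A : E →L[ℝ] E) {r : ℝ → E} (hr : Continuous r) (x : E) :
    ∃ z : ℝ → E, z 0 = x ∧ ∀ t, HasDerivAt z (A (z t) + r t) t := by
  let _ : NormedAlgebra ℚ (E →L[ℝ] E) := NormedAlgebra.restrictScalars ℚ ℝ _
  let S : ℝ → E →L[ℝ] E := fun t => NormedSpace.exp (t • A)
  have hS : ∀ t, HasDerivAt S (A * S t) t := fun t => hasDerivAt_exp_smul_const' A t
  have hSc : Continuous S := continuous_iff_continuousAt.2 fun t => (hS t).continuousAt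
  have hinv : ∀ t, S t * S (-t) = 1 := by
    intro t
    have hc : Commute (t • A) ((-t) • A) := by
      rw [neg_smul]; exact (Commute.refl _).neg_right
    have := NormedSpace.exp_add_of_commute hc
    rw [← add_smul, add_neg_cancel, zero_smul, NormedSpace.exp_zero] at this
    exact this.symm
  have hq : Continuous fun s => S (-s) (r s) :=
    (hSc.comp continuous_neg).clm_apply hr
  let I : ℝ → E := fun t => x + ∫ s in (0 : ℝ)..t, S (-s) (r s)
  have hI : ∀ t, HasDerivAt I (S (-t) (r t)) t := fun t =>
    (hq.integral_hasStrictDerivAt 0 t).hasDerivAt.const_add x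
  refine ⟨fun t => S t (I t), ?_, fun t => ?_⟩
  · simp [S, I]
  · have h1 := (hS t).clm_apply
      (u := I) (c := S) (𝕜 := ℝ) (hI t)
    have h2 : S t (S (-t) (r t)) = r t := by
      have := congrArg (fun L : E →L[ℝ] E => L (r t)) (hinv t)
      simpa using this
    rw [← h2]
    exact h1

/-- The bounded resolvent `(B + ε)⁻¹`; for positive `B` it is the Yosida regularisation of the
unbounded operator `B⁻¹`. It is the inverse in the ring of bounded operators, hence the junk
value `0` if `B + ε` is not invertible; for positive `B` and `ε > 0` it always is. -/
def yosida (B : V →L[ℂ] V) (ε : ℝ) : V →L[ℂ] V := Ring.inverse (B + (ε : ℂ) • 1)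

variable {B : V →L[ℂ] V} {ε : ℝ}

/-- `B + ε` is coercive, so it is invertible by the Lax–Milgram argument. -/
theorem isUnit_add_smul_one (hB : B.IsPositive) (hε : 0 < ε) : IsUnit (B + (ε : ℂ) • 1) := by
  refine ContinuousLinearMap.isUnit_of_forall_le_norm_inner_map _ (c := ⟨ε, hε.le⟩) hε fun x => ?_
  have h1 : 0 ≤ (inner ℂ (B x) x).re := hB.re_inner_nonneg_left x
  refine le_trans ?_ (Complex.re_le_norm _)
  have h2 : (inner ℂ ((ε : ℂ) • x) x).re = ε * ‖x‖ ^ 2 := by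
    rw [inner_smul_left, inner_self_eq_norm_sq_to_K]
    simp [← Complex.ofReal_pow]
  change ‖x‖ ^ 2 * ε ≤ (inner ℂ (B x + (ε : ℂ) • x) x).re
  rw [inner_add_left, Complex.add_re, h2]
  linarith

theorem add_yosida_apply (hB : B.IsPositive) (hε : 0 < ε) (x : V) :
    B (yosida B ε x) + (ε : ℂ) • yosida B ε x = x := by
  have := congrArg (fun L : V →L[ℂ] V => L x)
    (Ring.mul_inverse_cancel _ (isUnit_add_smul_one hB hε))
  exact this

theorem yosida_comm (hB : B.IsPositive) (hε : 0 < ε) (x : V) :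
    yosida B ε (B x) = B (yosida B ε x) := by
  have h1 := congrArg (fun L : V →L[ℂ] V => L (B (yosida B ε x)))
    (Ring.inverse_mul_cancel _ (isUnit_add_smul_one hB hε))
  have h2 : yosida B ε (B (B (yosida B ε x)) + (ε : ℂ) • B (yosida B ε x))
    = B (yosida B ε x) := h1
  rwa [← map_smul, ← map_add, add_yosida_apply hB hε] at h2

theorem re_inner_map_eq {V : Type*} [NormedAddCommGroup V] [InnerProductSpace ℂ V]
    {B : V →L[ℂ] V} (hB : B.IsPositive) (x : V) :
    ∃ p : ℝ, 0 ≤ p ∧ inner ℂ (B x) x = p := by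
  refine ⟨(inner ℂ (B x) x).re, hB.re_inner_nonneg_left x, ?_⟩
  have := hB.isSymmetric.coe_re_inner_apply_self x
  exact this.symm

theorem norm_sq_add_smul {V : Type*} [NormedAddCommGroup V] [InnerProductSpace ℂ V]
    {B : V →L[ℂ] V} {ε : ℝ} (hB : B.IsPositive) (hε : 0 < ε) (y : V) :
    ‖B y‖ ^ 2 + ε ^ 2 * ‖y‖ ^ 2 ≤ ‖B y + (ε : ℂ) • y‖ ^ 2 := by
  obtain ⟨p, hp0, hp⟩ := re_inner_map_eq hB y
  have h := norm_add_sq (𝕜 := ℂ) (B y) ((ε : ℂ) • y)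
  rw [inner_smul_right, hp, norm_smul] at h
  simp only [RCLike.re_to_complex, ← Complex.ofReal_mul, Complex.ofReal_re, Complex.norm_real,
    Real.norm_eq_abs, mul_pow, sq_abs] at h
  rw [h]
  nlinarith [mul_nonneg hε.le hp0]

theorem norm_map_yosida_le (hB : B.IsPositive) (hε : 0 < ε) (x : V) :
    ‖B (yosida B ε x)‖ ≤ ‖x‖ := by
  have h := norm_sq_add_smul hB hε (yosida B ε x)
  rw [add_yosida_apply hB hε] at h
  exact abs_le_of_sq_le_sq' (by nlinarith [sq_nonneg (ε * ‖yosida B ε x‖)]) (norm_nonneg _) |>.2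

/-- The quadratic form of the resolvent is real and nonnegative; this is where the sign of `Re α`
enters the estimates for the regularised equations. -/
theorem inner_yosida_eq (hB : B.IsPositive) (hε : 0 < ε) (x : V) :
    ∃ p : ℝ, 0 ≤ p ∧ inner ℂ (yosida B ε x) x = p := by
  obtain ⟨p, hp0, hp⟩ := re_inner_map_eq hB (yosida B ε x)
  refine ⟨p + ε * ‖yosida B ε x‖ ^ 2, by positivity, ?_⟩
  have h2 := hB.isSymmetric (yosida B ε x) (yosida B ε x)
  simp only [ContinuousLinearMap.coe_coe] at h2
  nth_rewrite 2 [← add_yosida_apply hB hε x]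
  rw [inner_add_right, ← h2, hp, inner_smul_right, inner_self_eq_norm_sq_to_K]
  simp

/-- The resolvent identity. -/
theorem yosida_sub (hB : B.IsPositive) {δ : ℝ} (hε : 0 < ε) (hδ : 0 < δ) (x : V) :
    yosida B ε x - yosida B δ x = ((δ - ε : ℝ) : ℂ) • yosida B ε (yosida B δ x) := by
  have h1 := congrArg (yosida B ε) (add_yosida_apply hB hδ x)
  have h2 := add_yosida_apply hB hε (yosida B δ x)
  rw [map_add, map_smul, yosida_comm hB hε] at h1
  set p := yosida B ε (yosida B δ x)
  rw [← h1, ← h2]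
  push_cast
  module

end Evolution

/-! ### Regular solutions of the linear equation -/

section Regular

/-- A sequence of continuous functions which is Cauchy on `[0, ∞)`, at the rate `1 / (n + 1)` and
locally uniformly in time, has a limit with the same rate. The limit is extended to negative
times by its value at `0`, so that it is continuous on the whole line. -/
theorem exists_limit_of_cauchy_rate {E : Type*} [NormedAddCommGroup E] [CompleteSpace E]
    {U : ℕ → ℝ → E} (hU : ∀ n, Continuous (U n)) {κ : ℝ → ℝ} (hκ : Continuous κ)
    (h : ∀ n m t, 0 ≤ t → ‖U n t - U m t‖ ≤ (1 / ((n : ℝ) + 1) + 1 / ((m : ℝ) + 1)) * κ t) :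
    ∃ v : ℝ → E, Continuous v ∧ (∀ t ≤ 0, v t = v 0) ∧
      ∀ n t, 0 ≤ t → ‖U n t - v t‖ ≤ 1 / ((n : ℝ) + 1) * κ t := by
  have hlim : ∀ t : ℝ, ∃ w : E, 0 ≤ t → Tendsto (fun n => U n t) atTop (𝓝 w) := by
    intro t
    by_cases ht : 0 ≤ t
    · have hc : CauchySeq fun n => U n t := by
        refine cauchySeq_of_le_tendsto_0' (fun n => 2 * (1 / ((n : ℝ) + 1)) * κ t) ?_ ?_
        · intro n m hnm
          rw [dist_eq_norm]
          refine (h n m t ht).trans ?_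
          have hk : 0 ≤ κ t := by
            have := (norm_nonneg _).trans (h 0 0 t ht)
            norm_num at this
            linarith
          have : 1 / ((m : ℝ) + 1) ≤ 1 / ((n : ℝ) + 1) := Nat.one_div_le_one_div hnm
          exact mul_le_mul_of_nonneg_right (by linarith) hk
        · have := (tendsto_one_div_add_atTop_nhds_zero_nat (𝕜 := ℝ)).const_mul 2 |>.mul_const (κ t)
          simpa using this
      obtain ⟨w, hw⟩ := cauchySeq_tendsto_of_complete hc
      exact ⟨w, fun _ => hw⟩
    · exact ⟨0, fun h => absurd h ht⟩
  choose w hw using hlim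
  have hb : ∀ n t, 0 ≤ t → ‖U n t - w t‖ ≤ 1 / ((n : ℝ) + 1) * κ t := by
    intro n t ht
    have h1 : Tendsto (fun m => ‖U n t - U m t‖) atTop (𝓝 ‖U n t - w t‖) :=
      (tendsto_const_nhds.sub (hw t ht)).norm
    have h2 : Tendsto (fun m : ℕ => (1 / ((n : ℝ) + 1) + 1 / ((m : ℝ) + 1)) * κ t) atTop
        (𝓝 ((1 / ((n : ℝ) + 1) + 0) * κ t)) :=
      (tendsto_const_nhds.add tendsto_one_div_add_atTop_nhds_zero_nat).mul_const _
    rw [add_zero] at h2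
    exact le_of_tendsto_of_tendsto' h1 h2 fun m => h n m t ht
  refine ⟨fun t => w (max t 0), ?_, fun t ht => by simp [ht], fun n t ht => ?_⟩
  · have hU' : ∀ n, Continuous fun t : ℝ => U n (max t 0) := fun n =>
      (hU n).comp (continuous_id.max continuous_const)
    refine TendstoLocallyUniformly.continuous (F := fun n t => U n (max t 0)) (p := atTop) ?_
      (Frequently.of_forall hU')
    rw [Metric.tendstoLocallyUniformly_iff]
    intro ε hε x
    have hcont : Continuous fun t : ℝ => κ (max t 0) :=
      hκ.comp (continuous_id.max continuous_const)
    have hev : ∀ᶠ y in 𝓝 x, κ (max y 0) < κ (max x 0) + 1 :=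
      hcont.continuousAt.eventually_lt continuousAt_const (by simp)
    refine ⟨_, hev, ?_⟩
    have h0 : Tendsto (fun n : ℕ => 1 / ((n : ℝ) + 1) * (κ (max x 0) + 1)) atTop (𝓝 0) := by
      simpa using (tendsto_one_div_add_atTop_nhds_zero_nat (𝕜 := ℝ)).mul_const (κ (max x 0) + 1)
    filter_upwards [h0.eventually_lt_const hε] with n hn y hy
    rw [dist_comm, dist_eq_norm]
    refine (hb n _ (le_max_right y 0)).trans_lt (lt_of_le_of_lt ?_ hn)
    exact mul_le_mul_of_nonneg_left (le_of_lt hy) (by positivity)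
  · simpa [ht] using hb n t ht

variable {V : Type*} [NormedAddCommGroup V] [InnerProductSpace ℂ V]

/-- `u` is a regular solution of the equation `u' + α B⁻¹ u = g` for positive times: `u` takes
its values in the range of `B`, and `p` plays the role of `B⁻¹ u`. The equation `u' = g - α p` is
required on the whole line, the relation `u = B p` for `t ≥ 0` only, which leaves `u` free to be
any `C¹` continuation to negative times. -/
structure IsRegularSolution (B : V →L[ℂ] V) (α : ℂ) (u p g : ℝ → V) : Prop where
  continuous_p : Continuous p
  continuous_g : Continuous g
  hasDerivAt : ∀ t, HasDerivAt u (g t - α • p t) t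
  eq_map : ∀ t, 0 ≤ t → u t = B (p t)

variable [CompleteSpace V] {B : V →L[ℂ] V} {ε : ℝ}

theorem two_re_inner_yosida_le (hB : B.IsPositive) (hε : 0 < ε) {α : ℂ} (hα : 0 ≤ α.re)
    (z r : V) :
    2 * (inner ℂ z (-α • yosida B ε z + r)).re ≤ ‖z‖ ^ 2 + ‖r‖ ^ 2 := by
  obtain ⟨p, hp0, hp⟩ := inner_yosida_eq hB hε z
  have h1 : inner ℂ z (yosida B ε z) = p := by
    rw [← inner_conj_symm, hp, Complex.conj_ofReal]
  have h2 : (inner ℂ z r).re ≤ ‖z‖ * ‖r‖ := (Complex.re_le_norm _).trans (norm_inner_le_norm _ _)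
  rw [inner_add_right, inner_smul_right, h1, Complex.add_re, Complex.re_mul_ofReal, Complex.neg_re]
  nlinarith [mul_nonneg hα hp0, sq_nonneg (‖z‖ - ‖r‖)]

theorem norm_yosida_map_le (hB : B.IsPositive) (hε : 0 < ε) (x : V) :
    ‖yosida B ε (B x)‖ ≤ ‖x‖ := by
  rw [yosida_comm hB hε]; exact norm_map_yosida_le hB hε x

/-- For data in the range of `B³` there is a regular solution. It is the limit of `B³ zₙ`, where
`zₙ` solves the equation with `B⁻¹` replaced by the resolvent `(B + 1 / (n + 1))⁻¹`, for the
forcing `y` smoothed accordingly; the powers of `B` absorb the resolvents in the error terms, so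
that `B² zₙ` converges at the rate `1 / (n + 1)`, and its limit is the function `p` of the
definition. -/
theorem exists_isRegularSolution (hB : B.IsPositive) {α : ℂ} (hα : 0 ≤ α.re) (x : V)
    {y : ℝ → V} (hy : Continuous y) :
    ∃ u p : ℝ → V, IsRegularSolution B α u p (fun t => B (B (B (y t)))) ∧
      u 0 = B (B (B x)) := by
  let ε : ℕ → ℝ := fun n => 1 / ((n : ℝ) + 1)
  have hε : ∀ n, 0 < ε n := fun n => Nat.one_div_pos_of_nat
  let A : ℕ → V →L[ℂ] V := fun n => yosida B (ε n)
  have hex : ∀ n, ∃ z : ℝ → V, z 0 = x ∧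
      ∀ t, HasDerivAt z (-α • A n (z t) + A n (B (y t))) t := fun n =>
    exists_hasDerivAt_linear ((-α • A n).restrictScalars ℝ)
      ((A n).continuous.comp (B.continuous.comp hy)) x
  choose z hz0 hz using hex
  have hzc : ∀ n, Continuous (z n) := fun n =>
    continuous_iff_continuousAt.2 fun t => (hz n t).continuousAt
  -- a bound for the approximations, uniform in the regularisation parameter
  let M : ℝ → ℝ := fun t => Real.exp t * (‖x‖ ^ 2 + ∫ s in (0 : ℝ)..t, ‖y s‖ ^ 2)
  have hMc : Continuous M := by
    have : Continuous fun t => ∫ s in (0 : ℝ)..t, ‖y s‖ ^ 2 :=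
      intervalIntegral.continuous_primitive
        (fun a b => (hy.norm.pow 2).intervalIntegrable a b) 0
    exact Real.continuous_exp.mul (continuous_const.add this)
  have hzM : ∀ n t, 0 ≤ t → ‖z n t‖ ≤ √(M t) := by
    intro n t ht
    refine Real.le_sqrt_of_sq_le ?_
    have := norm_sq_le_of_inner_le (z := z n) (r := fun t => ‖y t‖ ^ 2) (hy.norm.pow 2)
      (fun t => by positivity) (fun t _ => hz n t)
      (fun t _ => (two_re_inner_yosida_le hB (hε n) hα _ _).trans
        (by gcongr; exact norm_yosida_map_le hB (hε n) _)) ht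
    rwa [hz0] at this
  -- the second powers `B² zₙ` form a Cauchy sequence
  let ρ : ℝ → ℝ := fun t => ‖α‖ * √(M t) + ‖B (y t)‖
  have hρc : Continuous ρ :=
    (continuous_const.mul hMc.sqrt).add (B.continuous.comp hy).norm
  let κ : ℝ → ℝ := fun t => √(Real.exp t * ∫ s in (0 : ℝ)..t, ρ s ^ 2)
  have hκc : Continuous κ := by
    have : Continuous fun t => ∫ s in (0 : ℝ)..t, ρ s ^ 2 :=
      intervalIntegral.continuous_primitive
        (fun a b => (hρc.pow 2).intervalIntegrable a b) 0
    exact (Real.continuous_exp.mul this).sqrt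
  have hBz : ∀ n t, HasDerivAt (fun t => B (B (z n t)))
      (-α • A n (B (B (z n t))) + A n (B (B (B (y t))))) t := by
    intro n t
    have h1 := ((B.comp B).restrictScalars ℝ).hasFDerivAt.comp_hasDerivAt t (hz n t)
    refine h1.congr_deriv ?_
    change B (B _) = _
    simp only [map_add, map_smul, A, yosida_comm hB (hε n)]
  have hcauchy : ∀ n m t, 0 ≤ t → ‖B (B (z n t)) - B (B (z m t))‖ ≤
      (1 / ((n : ℝ) + 1) + 1 / ((m : ℝ) + 1)) * κ t := by
    intro n m t ht
    set e : ℝ := 1 / ((n : ℝ) + 1) + 1 / ((m : ℝ) + 1) with he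
    have he0 : 0 ≤ e := by positivity
    have key := norm_sq_le_of_inner_le (z := fun t => B (B (z n t)) - B (B (z m t)))
      (z' := fun t => -α • A n (B (B (z n t)) - B (B (z m t))) +
        (A n (-α • B (B (z m t)) + B (B (B (y t)))) - A m (-α • B (B (z m t)) + B (B (B (y t))))))
      (r := fun t => e ^ 2 * ρ t ^ 2) (continuous_const.mul (hρc.pow 2))
      (fun t => by positivity) (fun t _ => ?_) (fun t ht => ?_) ht
    · simp only [hz0, sub_self, norm_zero, intervalIntegral.integral_const_mul] at key
      refine abs_le_of_sq_le_sq' (key.trans (le_of_eq ?_)) (by positivity) |>.2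
      rw [mul_pow, Real.sq_sqrt]
      · ring
      · have : 0 ≤ ∫ s in (0 : ℝ)..t, ρ s ^ 2 :=
          intervalIntegral.integral_nonneg ht fun s _ => by positivity
        positivity
    · refine ((hBz n t).sub (hBz m t)).congr_deriv ?_
      simp only [map_sub, map_add, map_smul]
      module
    · refine (two_re_inner_yosida_le hB (hε n) hα _ _).trans ?_
      rw [← mul_pow]
      gcongr
      have h1 : -α • B (B (z m t)) + B (B (B (y t))) = B (B (-α • z m t + B (y t))) := by
        simp only [map_add, map_smul]
      rw [h1]
      simp only [A]
      rw [yosida_sub hB (hε n) (hε m), norm_smul, Complex.norm_real]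
      refine mul_le_mul ?_ ?_ (norm_nonneg _) he0
      · refine (abs_sub _ _).trans (le_of_eq ?_)
        rw [abs_of_pos (hε n), abs_of_pos (hε m), add_comm]
      · rw [yosida_comm hB (hε m)]
        refine (norm_yosida_map_le hB (hε n) _).trans ((norm_yosida_map_le hB (hε m) _).trans ?_)
        refine (norm_add_le _ _).trans ?_
        rw [norm_smul, norm_neg]
        change _ ≤ ‖α‖ * √(M t) + ‖B (y t)‖
        gcongr
        exact hzM m t ht
  obtain ⟨p, hpc, -, hp⟩ := exists_limit_of_cauchy_rate
    (fun n => B.continuous.comp (B.continuous.comp (hzc n))) hκc hcauchy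
  replace hp : ∀ n t, 0 ≤ t → ‖B (B (z n t)) - p t‖ ≤ 1 / ((n : ℝ) + 1) * κ t := hp
  have hqc : Continuous fun t => B (B (B (y t))) - α • p t :=
    (B.continuous.comp (B.continuous.comp (B.continuous.comp hy))).sub (hpc.const_smul α)
  refine ⟨fun t => B (B (B x)) + ∫ s in (0 : ℝ)..t, (B (B (B (y s))) - α • p s), p,
    ⟨hpc, B.continuous.comp (B.continuous.comp (B.continuous.comp hy)), fun t => ?_,
      fun t ht => ?_⟩, by simp⟩
  · exact (hqc.integral_hasStrictDerivAt 0 t).hasDerivAt.const_add _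
  -- pass to the limit in the integrated equation for `B³ zₙ`
  · let κ' : ℝ → ℝ := fun s => ‖α‖ * κ s + (‖α‖ * (‖B‖ * √(M s)) + ‖B (B (y s))‖)
    have hκ'c : Continuous κ' := (continuous_const.mul hκc).add
      ((continuous_const.mul (continuous_const.mul hMc.sqrt)).add
        (B.continuous.comp (B.continuous.comp hy)).norm)
    have hBBB : ∀ n t, HasDerivAt (fun t => B (B (B (z n t))))
        (A n (B (-α • B (B (z n t)) + B (B (B (y t)))))) t := by
      intro n t
      refine ((B.restrictScalars ℝ).hasFDerivAt.comp_hasDerivAt t (hBz n t)).congr_deriv ?_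
      change B _ = _
      simp only [map_add, map_smul, A, yosida_comm hB (hε n)]
    have hdc : ∀ n, Continuous fun t => A n (B (-α • B (B (z n t)) + B (B (B (y t))))) :=
      fun n => by have := hzc n; fun_prop
    have hbound : ∀ n : ℕ, ‖B (B (B x)) + (∫ s in (0 : ℝ)..t, (B (B (B (y s))) - α • p s)) -
        B (p t)‖ ≤ 1 / ((n : ℝ) + 1) * ((∫ s in (0 : ℝ)..t, κ' s) + ‖B‖ * κ t) := by
      intro n
      have hftc := intervalIntegral.integral_eq_sub_of_hasDerivAt (a := 0) (b := t)
        (fun s _ => hBBB n s) ((hdc n).intervalIntegrable 0 t)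
      rw [hz0] at hftc
      have hdiff : ‖(∫ s in (0 : ℝ)..t, (B (B (B (y s))) - α • p s)) -
          ∫ s in (0 : ℝ)..t, A n (B (-α • B (B (z n s)) + B (B (B (y s)))))‖ ≤
          ∫ s in (0 : ℝ)..t, 1 / ((n : ℝ) + 1) * κ' s := by
        rw [← intervalIntegral.integral_sub (hqc.intervalIntegrable 0 t)
          ((hdc n).intervalIntegrable 0 t)]
        refine intervalIntegral.norm_integral_le_of_norm_le ht ?_
          ((continuous_const.mul hκ'c).intervalIntegrable 0 t)
        refine Eventually.of_forall fun s hs => ?_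
        have hs0 : 0 ≤ s := hs.1.le
        set P := -α • B (B (z n s)) + B (B (B (y s))) with hP
        have h1 : A n (B P) = P - ((ε n : ℝ) : ℂ) • A n P := by
          rw [eq_sub_iff_add_eq]
          simp only [A]
          rw [yosida_comm hB (hε n)]
          exact add_yosida_apply hB (hε n) P
        have h2 : P = B (-α • B (z n s) + B (B (y s))) := by
          simp only [hP, map_add, map_smul]
        have h3 : ‖A n P‖ ≤ ‖α‖ * (‖B‖ * √(M s)) + ‖B (B (y s))‖ := by
          rw [h2]
          refine (norm_yosida_map_le hB (hε n) _).trans ((norm_add_le _ _).trans ?_)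
          rw [norm_smul, norm_neg]
          gcongr
          refine (B.le_opNorm _).trans ?_
          gcongr
          exact hzM n s hs0
        have h4 : B (B (B (y s))) - α • p s - A n (B P) =
            α • (B (B (z n s)) - p s) + ((ε n : ℝ) : ℂ) • A n P := by
          rw [h1, hP]; module
        rw [h4]
        refine (norm_add_le _ _).trans ?_
        rw [norm_smul, norm_smul, Complex.norm_real, Real.norm_eq_abs, abs_of_pos (hε n)]
        have h5 := mul_le_mul_of_nonneg_left (hp n s hs0) (norm_nonneg α)
        have h6 := mul_le_mul_of_nonneg_left h3 (hε n).le
        simp only [κ']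
        have : ε n = 1 / ((n : ℝ) + 1) := rfl
        rw [this] at h6 ⊢
        linarith
      have hB1 : ‖B (B (B (z n t))) - B (p t)‖ ≤ ‖B‖ * (1 / ((n : ℝ) + 1) * κ t) := by
        rw [← map_sub]
        exact (B.le_opNorm _).trans (by gcongr; exact hp n t ht)
      rw [intervalIntegral.integral_const_mul] at hdiff
      have e1 : B (B (B x)) + (∫ s in (0 : ℝ)..t, (B (B (B (y s))) - α • p s)) - B (p t) =
          ((∫ s in (0 : ℝ)..t, (B (B (B (y s))) - α • p s)) -
            ∫ s in (0 : ℝ)..t, A n (B (-α • B (B (z n s)) + B (B (B (y s)))))) +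
          (B (B (B (z n t))) - B (p t)) := by
        rw [hftc]; abel
      rw [e1]
      refine (norm_add_le _ _).trans ((add_le_add hdiff hB1).trans (le_of_eq ?_))
      ring
    have h0 : Tendsto (fun n : ℕ => 1 / ((n : ℝ) + 1) *
        ((∫ s in (0 : ℝ)..t, κ' s) + ‖B‖ * κ t)) atTop (𝓝 0) := by
      simpa using (tendsto_one_div_add_atTop_nhds_zero_nat (𝕜 := ℝ)).mul_const
        ((∫ s in (0 : ℝ)..t, κ' s) + ‖B‖ * κ t)
    have := ge_of_tendsto' h0 hbound
    exact sub_eq_zero.1 (norm_le_zero_iff.1 this)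

end Regular

/-! ### Energy estimates and linear solutions -/

section Linear

variable {V : Type*} [NormedAddCommGroup V] [InnerProductSpace ℂ V]
  {X : Type*} [NormedAddCommGroup X] [NormedSpace ℂ X]
  {H : Type*} [NormedAddCommGroup H] [InnerProductSpace ℂ H]
  {B : V →L[ℂ] V} {α : ℂ}

theorem two_mul_le_div_add (a b : ℝ) {r : ℝ} (hr : 0 < r) :
    2 * (a * b) ≤ a ^ 2 / r + r * b ^ 2 := by
  have : a ^ 2 / r + r * b ^ 2 - 2 * (a * b) = (a - r * b) ^ 2 / r := by
    field_simp
    ring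
  rw [← sub_nonneg, this]
  positivity

namespace IsRegularSolution

variable {u p g u₂ p₂ g₂ : ℝ → V}

theorem continuous (h : IsRegularSolution B α u p g) : Continuous u :=
  continuous_iff_continuousAt.2 fun t => (h.hasDerivAt t).continuousAt

theorem continuous_deriv (h : IsRegularSolution B α u p g) : Continuous fun t => g t - α • p t :=
  h.continuous_g.sub (h.continuous_p.const_smul α)

theorem sub (h : IsRegularSolution B α u p g) (h₂ : IsRegularSolution B α u₂ p₂ g₂) :
    IsRegularSolution B α (fun t => u t - u₂ t) (fun t => p t - p₂ t) (fun t => g t - g₂ t) where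
  continuous_p := h.continuous_p.sub h₂.continuous_p
  continuous_g := h.continuous_g.sub h₂.continuous_g
  hasDerivAt t := ((h.hasDerivAt t).sub (h₂.hasDerivAt t)).congr_deriv (by module)
  eq_map t ht := by rw [h.eq_map t ht, h₂.eq_map t ht, map_sub]

theorem zero : IsRegularSolution B α (0 : ℝ → V) 0 0 where
  continuous_p := continuous_const
  continuous_g := continuous_const
  hasDerivAt t := by simp
  eq_map t _ := by simp

/-- The energy estimate for `‖u‖²` that holds as soon as `Re α ≥ 0`. -/
theorem norm_sq_le [CompleteSpace V] (hB : B.IsPositive) (hα : 0 ≤ α.re)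
    (h : IsRegularSolution B α u p g) {t : ℝ} (ht : 0 ≤ t) :
    ‖u t‖ ^ 2 ≤ Real.exp t * (‖u 0‖ ^ 2 + ∫ s in (0 : ℝ)..t, ‖g s‖ ^ 2) := by
  refine norm_sq_le_of_inner_le (r := fun t => ‖g t‖ ^ 2) (h.continuous_g.norm.pow 2)
    (fun t => by positivity) (fun t _ => h.hasDerivAt t) (fun t ht => ?_) ht
  obtain ⟨q, hq0, hq⟩ := re_inner_map_eq hB (p t)
  have h2 : (inner ℂ (u t) (g t)).re ≤ ‖u t‖ * ‖g t‖ :=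
    (Complex.re_le_norm _).trans (norm_inner_le_norm _ _)
  have h3 : inner ℂ (u t) (p t) = q := by rw [h.eq_map t ht, hq]
  rw [inner_sub_right, inner_smul_right, h3, Complex.sub_re, Complex.re_mul_ofReal]
  nlinarith [mul_nonneg hα hq0, sq_nonneg (‖u t‖ - ‖g t‖)]

/-- The energy identity behind the parabolic estimates: in the pairing of `u = B p` with `u'`,
the function `p` is expressed through the equation as `α⁻¹ (g - u')`, and `B` turns the inner
product of `V` into that of `H`. -/
theorem inner_deriv_eq {J : V →L[ℂ] H} (hBJ : ∀ x y, inner ℂ (B x) y = inner ℂ (J x) (J y))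
    (hα : α ≠ 0) (h : IsRegularSolution B α u p g) {t : ℝ} (ht : 0 ≤ t) :
    inner ℂ (u t) (g t - α • p t) =
      inner ℂ (α⁻¹ • J (g t)) (J (g t - α • p t)) -
        (conj α⁻¹) * (‖J (g t - α • p t)‖ : ℂ) ^ 2 := by
  have h1 : p t = α⁻¹ • (g t - (g t - α • p t)) := by
    rw [sub_sub_cancel, smul_smul, inv_mul_cancel₀ hα, one_smul]
  set w := g t - α • p t with hw
  rw [h.eq_map t ht, hBJ]
  nth_rewrite 1 [h1]
  rw [map_smul, map_sub, smul_sub, inner_sub_left, inner_smul_left (J w) (J w),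
    inner_self_eq_norm_sq_to_K]
  rfl

/-- The energy identity after absorbing `J u'` by Young's inequality, which needs `Re α > 0`. -/
theorem two_re_inner_deriv_le {J : V →L[ℂ] H}
    (hBJ : ∀ x y, inner ℂ (B x) y = inner ℂ (J x) (J y))
    (hα : 0 < α.re) (h : IsRegularSolution B α u p g) {t : ℝ} (ht : 0 ≤ t) :
    2 * (inner ℂ (u t) (g t - α • p t)).re ≤
      ‖α⁻¹‖ ^ 2 / (α⁻¹).re * ‖J (g t)‖ ^ 2 - (α⁻¹).re * ‖J (g t - α • p t)‖ ^ 2 := by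
  have hα0 : α ≠ 0 := by rintro rfl; simp at hα
  have hβ : 0 < (α⁻¹).re := by
    rw [Complex.inv_re]; exact div_pos hα (Complex.normSq_pos.2 hα0)
  rw [h.inner_deriv_eq hBJ hα0 ht]
  set w := g t - α • p t
  have h1 : (inner ℂ (α⁻¹ • J (g t)) (J w)).re ≤ ‖α⁻¹‖ * ‖J (g t)‖ * ‖J w‖ := by
    refine (Complex.re_le_norm _).trans ((norm_inner_le_norm _ _).trans ?_)
    rw [norm_smul]
  have h2 : ((conj α⁻¹) * (‖J w‖ : ℂ) ^ 2).re = (α⁻¹).re * ‖J w‖ ^ 2 := by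
    rw [← Complex.ofReal_pow, Complex.re_mul_ofReal, Complex.conj_re]
  rw [Complex.sub_re, h2]
  have h3 : 2 * (‖α⁻¹‖ * ‖J (g t)‖ * ‖J w‖) ≤
      ‖α⁻¹‖ ^ 2 / (α⁻¹).re * ‖J (g t)‖ ^ 2 + (α⁻¹).re * ‖J w‖ ^ 2 := by
    have := two_mul_le_div_add (‖α⁻¹‖ * ‖J (g t)‖) ‖J w‖ hβ
    rwa [mul_pow, ← div_mul_eq_mul_div] at this
  linarith

/-- Maximal regularity: `u'` is bounded in `L²(0, t; H)` by the initial value in `V` and the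
forcing in `L²(0, t; H)`. -/
theorem norm_sq_add_integral_le {J : V →L[ℂ] H}
    (hBJ : ∀ x y, inner ℂ (B x) y = inner ℂ (J x) (J y))
    (hα : 0 < α.re) (h : IsRegularSolution B α u p g) {t : ℝ} (ht : 0 ≤ t) :
    ‖u t‖ ^ 2 + (α⁻¹).re * ∫ s in (0 : ℝ)..t, ‖J (g s - α • p s)‖ ^ 2 ≤
      ‖u 0‖ ^ 2 + ‖α⁻¹‖ ^ 2 / (α⁻¹).re * ∫ s in (0 : ℝ)..t, ‖J (g s)‖ ^ 2 := by
  have hw : Continuous fun s => J (g s - α • p s) := J.continuous.comp h.continuous_deriv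
  have hg : Continuous fun s => J (g s) := J.continuous.comp h.continuous_g
  have hd : Continuous fun s => 2 * (inner ℂ (u s) (g s - α • p s)).re :=
    continuous_const.mul (Complex.continuous_re.comp (h.continuous.inner h.continuous_deriv))
  have hftc := intervalIntegral.integral_eq_sub_of_hasDerivAt (a := 0) (b := t)
    (fun s _ => hasDerivAt_re_inner_self (h.hasDerivAt s)) (hd.intervalIntegrable 0 t)
  have hc1 : Continuous fun s => ‖α⁻¹‖ ^ 2 / (α⁻¹).re * ‖J (g s)‖ ^ 2 :=
    continuous_const.mul (hg.norm.pow 2)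
  have hc2 : Continuous fun s => (α⁻¹).re * ‖J (g s - α • p s)‖ ^ 2 :=
    continuous_const.mul (hw.norm.pow 2)
  have hle := intervalIntegral.integral_mono_on ht (hd.intervalIntegrable 0 t)
    ((hc1.sub hc2).intervalIntegrable (μ := volume) 0 t)
    (fun s hs => h.two_re_inner_deriv_le hBJ hα hs.1)
  simp only [Pi.sub_apply] at hle
  rw [hftc, intervalIntegral.integral_sub (hc1.intervalIntegrable 0 t)
    (hc2.intervalIntegrable 0 t), intervalIntegral.integral_const_mul,
    intervalIntegral.integral_const_mul] at hle
  linarith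

end IsRegularSolution

/-- Regular solutions are bounded in `V` by their initial value and by the `L²(0, t; X)` norm of
their forcing, the forcing being measured through `G : V → X`: for `G = id` this is the estimate
of a Schrödinger equation, for `G = J` that of a parabolic equation. -/
def StabilityEstimate (B : V →L[ℂ] V) (α : ℂ) (G : V →L[ℂ] X) (C : ℝ) : Prop :=
  ∀ u p g : ℝ → V, IsRegularSolution B α u p g → ∀ t, 0 ≤ t →
    ‖u t‖ ^ 2 ≤ Real.exp t * (‖u 0‖ ^ 2 + C * ∫ s in (0 : ℝ)..t, ‖G (g s)‖ ^ 2)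

theorem stabilityEstimate_id [CompleteSpace V] (hB : B.IsPositive) (hα : 0 ≤ α.re) :
    StabilityEstimate B α (ContinuousLinearMap.id ℂ V) 1 := by
  intro u p g h t ht
  simpa using h.norm_sq_le hB hα ht

theorem stabilityEstimate_parabolic {J : V →L[ℂ] H}
    (hBJ : ∀ x y, inner ℂ (B x) y = inner ℂ (J x) (J y)) (hα : 0 < α.re) :
    StabilityEstimate B α J (‖α⁻¹‖ ^ 2 / (α⁻¹).re) := by
  intro u p g h t ht
  have hβ : 0 < (α⁻¹).re := by
    rw [Complex.inv_re]
    exact div_pos hα (Complex.normSq_pos.2 (by rintro rfl; simp at hα))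
  have h1 := h.norm_sq_add_integral_le hBJ hα ht
  have h2 : 0 ≤ ∫ s in (0 : ℝ)..t, ‖J (g s - α • p s)‖ ^ 2 :=
    intervalIntegral.integral_nonneg ht fun s _ => by positivity
  have h3 : 0 ≤ ∫ s in (0 : ℝ)..t, ‖J (g s)‖ ^ 2 :=
    intervalIntegral.integral_nonneg ht fun s _ => by positivity
  have h4 : ‖u t‖ ^ 2 ≤ ‖u 0‖ ^ 2 + ‖α⁻¹‖ ^ 2 / (α⁻¹).re * ∫ s in (0 : ℝ)..t, ‖J (g s)‖ ^ 2 := by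
    nlinarith [mul_nonneg hβ.le h2]
  exact h4.trans (le_mul_of_one_le_left (by positivity) (Real.one_le_exp ht))

/-- `v` is a solution of `v' + α B⁻¹ v = F`, `v(0) = u₀`, with a forcing `F` in `X`, obtained as
a limit of regular solutions: their forcings `gₙ` satisfy `‖G gₙ - F‖ ≤ 1 / (n + 1)`, and they
converge in `V` at the rate `1 / (n + 1)`, locally uniformly on `[0, ∞)`. For negative times `v`
is constant. -/
structure IsLinearSolution (B : V →L[ℂ] V) (α : ℂ) (G : V →L[ℂ] X) (u₀ : V) (F : ℝ → X)
    (v : ℝ → V) : Prop where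
  continuous : Continuous v
  eq_of_nonpos : ∀ t ≤ 0, v t = u₀
  approx : ∃ (u p g : ℕ → ℝ → V) (κ : ℝ → ℝ), Continuous κ ∧
    (∀ n, IsRegularSolution B α (u n) (p n) (g n)) ∧
    (∀ n t, ‖G (g n t) - F t‖ ≤ 1 / ((n : ℝ) + 1)) ∧
    ∀ n t, 0 ≤ t → ‖u n t - v t‖ ≤ 1 / ((n : ℝ) + 1) * κ t

/-- Continuous curves lift approximately through a map of dense range, by a partition of unity. -/
theorem exists_continuous_approx {G : V →L[ℂ] X} (hG : DenseRange G) {F : ℝ → X}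
    (hF : Continuous F) {ε : ℝ} (hε : 0 < ε) :
    ∃ y : ℝ → V, Continuous y ∧ ∀ t, ‖G (y t) - F t‖ < ε := by
  have hconv : ∀ t, Convex ℝ {x : V | ‖G x - F t‖ < ε} := by
    intro t
    have h1 := (convex_ball (F t) ε).linear_preimage (G.restrictScalars ℝ : V →ₗ[ℝ] X)
    have e : {x : V | ‖G x - F t‖ < ε} =
        (G.restrictScalars ℝ : V →ₗ[ℝ] X) ⁻¹' Metric.ball (F t) ε := by
      ext x
      simp [dist_eq_norm]
    exact e ▸ h1
  have hloc : ∀ t, ∃ x : V, ∀ᶠ s in 𝓝 t, x ∈ {x : V | ‖G x - F s‖ < ε} := by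
    intro t
    obtain ⟨x, hx⟩ := hG.exists_dist_lt (F t) hε
    refine ⟨x, ?_⟩
    have : Continuous fun s => ‖G x - F s‖ := (continuous_const.sub hF).norm
    refine this.continuousAt.eventually_lt continuousAt_const ?_
    rwa [← dist_eq_norm, dist_comm]
  obtain ⟨y, hy⟩ := exists_continuous_forall_mem_convex_of_local_const hconv hloc
  exact ⟨y, y.continuous, hy⟩

theorem exists_isLinearSolution [CompleteSpace V] (hB : B.IsPositive) (hBd : DenseRange B)
    (hα : 0 ≤ α.re) {G : V →L[ℂ] X} (hG : DenseRange G) {C : ℝ} (hC0 : 0 ≤ C)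
    (hC : StabilityEstimate B α G C) (u₀ : V) {F : ℝ → X} (hF : Continuous F) :
    ∃ v, IsLinearSolution B α G u₀ F v := by
  have hB3 : DenseRange (B.comp (B.comp B)) :=
    hBd.comp (hBd.comp hBd B.continuous) B.continuous
  have hGB3 : DenseRange (G.comp (B.comp (B.comp B))) := hG.comp hB3 G.continuous
  have hex : ∀ n : ℕ, ∃ u p g : ℝ → V, IsRegularSolution B α u p g ∧
      (∀ t, ‖G (g t) - F t‖ ≤ 1 / ((n : ℝ) + 1)) ∧ ‖u 0 - u₀‖ ≤ 1 / ((n : ℝ) + 1) := by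
    intro n
    obtain ⟨y, hy, hyF⟩ := exists_continuous_approx hGB3 hF (Nat.one_div_pos_of_nat (n := n))
    obtain ⟨x, hx⟩ := hB3.exists_dist_lt u₀ (Nat.one_div_pos_of_nat (n := n))
    obtain ⟨u, p, h, h0⟩ := exists_isRegularSolution hB hα x hy
    refine ⟨u, p, _, h, fun t => (hyF t).le, ?_⟩
    rw [h0, ← dist_eq_norm, dist_comm]
    exact hx.le
  choose u p g h hg hu0 using hex
  let κ : ℝ → ℝ := fun t => √(Real.exp t * (1 + C * t))
  have hκ : Continuous κ := by fun_prop
  have hcauchy : ∀ n m t, 0 ≤ t → ‖u n t - u m t‖ ≤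
      (1 / ((n : ℝ) + 1) + 1 / ((m : ℝ) + 1)) * κ t := by
    intro n m t ht
    set e : ℝ := 1 / ((n : ℝ) + 1) + 1 / ((m : ℝ) + 1) with he
    have he0 : 0 ≤ e := by positivity
    have h1 := hC _ _ _ ((h n).sub (h m)) t ht
    have h2 : ‖u n 0 - u m 0‖ ≤ e := by
      rw [← sub_sub_sub_cancel_right (u n 0) (u m 0) u₀]
      exact (norm_sub_le _ _).trans (add_le_add (hu0 n) (hu0 m))
    have h3 : ∀ s, ‖G (g n s - g m s)‖ ≤ e := by
      intro s
      rw [map_sub, ← sub_sub_sub_cancel_right (G (g n s)) (G (g m s)) (F s)]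
      exact (norm_sub_le _ _).trans (add_le_add (hg n s) (hg m s))
    have h4 : ∫ s in (0 : ℝ)..t, ‖G (g n s - g m s)‖ ^ 2 ≤ ∫ s in (0 : ℝ)..t, e ^ 2 := by
      refine intervalIntegral.integral_mono_on ht ?_ (by simp) fun s _ => ?_
      · exact ((G.continuous.comp ((h n).sub (h m)).continuous_g).norm.pow 2).intervalIntegrable _ _
      · have := h3 s
        gcongr
    rw [intervalIntegral.integral_const, sub_zero, smul_eq_mul] at h4
    have h5 : ‖u n t - u m t‖ ^ 2 ≤ (e * κ t) ^ 2 := by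
      rw [mul_pow, Real.sq_sqrt (by positivity)]
      calc _ ≤ _ := h1
        _ ≤ Real.exp t * (e ^ 2 + C * (t * e ^ 2)) := by gcongr
        _ = _ := by ring
    exact (abs_le_of_sq_le_sq' h5 (by positivity)).2
  obtain ⟨v, hv, hv0, hlim⟩ := exists_limit_of_cauchy_rate (fun n => (h n).continuous) hκ hcauchy
  refine ⟨v, hv, fun t ht => ?_, u, p, g, κ, hκ, h, hg, hlim⟩
  rw [hv0 t ht]
  have h1 : Tendsto (fun n => u n 0 - v 0) atTop (𝓝 0) := by
    refine squeeze_zero_norm (fun n => hlim n 0 le_rfl) ?_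
    simpa using (tendsto_one_div_add_atTop_nhds_zero_nat (𝕜 := ℝ)).mul_const (κ 0)
  have h2 : Tendsto (fun n => u n 0 - u₀) atTop (𝓝 0) :=
    squeeze_zero_norm hu0 tendsto_one_div_add_atTop_nhds_zero_nat
  have h3 := tendsto_nhds_unique ((h2.sub h1).congr fun n => by abel)
    (tendsto_const_nhds (x := v 0 - u₀))
  rw [sub_zero] at h3
  exact sub_eq_zero.1 h3.symm

/-- Stability of linear solutions; it contains their uniqueness. -/
theorem IsLinearSolution.norm_sub_sq_le {G : V →L[ℂ] X} {C : ℝ} (hC0 : 0 ≤ C)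
    (hC : StabilityEstimate B α G C) {u₁ u₂ : V} {F₁ F₂ : ℝ → X} {v₁ v₂ : ℝ → V}
    (hF₁ : Continuous F₁) (hF₂ : Continuous F₂)
    (h₁ : IsLinearSolution B α G u₁ F₁ v₁) (h₂ : IsLinearSolution B α G u₂ F₂ v₂)
    {t : ℝ} (ht : 0 ≤ t) :
    ‖v₁ t - v₂ t‖ ^ 2 ≤
      Real.exp t * (‖u₁ - u₂‖ ^ 2 + 2 * C * ∫ s in (0 : ℝ)..t, ‖F₁ s - F₂ s‖ ^ 2) := by
  obtain ⟨U₁, p₁, g₁, κ₁, -, hr₁, hg₁, hU₁⟩ := h₁.approx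
  obtain ⟨U₂, p₂, g₂, κ₂, -, hr₂, hg₂, hU₂⟩ := h₂.approx
  have hlim : ∀ {U : ℕ → ℝ → V} {κ : ℝ → ℝ} {v : ℝ → V}
      (_ : ∀ n t, 0 ≤ t → ‖U n t - v t‖ ≤ 1 / ((n : ℝ) + 1) * κ t) {s : ℝ} (_ : 0 ≤ s),
      Tendsto (fun n => U n s) atTop (𝓝 (v s)) := by
    intro U κ v hU s hs
    rw [tendsto_iff_norm_sub_tendsto_zero]
    refine squeeze_zero (fun _ => norm_nonneg _) (fun n => hU n s hs) ?_
    simpa using (tendsto_one_div_add_atTop_nhds_zero_nat (𝕜 := ℝ)).mul_const (κ s)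
  have hl : Tendsto (fun n => ‖U₁ n t - U₂ n t‖ ^ 2) atTop (𝓝 (‖v₁ t - v₂ t‖ ^ 2)) :=
    ((hlim hU₁ ht).sub (hlim hU₂ ht)).norm.pow 2
  have hl0 : Tendsto (fun n => ‖U₁ n 0 - U₂ n 0‖ ^ 2) atTop (𝓝 (‖u₁ - u₂‖ ^ 2)) := by
    have := ((hlim hU₁ le_rfl).sub (hlim hU₂ le_rfl)).norm.pow 2
    rwa [h₁.eq_of_nonpos 0 le_rfl, h₂.eq_of_nonpos 0 le_rfl] at this
  set I := ∫ s in (0 : ℝ)..t, ‖F₁ s - F₂ s‖ ^ 2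
  have hr : Tendsto (fun n : ℕ => Real.exp t * (‖U₁ n 0 - U₂ n 0‖ ^ 2 +
      C * (2 * I + 8 * (1 / ((n : ℝ) + 1)) ^ 2 * t))) atTop
      (𝓝 (Real.exp t * (‖u₁ - u₂‖ ^ 2 + C * (2 * I + 8 * 0 ^ 2 * t)))) :=
    (hl0.add ((tendsto_const_nhds.add (((tendsto_one_div_add_atTop_nhds_zero_nat.pow 2).const_mul
      8).mul_const t)).const_mul C)).const_mul _
  refine (le_of_tendsto_of_tendsto' hl hr fun n => ?_).trans (le_of_eq (by ring))
  refine (hC _ _ _ ((hr₁ n).sub (hr₂ n)) t ht).trans ?_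
  gcongr
  have hc : Continuous fun s => ‖F₁ s - F₂ s‖ ^ 2 := (hF₁.sub hF₂).norm.pow 2
  calc ∫ s in (0 : ℝ)..t, ‖G (g₁ n s - g₂ n s)‖ ^ 2
      ≤ ∫ s in (0 : ℝ)..t, (2 * ‖F₁ s - F₂ s‖ ^ 2 + 8 * (1 / ((n : ℝ) + 1)) ^ 2) := by
        refine intervalIntegral.integral_mono_on ht ?_ ?_ fun s _ => ?_
        · exact ((G.continuous.comp ((hr₁ n).sub (hr₂ n)).continuous_g).norm.pow 2
            ).intervalIntegrable _ _
        · exact ((continuous_const.mul hc).add continuous_const).intervalIntegrable _ _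
        · have h1 : ‖G (g₁ n s - g₂ n s)‖ ≤ ‖F₁ s - F₂ s‖ + 2 * (1 / ((n : ℝ) + 1)) := by
            have e : G (g₁ n s - g₂ n s) =
              (F₁ s - F₂ s) + ((G (g₁ n s) - F₁ s) - (G (g₂ n s) - F₂ s)) := by
              rw [map_sub]; abel
            rw [e]
            refine (norm_add_le _ _).trans ?_
            have := (norm_sub_le (G (g₁ n s) - F₁ s) (G (g₂ n s) - F₂ s)).trans
              (add_le_add (hg₁ n s) (hg₂ n s))
            linarith
          have h2 := pow_le_pow_left₀ (norm_nonneg _) h1 2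
          nlinarith [sq_nonneg (‖F₁ s - F₂ s‖ - 2 * (1 / ((n : ℝ) + 1)))]
    _ = 2 * I + 8 * (1 / ((n : ℝ) + 1)) ^ 2 * t := by
        have hc' : Continuous fun s => 2 * ‖F₁ s - F₂ s‖ ^ 2 := continuous_const.mul hc
        rw [intervalIntegral.integral_add (hc'.intervalIntegrable _ _) (by simp),
          intervalIntegral.integral_const_mul, intervalIntegral.integral_const]
        simp [I]
        ring

theorem IsLinearSolution.norm_sq_le {G : V →L[ℂ] X} {C : ℝ} (hC0 : 0 ≤ C)
    (hC : StabilityEstimate B α G C) {u₀ : V} {F : ℝ → X} {v : ℝ → V}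
    (hF : Continuous F) (h : IsLinearSolution B α G u₀ F v) {t : ℝ} (ht : 0 ≤ t) :
    ‖v t‖ ^ 2 ≤ Real.exp t * (‖u₀‖ ^ 2 + 2 * C * ∫ s in (0 : ℝ)..t, ‖F s‖ ^ 2) := by
  have h0 : IsLinearSolution B α G 0 (fun _ => (0 : X)) (fun _ => (0 : V)) :=
    ⟨continuous_const, fun _ _ => rfl, fun _ => 0, fun _ => 0, fun _ => 0, fun _ => 0,
      continuous_const, fun _ => IsRegularSolution.zero, fun n t => by simp; positivity,
      fun n t _ => by simp⟩
  simpa only [sub_zero] using h.norm_sub_sq_le hC0 hC hF continuous_const h0 ht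

/-- The equation tested with `B ψ` in `V`, which is the equation tested with `J ψ` in `H`, and
integrated in time. -/
theorem IsLinearSolution.weak_eq {J : V →L[ℂ] H}
    (hBJ : ∀ x y, inner ℂ (B x) y = inner ℂ (J x) (J y))
    {G : V →L[ℂ] X} {Q : X →L[ℂ] H} (hQ : ∀ x, Q (G x) = J x)
    {u₀ : V} {F : ℝ → X} {v : ℝ → V} (hF : Continuous F)
    (h : IsLinearSolution B α G u₀ F v) (ψ : V) {t : ℝ} (ht : 0 ≤ t) :
    inner ℂ (J ψ) (J (v t)) = inner ℂ (J ψ) (J u₀) +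
      ∫ s in (0 : ℝ)..t, (inner ℂ (J ψ) (Q (F s)) - α * inner ℂ ψ (v s)) := by
  obtain ⟨U, p, g, κ, hκ, hr, hg, hU⟩ := h.approx
  have hv := h.continuous
  have hBJ' : ∀ x, inner ℂ (J ψ) (J x) = inner ℂ ψ (B x) := fun x => by
    rw [← inner_conj_symm, ← hBJ, inner_conj_symm]
  let c : ℝ := ‖J ψ‖ * ‖J‖
  let I : ℝ := ∫ s in (0 : ℝ)..t, (‖J ψ‖ * ‖Q‖ + ‖α‖ * (‖ψ‖ * κ s))
  have hb : ∀ n : ℕ, ‖inner ℂ (J ψ) (J (v t)) - (inner ℂ (J ψ) (J u₀) +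
      ∫ s in (0 : ℝ)..t, (inner ℂ (J ψ) (Q (F s)) - α * inner ℂ ψ (v s)))‖ ≤
      1 / ((n : ℝ) + 1) * (c * κ t + c * κ 0 + I) := by
    intro n
    have hUn := (hr n).continuous
    have hgn := (hr n).continuous_g
    have hd : ∀ s, HasDerivAt (fun s => inner ℂ (J ψ) (J (U n s)))
        (inner ℂ (J ψ) (J (g n s - α • p n s))) s := fun s =>
      (((innerSL ℂ (J ψ)).comp J).restrictScalars ℝ).hasFDerivAt.comp_hasDerivAt s
        ((hr n).hasDerivAt s)
    have hdc : Continuous fun s => inner ℂ (J ψ) (J (g n s - α • p n s)) :=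
      continuous_const.inner (J.continuous.comp (hr n).continuous_deriv)
    have hftc := intervalIntegral.integral_eq_sub_of_hasDerivAt (a := 0) (b := t)
      (fun s _ => hd s) (hdc.intervalIntegrable 0 t)
    have hlc : Continuous fun s => inner ℂ (J ψ) (Q (F s)) - α * inner ℂ ψ (v s) := by fun_prop
    have hint : ‖(∫ s in (0 : ℝ)..t, inner ℂ (J ψ) (J (g n s - α • p n s))) -
        ∫ s in (0 : ℝ)..t, (inner ℂ (J ψ) (Q (F s)) - α * inner ℂ ψ (v s))‖ ≤
        ∫ s in (0 : ℝ)..t, 1 / ((n : ℝ) + 1) * (‖J ψ‖ * ‖Q‖ + ‖α‖ * (‖ψ‖ * κ s)) := by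
      rw [← intervalIntegral.integral_sub (hdc.intervalIntegrable 0 t)
        (hlc.intervalIntegrable 0 t)]
      refine intervalIntegral.norm_integral_le_of_norm_le ht (Eventually.of_forall fun s hs => ?_)
        ((by fun_prop : Continuous _).intervalIntegrable 0 t)
      have hs0 : 0 ≤ s := hs.1.le
      have e : inner ℂ (J ψ) (J (g n s - α • p n s)) -
          (inner ℂ (J ψ) (Q (F s)) - α * inner ℂ ψ (v s)) =
          inner ℂ (J ψ) (Q (G (g n s) - F s)) - α * inner ℂ ψ (U n s - v s) := by
        rw [map_sub, map_smul, inner_sub_right, inner_smul_right, hBJ' (p n s),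
          ← (hr n).eq_map s hs0, map_sub, hQ, inner_sub_right, inner_sub_right]
        ring
      rw [e]
      refine (norm_sub_le _ _).trans ?_
      rw [norm_mul]
      have h1 : ‖inner ℂ (J ψ) (Q (G (g n s) - F s))‖ ≤ ‖J ψ‖ * (‖Q‖ * (1 / ((n : ℝ) + 1))) := by
        refine (norm_inner_le_norm _ _).trans ?_
        gcongr
        refine (Q.le_opNorm _).trans ?_
        gcongr
        exact hg n s
      have h2 : ‖inner ℂ ψ (U n s - v s)‖ ≤ ‖ψ‖ * (1 / ((n : ℝ) + 1) * κ s) := by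
        refine (norm_inner_le_norm _ _).trans ?_
        gcongr
        exact hU n s hs0
      have h3 := mul_le_mul_of_nonneg_left h2 (norm_nonneg α)
      linarith
    rw [intervalIntegral.integral_const_mul] at hint
    have hJ : ∀ s, 0 ≤ s → ‖inner ℂ (J ψ) (J (v s)) - inner ℂ (J ψ) (J (U n s))‖ ≤
        1 / ((n : ℝ) + 1) * (c * κ s) := by
      intro s hs
      rw [← inner_sub_right, ← map_sub]
      refine (norm_inner_le_norm _ _).trans ?_
      have h1 : ‖J (v s - U n s)‖ ≤ ‖J‖ * (1 / ((n : ℝ) + 1) * κ s) := by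
        refine (J.le_opNorm _).trans ?_
        rw [norm_sub_rev]
        gcongr
        exact hU n s hs
      refine (mul_le_mul_of_nonneg_left h1 (norm_nonneg _)).trans (le_of_eq ?_)
      simp only [c]; ring
    have h0 := hJ 0 le_rfl
    rw [h.eq_of_nonpos 0 le_rfl, norm_sub_rev] at h0
    have e : inner ℂ (J ψ) (J (v t)) - (inner ℂ (J ψ) (J u₀) +
        ∫ s in (0 : ℝ)..t, (inner ℂ (J ψ) (Q (F s)) - α * inner ℂ ψ (v s))) =
        (inner ℂ (J ψ) (J (v t)) - inner ℂ (J ψ) (J (U n t))) +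
        (inner ℂ (J ψ) (J (U n 0)) - inner ℂ (J ψ) (J u₀)) +
        ((∫ s in (0 : ℝ)..t, inner ℂ (J ψ) (J (g n s - α • p n s))) -
        ∫ s in (0 : ℝ)..t, (inner ℂ (J ψ) (Q (F s)) - α * inner ℂ ψ (v s))) := by
      rw [hftc]; ring
    rw [e]
    refine (norm_add₃_le).trans ((add_le_add_three (hJ t ht) h0 hint).trans (le_of_eq ?_))
    simp only [I]
    ring
  have h0 : Tendsto (fun n : ℕ => 1 / ((n : ℝ) + 1) * (c * κ t + c * κ 0 + I)) atTop (𝓝 0) := by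
    simpa using (tendsto_one_div_add_atTop_nhds_zero_nat (𝕜 := ℝ)).mul_const
      (c * κ t + c * κ 0 + I)
  exact sub_eq_zero.1 (norm_le_zero_iff.1 (ge_of_tendsto' h0 hb))

end Linear

/-! ### The weak time derivative of a parabolic solution -/

section TimeDerivative

variable {V : Type*} [NormedAddCommGroup V] [InnerProductSpace ℂ V]
  {H : Type*} [NormedAddCommGroup H] [InnerProductSpace ℂ H]
  {B : V →L[ℂ] V} {α : ℂ}

theorem memLp_two_Ioo {E : Type*} [NormedAddCommGroup E] {f : ℝ → E} (hf : Continuous f)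
    (T : ℝ) : MemLp f 2 (volume.restrict (Ioo 0 T)) := by
  have hfin : IsFiniteMeasure (volume.restrict (Ioo (0 : ℝ) T)) := inferInstance
  obtain ⟨C, hC⟩ := isCompact_Icc.exists_bound_of_continuousOn (s := Icc 0 T) hf.continuousOn
  refine MemLp.of_bound hf.aestronglyMeasurable C ?_
  exact (ae_restrict_iff' measurableSet_Ioo).2
    (Eventually.of_forall fun t ht => hC t (Ioo_subset_Icc_self ht))

theorem norm_toLp_sq {f : ℝ → H} {T : ℝ} (hT : 0 ≤ T)
    (hf : MemLp f 2 (volume.restrict (Ioo 0 T))) :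
    ‖hf.toLp f‖ ^ 2 = ∫ s in (0 : ℝ)..T, ‖f s‖ ^ 2 := by
  have h1 : ((‖hf.toLp f‖ ^ 2 : ℝ) : ℂ) = ((∫ s in (0 : ℝ)..T, ‖f s‖ ^ 2 : ℝ) : ℂ) := by
    rw [Complex.ofReal_pow]
    refine (inner_self_eq_norm_sq_to_K (𝕜 := ℂ) (hf.toLp f)).symm.trans ?_
    rw [L2.inner_def, intervalIntegral.integral_of_le hT, integral_Ioc_eq_integral_Ioo,
      ← integral_complex_ofReal]
    refine integral_congr_ae ?_
    filter_upwards [hf.coeFn_toLp] with t ht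
    rw [ht, inner_self_eq_norm_sq_to_K]
    push_cast
    rfl
  exact_mod_cast h1

/-- The bounded functional `f ↦ ∫ η f` on `L²` given by a real weight `η ∈ L²`. -/
def smulIntegralL {X : Type*} [MeasurableSpace X] {μ : Measure X} {E : Type*}
    [NormedAddCommGroup E] [NormedSpace ℝ E] [CompleteSpace E] {η : X → ℝ} (hη : MemLp η 2 μ) :
    Lp E 2 μ →L[ℝ] E :=
  (ContinuousLinearMap.lsmul ℝ ℝ : ℝ →L[ℝ] E →L[ℝ] E).lpPairing μ 2 2 (hη.toLp η)

theorem smulIntegralL_apply {X : Type*} [MeasurableSpace X] {μ : Measure X} {E : Type*}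
    [NormedAddCommGroup E] [NormedSpace ℝ E] [CompleteSpace E] {η : X → ℝ} (hη : MemLp η 2 μ)
    (f : Lp E 2 μ) : smulIntegralL hη f = ∫ x, η x • f x ∂μ := by
  rw [smulIntegralL, ContinuousLinearMap.lpPairing_eq_integral]
  refine integral_congr_ae ?_
  filter_upwards [hη.coeFn_toLp] with x hx
  simp [hx]

/-- A classical derivative is a weak derivative. -/
theorem integral_Ioo_deriv_smul {E : Type*} [NormedAddCommGroup E] [NormedSpace ℝ E]
    [CompleteSpace E] {T : ℝ} (hT : 0 < T) {f f' : ℝ → E} {η : ℝ → ℝ}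
    (hf : ∀ t, HasDerivAt f (f' t) t) (hf' : Continuous f') (hη : ContDiff ℝ ∞ η)
    (hsupp : tsupport η ⊆ Ioo 0 T) :
    ∫ t in Ioo 0 T, deriv η t • f t = -∫ t in Ioo 0 T, η t • f' t := by
  have hη0 : η 0 = 0 := by
    by_contra h
    exact lt_irrefl _ (hsupp (subset_tsupport _ h)).1
  have hηT : η T = 0 := by
    by_contra h
    exact lt_irrefl _ (hsupp (subset_tsupport _ h)).2
  have hd : Continuous (deriv η) := hη.continuous_deriv (by simp)
  have h := intervalIntegral.integral_smul_deriv_eq_deriv_smul (a := 0) (b := T) (u := η) (v := f)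
    (fun t _ => (hη.differentiable (by simp) t).hasDerivAt) (fun t _ => hf t)
    (hd.intervalIntegrable 0 T) (hf'.intervalIntegrable 0 T)
  rw [hη0, hηT, zero_smul, zero_smul, sub_zero, zero_sub,
    intervalIntegral.integral_of_le hT.le, intervalIntegral.integral_of_le hT.le,
    integral_Ioc_eq_integral_Ioo, integral_Ioc_eq_integral_Ioo] at h
  rw [h, neg_neg]

/-- The derivatives of the approximating regular solutions are Cauchy in `L²(0, T; H)`, by
maximal regularity applied to differences. -/
theorem IsLinearSolution.exists_hasL2WeakTimeDeriv [CompleteSpace V] [CompleteSpace H]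
    {J : V →L[ℂ] H}
    (hBJ : ∀ x y, inner ℂ (B x) y = inner ℂ (J x) (J y)) (hα : 0 < α.re)
    {u₀ : V} {F : ℝ → H} {v : ℝ → V}
    (h : IsLinearSolution B α J u₀ F v) {T : ℝ} (hT : 0 < T) :
    ∃ w : ℝ → H, HasL2WeakTimeDeriv T (fun t => J (v t)) w := by
  have hβ : 0 < (α⁻¹).re := by
    rw [Complex.inv_re]
    exact div_pos hα (Complex.normSq_pos.2 (by rintro rfl; simp at hα))
  obtain ⟨U, p, g, κ, hκ, hr, hg, hU⟩ := h.approx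
  have hv := h.continuous
  let D : ℕ → ℝ → H := fun n t => J (g n t - α • p n t)
  have hDc : ∀ n, Continuous (D n) := fun n => J.continuous.comp (hr n).continuous_deriv
  have hD : ∀ n, MemLp (D n) 2 (volume.restrict (Ioo 0 T)) := fun n => memLp_two_Ioo (hDc n) T
  let W : ℕ → Lp H 2 (volume.restrict (Ioo 0 T)) := fun n => (hD n).toLp (D n)
  let K : ℝ := (κ 0 ^ 2 + ‖α⁻¹‖ ^ 2 / (α⁻¹).re * T) / (α⁻¹).re
  have hK : 0 ≤ K := by positivity
  -- the parabolic estimate for differences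
  have hdiff : ∀ n m, ‖W n - W m‖ ≤ (1 / ((n : ℝ) + 1) + 1 / ((m : ℝ) + 1)) * √K := by
    intro n m
    set e : ℝ := 1 / ((n : ℝ) + 1) + 1 / ((m : ℝ) + 1) with he
    have he0 : 0 ≤ e := by positivity
    have hnm := (hr n).sub (hr m)
    have h1 := hnm.norm_sq_add_integral_le hBJ hα hT.le
    have h2 : ‖U n 0 - U m 0‖ ≤ e * κ 0 := by
      rw [← sub_sub_sub_cancel_right (U n 0) (U m 0) (v 0), he, add_mul]
      exact (norm_sub_le _ _).trans (add_le_add (hU n 0 le_rfl) (hU m 0 le_rfl))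
    have h3 : ∀ s, ‖J (g n s - g m s)‖ ≤ e := by
      intro s
      rw [map_sub, ← sub_sub_sub_cancel_right (J (g n s)) (J (g m s)) (F s)]
      exact (norm_sub_le _ _).trans (add_le_add (hg n s) (hg m s))
    have h4 : ∫ s in (0 : ℝ)..T, ‖J (g n s - g m s)‖ ^ 2 ≤ ∫ s in (0 : ℝ)..T, e ^ 2 := by
      refine intervalIntegral.integral_mono_on hT.le ?_ (by simp) fun s _ => ?_
      · exact ((J.continuous.comp hnm.continuous_g).norm.pow 2).intervalIntegrable _ _
      · have := h3 s
        gcongr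
    rw [intervalIntegral.integral_const, sub_zero, smul_eq_mul] at h4
    have h5 : ‖W n - W m‖ ^ 2 =
        ∫ s in (0 : ℝ)..T, ‖J (g n s - g m s - α • (p n s - p m s))‖ ^ 2 := by
      simp only [W]
      rw [← MemLp.toLp_sub, norm_toLp_sq hT.le]
      refine intervalIntegral.integral_congr fun s _ => ?_
      simp only [D, Pi.sub_apply, ← map_sub]
      congr 3
      module
    rw [← h5] at h1
    have h6 : ‖W n - W m‖ ^ 2 ≤ (e * √K) ^ 2 := by
      rw [mul_pow, Real.sq_sqrt hK]
      have h7 : ‖U n 0 - U m 0‖ ^ 2 ≤ (e * κ 0) ^ 2 := by gcongr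
      have h8 : (α⁻¹).re * ‖W n - W m‖ ^ 2 ≤
          (e * κ 0) ^ 2 + ‖α⁻¹‖ ^ 2 / (α⁻¹).re * (T * e ^ 2) := by
        have : ‖α⁻¹‖ ^ 2 / (α⁻¹).re * (∫ s in (0 : ℝ)..T, ‖J (g n s - g m s)‖ ^ 2) ≤
          ‖α⁻¹‖ ^ 2 / (α⁻¹).re * (T * e ^ 2) := by gcongr
        nlinarith [sq_nonneg ‖U n T - U m T‖]
      have h9 : e ^ 2 * K = ((e * κ 0) ^ 2 + ‖α⁻¹‖ ^ 2 / (α⁻¹).re * (T * e ^ 2)) / (α⁻¹).re := by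
        simp only [K]; ring
      rw [h9, le_div_iff₀ hβ]
      linarith
    exact (abs_le_of_sq_le_sq' h6 (by positivity)).2
  have hcauchy : CauchySeq W := by
    refine cauchySeq_of_le_tendsto_0' (fun n : ℕ => 2 * (1 / ((n : ℝ) + 1)) * √K) ?_ ?_
    · intro n m hnm
      rw [dist_eq_norm]
      refine (hdiff n m).trans ?_
      have : 1 / ((m : ℝ) + 1) ≤ 1 / ((n : ℝ) + 1) := Nat.one_div_le_one_div hnm
      gcongr
      linarith
    · simpa using ((tendsto_one_div_add_atTop_nhds_zero_nat (𝕜 := ℝ)).const_mul 2).mul_const (√K)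
  obtain ⟨w, hw⟩ := cauchySeq_tendsto_of_complete hcauchy
  refine ⟨w, ⟨?_, Lp.memLp w, fun η hη _ hsupp => ?_⟩⟩
  · exact ((J.continuous.comp hv).integrableOn_Icc (a := 0) (b := T)).mono_set Ioo_subset_Icc_self
  · have hη2 : MemLp η 2 (volume.restrict (Ioo 0 T)) := memLp_two_Ioo hη.continuous T
    have hd : Continuous (deriv η) := hη.continuous_deriv (by simp)
    let Λ : Lp H 2 (volume.restrict (Ioo 0 T)) →L[ℝ] H := smulIntegralL hη2
    have hΛ : ∀ f : Lp H 2 (volume.restrict (Ioo 0 T)), Λ f = ∫ t in Ioo 0 T, η t • f t :=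
      smulIntegralL_apply hη2
    have hW : ∀ n, ∫ t in Ioo 0 T, deriv η t • J (U n t) = -Λ (W n) := by
      intro n
      rw [hΛ, integral_Ioo_deriv_smul hT (f := fun t => J (U n t)) (f' := D n) (fun t =>
        (J.restrictScalars ℝ).hasFDerivAt.comp_hasDerivAt t ((hr n).hasDerivAt t)) (hDc n) hη hsupp]
      congr 1
      refine integral_congr_ae ?_
      filter_upwards [(hD n).coeFn_toLp] with t ht
      rw [ht]
    have hlim1 : Tendsto (fun n => -Λ (W n)) atTop (𝓝 (-Λ w)) :=
      ((Λ.continuous.tendsto w).comp hw).neg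
    rw [← hΛ]
    refine tendsto_nhds_unique ?_ hlim1
    rw [tendsto_iff_norm_sub_tendsto_zero]
    have hb : ∀ n : ℕ, ‖-Λ (W n) - ∫ t in Ioo 0 T, deriv η t • J (v t)‖ ≤
        1 / ((n : ℝ) + 1) * ∫ t in (0 : ℝ)..T, |deriv η t| * (‖J‖ * κ t) := by
      intro n
      have hUn := (hr n).continuous
      have hc1 : Continuous fun t => deriv η t • J (U n t) := hd.smul (J.continuous.comp hUn)
      have hc2 : Continuous fun t => deriv η t • J (v t) := hd.smul (J.continuous.comp hv)
      rw [← hW, ← integral_Ioc_eq_integral_Ioo, ← integral_Ioc_eq_integral_Ioo,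
        ← intervalIntegral.integral_of_le hT.le, ← intervalIntegral.integral_of_le hT.le,
        ← intervalIntegral.integral_sub (hc1.intervalIntegrable 0 T) (hc2.intervalIntegrable 0 T),
        ← intervalIntegral.integral_const_mul]
      refine intervalIntegral.norm_integral_le_of_norm_le hT.le
        (Eventually.of_forall fun s hs => ?_)
        ((by fun_prop : Continuous _).intervalIntegrable 0 T)
      rw [← smul_sub, norm_smul, ← map_sub, Real.norm_eq_abs]
      have h1 := (J.le_opNorm (U n s - v s)).trans
        (mul_le_mul_of_nonneg_left (hU n s hs.1.le) (norm_nonneg J))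
      have h2 := mul_le_mul_of_nonneg_left h1 (abs_nonneg (deriv η s))
      linarith
    refine squeeze_zero (fun _ => norm_nonneg _) hb ?_
    simpa using (tendsto_one_div_add_atTop_nhds_zero_nat (𝕜 := ℝ)).mul_const
      (∫ t in (0 : ℝ)..T, |deriv η t| * (‖J‖ * κ t))

end TimeDerivative

/-! ### Picard iteration for causal maps -/

section Picard

theorem norm_sub_le_of_geometric {E : Type*} [NormedAddCommGroup E] {U : ℕ → E} {A : ℝ}
    (hA : 0 ≤ A) (h : ∀ n, ‖U (n + 1) - U n‖ ≤ A * (1 / 2) ^ n) (n m : ℕ) :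
    ‖U n - U m‖ ≤ (1 / ((n : ℝ) + 1) + 1 / ((m : ℝ) + 1)) * (2 * A) := by
  have h1 : ∀ n k : ℕ, ‖U (n + k) - U n‖ ≤ 2 * A * (1 / 2) ^ n * (1 - (1 / 2) ^ k) := by
    intro n k
    induction k with
    | zero => simp
    | succ k ih =>
      have e : U (n + (k + 1)) - U n = (U (n + k + 1) - U (n + k)) + (U (n + k) - U n) := by
        rw [← add_assoc]; abel
      rw [e]
      refine (norm_add_le _ _).trans ((add_le_add (h (n + k)) ih).trans (le_of_eq ?_))
      rw [pow_add, pow_succ]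
      ring
  have h2 : ∀ n : ℕ, (1 / 2 : ℝ) ^ n ≤ 1 / ((n : ℝ) + 1) := by
    intro n
    rw [one_div_pow]
    refine one_div_le_one_div_of_le (by positivity) ?_
    exact_mod_cast Nat.lt_two_pow_self (n := n)
  have h3 : ∀ n m : ℕ, n ≤ m → ‖U m - U n‖ ≤ 1 / ((n : ℝ) + 1) * (2 * A) := by
    intro n m hnm
    obtain ⟨k, rfl⟩ := Nat.exists_eq_add_of_le hnm
    refine (h1 n k).trans ?_
    have h4 : 1 - (1 / 2 : ℝ) ^ k ≤ 1 := by
      have : 0 ≤ (1 / 2 : ℝ) ^ k := by positivity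
      linarith
    calc _ ≤ 2 * A * (1 / 2) ^ n * 1 := by gcongr
      _ ≤ 2 * A * (1 / ((n : ℝ) + 1)) * 1 := by gcongr; exact h2 n
      _ = _ := by ring
  have hn : 0 ≤ 1 / ((n : ℝ) + 1) * (2 * A) := by positivity
  have hm : 0 ≤ 1 / ((m : ℝ) + 1) * (2 * A) := by positivity
  rw [add_mul]
  rcases le_total n m with hnm | hnm
  · rw [norm_sub_rev]
    linarith [h3 n m hnm]
  · linarith [h3 m n hnm]

/-- Picard iteration on `[0, ∞)`. The map is given as a relation `R u u'` between a curve and its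
image, and the bound at time `t` involves earlier times only, so that it is a contraction for a
suitable exponential weight in time, whatever the size of `L`. -/
theorem exists_fixedPoint_of_causal_bound {W : Type*} [NormedAddCommGroup W] [CompleteSpace W]
    (R : (ℝ → W) → (ℝ → W) → Prop) (w₀ : W)
    (hex : ∀ u, Continuous u → ∃ u', R u u')
    (hcont : ∀ u u', Continuous u → R u u' → Continuous u' ∧ ∀ t ≤ 0, u' t = w₀)
    {L : ℝ → ℝ} (hL : Continuous L) (hL0 : ∀ t, 0 ≤ L t) (hLm : MonotoneOn L (Ici 0))
    (hR : ∀ u₁ u₂ u₁' u₂', Continuous u₁ → Continuous u₂ → R u₁ u₁' → R u₂ u₂' →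
      ∀ t, 0 ≤ t → ‖u₁' t - u₂' t‖ ^ 2 ≤ L t * ∫ s in (0 : ℝ)..t, ‖u₁ s - u₂ s‖ ^ 2) :
    ∃ u, Continuous u ∧ R u u := by
  choose! step hstep using hex
  let u : ℕ → ℝ → W := fun n => step^[n] fun _ => w₀
  have hu_succ : ∀ n, u (n + 1) = step (u n) := fun n => Function.iterate_succ_apply' _ _ _
  have huc : ∀ n, Continuous (u n) := by
    intro n
    induction n with
    | zero => exact continuous_const
    | succ n ih => rw [hu_succ]; exact (hcont _ _ ih (hstep _ ih)).1
  have huR : ∀ n, R (u n) (u (n + 1)) := fun n => by rw [hu_succ]; exact hstep _ (huc n)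
  have hd : ∀ n, Continuous fun s => ‖u (n + 1) s - u n s‖ ^ 2 := fun n =>
    ((huc (n + 1)).sub (huc n)).norm.pow 2
  let M : ℝ → ℝ := fun t => L t * ∫ s in (0 : ℝ)..t, ‖u 1 s - u 0 s‖ ^ 2
  have hMc : Continuous M := hL.mul (intervalIntegral.continuous_primitive
    (fun a b => (hd 0).intervalIntegrable a b) 0)
  have hM0 : ∀ t, 0 ≤ t → 0 ≤ M t := fun t ht =>
    mul_nonneg (hL0 t) (intervalIntegral.integral_nonneg ht fun s _ => by positivity)
  -- the exponential weight turns the causal bound into a contraction by the factor `1 / 4`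
  have hk : ∀ t, 0 ≤ t → ∀ n s, 0 ≤ s → s ≤ t → ‖u (n + 2) s - u (n + 1) s‖ ^ 2 ≤
      M t * Real.exp ((4 * L t + 1) * s) * (1 / 4) ^ n := by
    intro t ht n
    have hc : 0 < 4 * L t + 1 := by linarith [hL0 t]
    induction n with
    | zero =>
      intro s hs hst
      have h1 := hR _ _ _ _ (huc 1) (huc 0) (huR 1) (huR 0) s hs
      have h2 : M s ≤ M t := by
        simp only [M]
        refine mul_le_mul (hLm hs ht hst) ?_
          (intervalIntegral.integral_nonneg hs fun s _ => by positivity) (hL0 t)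
        exact intervalIntegral.integral_mono_interval le_rfl hs hst
          (Eventually.of_forall fun s => by positivity) ((hd 0).intervalIntegrable 0 t)
      have h3 : 1 ≤ Real.exp ((4 * L t + 1) * s) := Real.one_le_exp (by positivity)
      rw [pow_zero, mul_one]
      exact (h1.trans h2).trans (le_mul_of_one_le_right (hM0 t ht) h3)
    | succ n ih =>
      intro s hs hst
      have h1 := hR _ _ _ _ (huc (n + 2)) (huc (n + 1)) (huR (n + 2)) (huR (n + 1)) s hs
      refine h1.trans ?_
      have hexp : ∀ r : ℝ, HasDerivAt (fun r => M t * (1 / 4) ^ n *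
          (Real.exp ((4 * L t + 1) * r) / (4 * L t + 1)))
          (M t * Real.exp ((4 * L t + 1) * r) * (1 / 4) ^ n) r := by
        intro r
        have h := (((hasDerivAt_id r).const_mul (4 * L t + 1)).exp.div_const
          (4 * L t + 1)).const_mul (M t * (1 / 4) ^ n)
        refine h.congr_deriv ?_
        simp only [id]
        field_simp
      have hcexp : Continuous fun r => M t * Real.exp ((4 * L t + 1) * r) * (1 / 4) ^ n := by
        fun_prop
      have h2 : ∫ r in (0 : ℝ)..s, ‖u (n + 1 + 1) r - u (n + 1) r‖ ^ 2 ≤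
          M t * (1 / 4) ^ n * (Real.exp ((4 * L t + 1) * s) / (4 * L t + 1)) := by
        calc _ ≤ ∫ r in (0 : ℝ)..s, M t * Real.exp ((4 * L t + 1) * r) * (1 / 4) ^ n :=
              intervalIntegral.integral_mono_on hs ((hd (n + 1)).intervalIntegrable 0 s)
                (hcexp.intervalIntegrable 0 s) fun r hr => ih r hr.1 (hr.2.trans hst)
          _ = _ := intervalIntegral.integral_eq_sub_of_hasDerivAt (fun r _ => hexp r)
                (hcexp.intervalIntegrable 0 s)
          _ ≤ _ := by
            have : 0 ≤ M t * (1 / 4) ^ n * (Real.exp ((4 * L t + 1) * 0) / (4 * L t + 1)) := by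
              have := hM0 t ht
              positivity
            linarith
      have h3 : L s ≤ L t := hLm hs ht hst
      have hI : 0 ≤ M t * (1 / 4) ^ n * (Real.exp ((4 * L t + 1) * s) / (4 * L t + 1)) := by
        have := hM0 t ht
        positivity
      calc _ ≤ L t * (M t * (1 / 4) ^ n * (Real.exp ((4 * L t + 1) * s) / (4 * L t + 1))) :=
            mul_le_mul h3 h2 (intervalIntegral.integral_nonneg hs fun s _ => by positivity) (hL0 t)
        _ = (L t / (4 * L t + 1)) * (M t * Real.exp ((4 * L t + 1) * s) * (1 / 4) ^ n) := by ring
        _ ≤ (1 / 4) * (M t * Real.exp ((4 * L t + 1) * s) * (1 / 4) ^ n) := by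
            have h5 : L t / (4 * L t + 1) ≤ 1 / 4 := by
              rw [div_le_div_iff₀ hc (by norm_num)]
              linarith
            have := hM0 t ht
            gcongr
        _ = _ := by ring
  let A : ℝ → ℝ := fun t => √(M t * Real.exp ((4 * L t + 1) * t))
  have hAc : Continuous A := by
    refine (hMc.mul (Real.continuous_exp.comp ?_)).sqrt
    exact ((continuous_const.mul hL).add continuous_const).mul continuous_id
  obtain ⟨v, hv, hv0, hlim⟩ := exists_limit_of_cauchy_rate (U := fun n => u (n + 1))
    (fun n => huc (n + 1)) (κ := fun t => 2 * A t) (continuous_const.mul hAc) (by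
      intro n m t ht
      refine norm_sub_le_of_geometric (U := fun n => u (n + 1) t) (Real.sqrt_nonneg _) ?_ n m
      intro n
      have h1 := hk t ht n t ht le_rfl
      have h2 : ‖u (n + 2) t - u (n + 1) t‖ ^ 2 ≤ (A t * (1 / 2) ^ n) ^ 2 := by
        refine h1.trans (le_of_eq ?_)
        have := hM0 t ht
        simp only [A]
        rw [mul_pow, Real.sq_sqrt (by positivity), ← pow_mul, mul_comm n 2, pow_mul]
        norm_num
      exact (abs_le_of_sq_le_sq' h2 (by positivity)).2)
  have hv0' : ∀ t ≤ 0, v t = w₀ := by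
    intro t ht
    have h1 : ∀ n, u (n + 1) 0 = w₀ := fun n => (hcont _ _ (huc n) (huR n)).2 0 le_rfl
    have h2 : ∀ n : ℕ, ‖w₀ - v 0‖ ≤ 1 / ((n : ℝ) + 1) * (2 * A 0) := fun n => by
      have := hlim n 0 le_rfl
      rwa [h1] at this
    have h3 : Tendsto (fun n : ℕ => 1 / ((n : ℝ) + 1) * (2 * A 0)) atTop (𝓝 0) := by
      simpa using (tendsto_one_div_add_atTop_nhds_zero_nat (𝕜 := ℝ)).mul_const (2 * A 0)
    rw [hv0 t ht]
    exact (sub_eq_zero.1 (norm_le_zero_iff.1 (ge_of_tendsto' h3 h2))).symm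
  have hvR := hstep v hv
  have hfix : step v = v := by
    funext t
    rcases le_total t 0 with ht | ht
    · rw [hv0' t ht, (hcont _ _ hv hvR).2 t ht]
    · have h1 : ∀ n : ℕ, ‖u (n + 2) t - step v t‖ ^ 2 ≤
          (1 / ((n : ℝ) + 1)) ^ 2 * (L t * ∫ s in (0 : ℝ)..t, (2 * A s) ^ 2) := by
        intro n
        refine (hR _ _ _ _ (huc (n + 1)) hv (huR (n + 1)) hvR t ht).trans ?_
        have h2 : ∫ s in (0 : ℝ)..t, ‖u (n + 1) s - v s‖ ^ 2 ≤
            ∫ s in (0 : ℝ)..t, (1 / ((n : ℝ) + 1)) ^ 2 * (2 * A s) ^ 2 := by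
          refine intervalIntegral.integral_mono_on ht
            ((((huc (n + 1)).sub hv).norm.pow 2).intervalIntegrable 0 t)
            ((by fun_prop : Continuous _).intervalIntegrable 0 t) fun s hs => ?_
          rw [← mul_pow]
          exact pow_le_pow_left₀ (norm_nonneg _) (hlim n s hs.1) 2
        rw [intervalIntegral.integral_const_mul] at h2
        calc _ ≤ L t * _ := mul_le_mul_of_nonneg_left h2 (hL0 t)
          _ = _ := by ring
      have h3 : Tendsto (fun n : ℕ => (1 / ((n : ℝ) + 1)) ^ 2 *
          (L t * ∫ s in (0 : ℝ)..t, (2 * A s) ^ 2)) atTop (𝓝 0) := by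
        simpa using ((tendsto_one_div_add_atTop_nhds_zero_nat (𝕜 := ℝ)).pow 2).mul_const
          (L t * ∫ s in (0 : ℝ)..t, (2 * A s) ^ 2)
      have h4 : Tendsto (fun n => u (n + 1) t) atTop (𝓝 (v t)) := by
        rw [tendsto_iff_norm_sub_tendsto_zero]
        refine squeeze_zero (fun _ => norm_nonneg _) (fun n => hlim n t ht) ?_
        simpa using (tendsto_one_div_add_atTop_nhds_zero_nat (𝕜 := ℝ)).mul_const (2 * A t)
      have h5 : Tendsto (fun n => ‖u (n + 2) t - step v t‖ ^ 2) atTop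
          (𝓝 (‖v t - step v t‖ ^ 2)) :=
        (((tendsto_add_atTop_iff_nat 1).2 h4).sub tendsto_const_nhds).norm.pow 2
      have h6 : ‖v t - step v t‖ ^ 2 ≤ 0 := le_of_tendsto_of_tendsto' h5 h3 h1
      have h7 : ‖v t - step v t‖ = 0 := by
        have := sq_nonneg ‖v t - step v t‖
        exact pow_eq_zero_iff (two_ne_zero) |>.1 (le_antisymm h6 this)
      exact (sub_eq_zero.1 (norm_eq_zero.1 h7)).symm
  exact ⟨v, hv, by rw [hfix] at hvR; exact hvR⟩

end Picard

/-! ### Truncation and continuation -/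

section Truncation

variable {E : Type*} [NormedAddCommGroup E] [NormedSpace ℝ E]

/-- The radial retraction of a normed space onto the closed ball of radius `R > 0` about `0`. -/
def radialRetraction (R : ℝ) (x : E) : E := (R / max R ‖x‖) • x

theorem norm_radialRetraction_le {R : ℝ} (hR : 0 < R) (x : E) : ‖radialRetraction R x‖ ≤ R := by
  have hm : 0 < max R ‖x‖ := lt_max_of_lt_left hR
  rw [radialRetraction, norm_smul, Real.norm_eq_abs, abs_of_nonneg (by positivity),
    div_mul_eq_mul_div, div_le_iff₀ hm]
  gcongr
  exact le_max_right _ _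

theorem radialRetraction_eq_self {R : ℝ} (hR : 0 < R) {x : E} (hx : ‖x‖ ≤ R) :
    radialRetraction R x = x := by
  rw [radialRetraction, max_eq_left hx, div_self hR.ne', one_smul]

/-- In a general normed space the radial retraction is Lipschitz with constant `2`. -/
theorem norm_radialRetraction_sub_le {R : ℝ} (hR : 0 < R) (x y : E) :
    ‖radialRetraction R x - radialRetraction R y‖ ≤ 2 * ‖x - y‖ := by
  set a := max R ‖x‖ with ha
  set b := max R ‖y‖ with hb
  have ha0 : 0 < a := lt_max_of_lt_left hR
  have hb0 : 0 < b := lt_max_of_lt_left hR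
  have hRa : R / a ≤ 1 := (div_le_one ha0).2 (le_max_left _ _)
  have hyb : ‖y‖ / b ≤ 1 := (div_le_one hb0).2 (le_max_right _ _)
  have hab : |b - a| ≤ ‖x - y‖ := by
    have h1 := abs_max_sub_max_le_max R ‖y‖ R ‖x‖
    rw [sub_self, abs_zero, max_eq_right (abs_nonneg (‖y‖ - ‖x‖))] at h1
    refine h1.trans ?_
    rw [norm_sub_rev]
    exact abs_norm_sub_norm_le y x
  have e : radialRetraction R x - radialRetraction R y =
      (R / a) • (x - y) + (R / a - R / b) • y := by
    simp only [radialRetraction, ← ha, ← hb]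
    module
  have e2 : R / a - R / b = (R / a) * ((b - a) / b) := by
    field_simp
  have h1 : ‖(R / a) • (x - y)‖ ≤ ‖x - y‖ := by
    rw [norm_smul, Real.norm_eq_abs, abs_of_nonneg (by positivity)]
    exact mul_le_of_le_one_left (norm_nonneg _) hRa
  have h2 : ‖(R / a - R / b) • y‖ ≤ ‖x - y‖ := by
    rw [norm_smul, e2, Real.norm_eq_abs, abs_mul,
      abs_of_nonneg (by positivity : 0 ≤ R / a), abs_div, abs_of_pos hb0]
    calc R / a * (|b - a| / b) * ‖y‖ = (R / a) * (|b - a| * (‖y‖ / b)) := by ring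
      _ ≤ 1 * (‖x - y‖ * 1) := by gcongr
      _ = _ := by ring
  rw [e]
  refine (norm_add_le _ _).trans ?_
  linarith

theorem continuous_radialRetraction {X : Type*} [TopologicalSpace X] {R : X → ℝ} {f : X → E}
    (hR : Continuous R) (hR0 : ∀ t, 0 < R t) (hf : Continuous f) :
    Continuous fun t => radialRetraction (R t) (f t) :=
  (hR.div (hR.max hf.norm) fun t => (lt_max_of_lt_left (hR0 t)).ne').smul hf

/-- Continuation principle: a bound that improves to a strict one whenever it holds up to some
time is never broken. -/
theorem le_of_forall_le_imp_lt {f R : ℝ → ℝ} (hf : Continuous f) (hR : Continuous R)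
    (h0 : f 0 ≤ R 0) (h : ∀ τ, 0 ≤ τ → (∀ s, 0 ≤ s → s ≤ τ → f s ≤ R s) → f τ < R τ)
    {t : ℝ} (ht : 0 ≤ t) : f t ≤ R t := by
  by_contra hlt
  push Not at hlt
  let A : Set ℝ := Icc 0 t ∩ {s | R s ≤ f s}
  have hA : IsCompact A := isCompact_Icc.inter_right (isClosed_le hR hf)
  obtain ⟨s, hs, hmin⟩ := hA.exists_isLeast ⟨t, ⟨ht, le_rfl⟩, hlt.le⟩
  have hbefore : ∀ r, 0 ≤ r → r < s → f r < R r := by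
    intro r hr hrs
    by_contra hcon
    exact absurd (hmin ⟨⟨hr, hrs.le.trans hs.1.2⟩, not_lt.1 hcon⟩) (not_le.2 hrs)
  have hat : f s ≤ R s := by
    rcases hs.1.1.eq_or_lt with h | h
    · rwa [← h]
    · by_contra hcon
      push Not at hcon
      have h1 : ∀ᶠ r in 𝓝[<] s, R r < f r :=
        (hR.continuousAt.eventually_lt hf.continuousAt hcon).filter_mono nhdsWithin_le_nhds
      have h2 : ∀ᶠ r in 𝓝[<] s, r ∈ Ioo 0 s := Ioo_mem_nhdsLT h
      obtain ⟨r, hr1, hr2⟩ := (h1.and h2).exists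
      exact lt_asymm hr1 (hbefore r hr2.1.le hr2.2)
  have := h s hs.1.1 fun r hr hrs => by
    rcases hrs.eq_or_lt with h | h
    · rwa [h]
    · exact (hbefore r hr h).le
  exact absurd hs.2 (not_le.2 this)

end Truncation

/-! ### The energy inequality and the Gronwall bound -/

section System

variable {V : Type*} [NormedAddCommGroup V] [InnerProductSpace ℂ V]
  {H : Type*} [NormedAddCommGroup H] [InnerProductSpace ℂ H]
  {B : V →L[ℂ] V} {α : ℂ} {J : V →L[ℂ] H} {N : V → H} {Φ : V → ℝ} {k l : ℝ}

theorem continuous_of_norm_sub_le {V H : Type*} [NormedAddCommGroup V] [NormedAddCommGroup H]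
    {N : V → H} {k : ℝ}
    (hN : ∀ u v, ‖N u - N v‖ ≤ k * (‖u‖ + ‖v‖) ^ 2 * ‖u - v‖) : Continuous N := by
  rw [continuous_iff_continuousAt]
  intro v
  rw [ContinuousAt, tendsto_iff_norm_sub_tendsto_zero]
  refine squeeze_zero (fun _ => norm_nonneg _) (fun u => hN u v) ?_
  have : Continuous fun u : V => k * (‖u‖ + ‖v‖) ^ 2 * ‖u - v‖ := by fun_prop
  simpa using this.tendsto v

/-- The energy inequality for a forcing `F = α (Y - l N v)`, where `N` is the differential of the
potential `Φ ≥ 0`: the cubic term is moved to the left-hand side, where it becomes the derivative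
of `2 l Φ(v)`. It is proved for the approximating regular solutions, for which `α⁻¹ g` differs
from `Y - l N u` by an error of order `1 / (n + 1)`. The relation between `F` and `v` is required
up to time `t` only, because it is applied to truncated problems. -/
theorem IsLinearSolution.energy_le
    (hBJ : ∀ x y, inner ℂ (B x) y = inner ℂ (J x) (J y)) (hα : 0 < α.re)
    (hk : 0 ≤ k) (hl : 0 ≤ l)
    (hN : ∀ u v, ‖N u - N v‖ ≤ k * (‖u‖ + ‖v‖) ^ 2 * ‖u - v‖)
    (hΦ : ∀ (u : ℝ → V) (u' : V) (t : ℝ), HasDerivAt u u' t →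
      HasDerivAt (fun s => Φ (u s)) (inner ℂ (N (u t)) (J u')).re t)
    (hΦ0 : ∀ u, 0 ≤ Φ u) (hΦc : Continuous Φ)
    {u₀ : V} {F Y : ℝ → H} {v : ℝ → V} (hY : Continuous Y)
    (h : IsLinearSolution B α J u₀ F v) {t : ℝ} (ht : 0 ≤ t)
    (hF : ∀ s, 0 ≤ s → s ≤ t → α⁻¹ • F s = Y s - (l : ℂ) • N (v s)) :
    ‖v t‖ ^ 2 ≤ ‖u₀‖ ^ 2 + 2 * l * Φ u₀ + ((α⁻¹).re)⁻¹ * ∫ s in (0 : ℝ)..t, ‖Y s‖ ^ 2 := by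
  have hα0 : α ≠ 0 := by rintro rfl; simp at hα
  have hβ : 0 < (α⁻¹).re := by
    rw [Complex.inv_re]; exact div_pos hα (Complex.normSq_pos.2 hα0)
  have hNc := continuous_of_norm_sub_le hN
  obtain ⟨U, p, g, κ, hκ, hr, hg, hU⟩ := h.approx
  have hv := h.continuous
  have hκ0 : ∀ s, 0 ≤ s → 0 ≤ κ s := fun s hs => by
    simpa using (norm_nonneg _).trans (hU 0 s hs)
  let m : ℝ → ℝ := fun s => ‖α⁻¹‖ + l * (k * (2 * ‖v s‖ + κ s) ^ 2 * κ s)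
  have hmc : Continuous m := by fun_prop
  have key : ∀ n : ℕ, ‖U n t‖ ^ 2 ≤ ‖U n 0‖ ^ 2 + 2 * l * Φ (U n 0) +
      ((1 / ((n : ℝ) + 1)) ^ 2 * (((α⁻¹).re)⁻¹ * ∫ s in (0 : ℝ)..t, m s ^ 2) +
        ((α⁻¹).re)⁻¹ * ∫ s in (0 : ℝ)..t, ‖Y s‖ ^ 2) := by
    intro n
    have hUc := (hr n).continuous
    have hUd := (hr n).continuous_deriv
    set u' : ℝ → V := fun s => g n s - α • p n s with hu'
    let D : ℝ → ℝ := fun s => 2 * (inner ℂ (U n s) (u' s)).re +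
      2 * l * (inner ℂ (N (U n s)) (J (u' s))).re
    have hDc : Continuous D := by
      have h1 : Continuous fun s => inner ℂ (U n s) (u' s) := hUc.inner hUd
      have h2 : Continuous fun s => inner ℂ (N (U n s)) (J (u' s)) :=
        (hNc.comp hUc).inner (J.continuous.comp hUd)
      exact (continuous_const.mul (Complex.continuous_re.comp h1)).add
        (continuous_const.mul (Complex.continuous_re.comp h2))
    have hD : ∀ s, HasDerivAt (fun s => ‖U n s‖ ^ 2 + 2 * l * Φ (U n s)) (D s) s := fun s =>
      (hasDerivAt_re_inner_self ((hr n).hasDerivAt s)).add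
        ((hΦ _ _ s ((hr n).hasDerivAt s)).const_mul (2 * l))
    have hftc := intervalIntegral.integral_eq_sub_of_hasDerivAt (a := 0) (b := t)
      (fun s _ => hD s) (hDc.intervalIntegrable 0 t)
    have hle : ∀ s, 0 ≤ s → s ≤ t → D s ≤ ((α⁻¹).re)⁻¹ * ((1 / ((n : ℝ) + 1)) ^ 2 * m s ^ 2) +
        ((α⁻¹).re)⁻¹ * ‖Y s‖ ^ 2 := by
      intro s hs hst
      set w := J (u' s) with hw
      set E : H := α⁻¹ • (J (g n s) - F s) + (l : ℂ) • (N (U n s) - N (v s)) with hE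
      have hEm : ‖E‖ ≤ 1 / ((n : ℝ) + 1) * m s := by
        refine (norm_add_le _ _).trans ?_
        rw [norm_smul, norm_smul, Complex.norm_real, Real.norm_eq_abs, abs_of_nonneg hl]
        have h1 := mul_le_mul_of_nonneg_left (hg n s) (norm_nonneg α⁻¹)
        have hd := hU n s hs
        have h1n : 1 / ((n : ℝ) + 1) ≤ 1 := by
          rw [div_le_one (by positivity)]
          have : (0 : ℝ) ≤ n := Nat.cast_nonneg n
          linarith
        have h2 : ‖U n s‖ + ‖v s‖ ≤ 2 * ‖v s‖ + κ s := by
          have h3 : ‖U n s‖ ≤ ‖U n s - v s‖ + ‖v s‖ := by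
            simpa using norm_add_le (U n s - v s) (v s)
          have h4 := mul_le_mul_of_nonneg_right h1n (hκ0 s hs)
          linarith
        have h5 : ‖N (U n s) - N (v s)‖ ≤
            k * (2 * ‖v s‖ + κ s) ^ 2 * (1 / ((n : ℝ) + 1) * κ s) :=
          (hN _ _).trans (by gcongr)
        have h6 := mul_le_mul_of_nonneg_left h5 hl
        simp only [m]
        linarith
      have hsplit : α⁻¹ • J (g n s) = E + Y s - (l : ℂ) • N (U n s) := by
        have := hF s hs hst
        rw [hE, smul_sub, this]
        module
      have hin := (hr n).inner_deriv_eq hBJ hα0 hs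
      have e1 : (inner ℂ (U n s) (u' s)).re + l * (inner ℂ (N (U n s)) w).re =
          (inner ℂ (E + Y s) w).re - (α⁻¹).re * ‖w‖ ^ 2 := by
        change inner ℂ (U n s) (u' s) = inner ℂ _ w - _ at hin
        rw [hin, hsplit, inner_sub_left, inner_smul_left, Complex.conj_ofReal, Complex.sub_re,
          Complex.sub_re, Complex.re_ofReal_mul, ← Complex.ofReal_pow, Complex.re_mul_ofReal,
          Complex.conj_re]
        ring
      have h2 : (inner ℂ (E + Y s) w).re ≤ ‖E + Y s‖ * ‖w‖ :=
        (Complex.re_le_norm _).trans (norm_inner_le_norm _ _)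
      have h3 := two_mul_le_div_add ‖E + Y s‖ ‖w‖ (mul_pos two_pos hβ)
      have h4 : ‖E + Y s‖ ^ 2 ≤ 2 * ‖E‖ ^ 2 + 2 * ‖Y s‖ ^ 2 := by
        have := pow_le_pow_left₀ (norm_nonneg _) (norm_add_le E (Y s)) 2
        nlinarith [sq_nonneg (‖E‖ - ‖Y s‖)]
      have h5 : ‖E + Y s‖ ^ 2 / (2 * (α⁻¹).re) ≤
          ((α⁻¹).re)⁻¹ * ‖E‖ ^ 2 + ((α⁻¹).re)⁻¹ * ‖Y s‖ ^ 2 := by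
        rw [div_le_iff₀ (by positivity)]
        have : (((α⁻¹).re)⁻¹ * ‖E‖ ^ 2 + ((α⁻¹).re)⁻¹ * ‖Y s‖ ^ 2) * (2 * (α⁻¹).re) =
            2 * ‖E‖ ^ 2 + 2 * ‖Y s‖ ^ 2 := by
          have hi := inv_mul_cancel₀ hβ.ne'
          linear_combination (2 * ‖E‖ ^ 2 + 2 * ‖Y s‖ ^ 2) * hi
        rw [this]
        exact h4
      have h6 : ((α⁻¹).re)⁻¹ * ‖E‖ ^ 2 ≤ ((α⁻¹).re)⁻¹ * ((1 / ((n : ℝ) + 1)) ^ 2 * m s ^ 2) := by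
        rw [← mul_pow]
        gcongr
      have h7 : D s = 2 * ((inner ℂ (U n s) (u' s)).re + l * (inner ℂ (N (U n s)) w).re) := by
        simp only [D, hw]; ring
      rw [h7, e1]
      linarith
    have hc1 : Continuous fun s => ((α⁻¹).re)⁻¹ * ((1 / ((n : ℝ) + 1)) ^ 2 * m s ^ 2) := by fun_prop
    have hc2 : Continuous fun s => ((α⁻¹).re)⁻¹ * ‖Y s‖ ^ 2 := by fun_prop
    have hmono := intervalIntegral.integral_mono_on ht (hDc.intervalIntegrable (μ := volume) 0 t)
      ((hc1.add hc2).intervalIntegrable (μ := volume) 0 t) (fun s hs => hle s hs.1 hs.2)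
    simp only [Pi.add_apply] at hmono
    rw [hftc, intervalIntegral.integral_add (hc1.intervalIntegrable 0 t)
      (hc2.intervalIntegrable 0 t), intervalIntegral.integral_const_mul,
      intervalIntegral.integral_const_mul, intervalIntegral.integral_const_mul] at hmono
    have h0 : 0 ≤ 2 * l * Φ (U n t) := by have := hΦ0 (U n t); positivity
    linarith
  have hlim : ∀ s, 0 ≤ s → Tendsto (fun n => U n s) atTop (𝓝 (v s)) := by
    intro s hs
    rw [tendsto_iff_norm_sub_tendsto_zero]
    refine squeeze_zero (fun _ => norm_nonneg _) (fun n => hU n s hs) ?_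
    simpa using (tendsto_one_div_add_atTop_nhds_zero_nat (𝕜 := ℝ)).mul_const (κ s)
  have hl0 := hlim 0 le_rfl
  rw [h.eq_of_nonpos 0 le_rfl] at hl0
  have hR := ((hl0.norm.pow 2).add (((hΦc.tendsto u₀).comp hl0).const_mul (2 * l))).add
    ((((tendsto_one_div_add_atTop_nhds_zero_nat (𝕜 := ℝ)).pow 2).mul_const
      (((α⁻¹).re)⁻¹ * ∫ s in (0 : ℝ)..t, m s ^ 2)).add_const
      (((α⁻¹).re)⁻¹ * ∫ s in (0 : ℝ)..t, ‖Y s‖ ^ 2))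
  have := le_of_tendsto_of_tendsto' ((hlim t ht).norm.pow 2) hR key
  simpa using this

/-- Gronwall's inequality in integral form, with the factor `exp t` of the linear estimates in
front. The right-hand side is a closed expression in `τ`, which serves as a truncation radius. -/
theorem one_add_le_of_le_exp_mul_integral {Z : ℝ → ℝ} {K C τ : ℝ} (hZ : Continuous Z)
    (hC : 0 ≤ C) (hτ : 0 ≤ τ)
    (h : ∀ t, 0 ≤ t → t ≤ τ → Z t ≤ Real.exp t * (K + C * ∫ s in (0 : ℝ)..t, (1 + Z s))) :
    1 + Z τ ≤ (K + 1) * Real.exp τ * Real.exp (C * (Real.exp τ - 1)) := by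
  let S : ℝ → ℝ := fun t => K + 1 + C * ∫ s in (0 : ℝ)..t, (1 + Z s)
  let q : ℝ → ℝ := fun t => S t * Real.exp (-(C * (Real.exp t - 1)))
  have hS : ∀ t, HasDerivAt S (C * (1 + Z t)) t := fun t =>
    (((continuous_const.add hZ).integral_hasStrictDerivAt 0 t).hasDerivAt.const_mul C).const_add _
  have hq : ∀ t, HasDerivAt q (C * (1 + Z t) * Real.exp (-(C * (Real.exp t - 1))) +
      S t * (Real.exp (-(C * (Real.exp t - 1))) * (-(C * Real.exp t)))) t := fun t =>
    (hS t).mul ((((Real.hasDerivAt_exp t).sub_const 1).const_mul C).neg.exp)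
  have hSZ : ∀ t, 0 ≤ t → t ≤ τ → 1 + Z t ≤ Real.exp t * S t := by
    intro t ht htτ
    have h1 := h t ht htτ
    have h2 := Real.one_le_exp ht
    simp only [S]
    nlinarith
  have hanti : AntitoneOn q (Icc 0 τ) := by
    refine antitoneOn_of_deriv_nonpos (convex_Icc 0 τ)
      (fun t _ => (hq t).continuousAt.continuousWithinAt)
      (fun t _ => (hq t).differentiableAt.differentiableWithinAt) fun t ht => ?_
    have ht' := interior_subset ht
    rw [(hq t).deriv]
    have h1 := mul_le_mul_of_nonneg_left (hSZ t ht'.1 ht'.2) hC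
    have h2 := mul_le_mul_of_nonneg_right h1 (Real.exp_pos (-(C * (Real.exp t - 1)))).le
    linarith
  have h1 := hanti ⟨le_rfl, hτ⟩ ⟨hτ, le_rfl⟩ hτ
  have hq0 : q 0 = K + 1 := by simp [q, S]
  rw [hq0] at h1
  have h2 : S τ ≤ (K + 1) * Real.exp (C * (Real.exp τ - 1)) := by
    have h3 := mul_le_mul_of_nonneg_right h1 (Real.exp_pos (C * (Real.exp τ - 1))).le
    simp only [q] at h3
    rwa [mul_assoc, ← Real.exp_add, neg_add_cancel, Real.exp_zero, mul_one] at h3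
  calc 1 + Z τ ≤ Real.exp τ * S τ := hSZ τ hτ le_rfl
    _ ≤ Real.exp τ * ((K + 1) * Real.exp (C * (Real.exp τ - 1))) := by gcongr
    _ = _ := by ring

end System

/-! ### The coupled system with a locally Lipschitz nonlinearity -/

section Coupled

variable {V : Type*} [NormedAddCommGroup V] [InnerProductSpace ℂ V]
  {H : Type*} [NormedAddCommGroup H] [InnerProductSpace ℂ H]
  {B : V →L[ℂ] V} {J : V →L[ℂ] H} {N : V → H} {Φ : V → ℝ} {k l : ℝ}

theorem norm_affine_sq_le {V E : Type*} [NormedAddCommGroup V] [NormedSpace ℂ V]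
    [NormedAddCommGroup E] [NormedSpace ℂ E] (S₁ S₂ : V →L[ℂ] E) (e : E) (x y : V) :
    ‖S₁ x + S₂ y + e‖ ^ 2 ≤
      3 * (‖S₁‖ ^ 2 + ‖S₂‖ ^ 2 + ‖e‖ ^ 2) * (1 + (‖x‖ ^ 2 + ‖y‖ ^ 2)) := by
  have h : ‖S₁ x + S₂ y + e‖ ≤ ‖S₁‖ * ‖x‖ + ‖S₂‖ * ‖y‖ + ‖e‖ :=
    norm_add₃_le.trans (by gcongr <;> exact ContinuousLinearMap.le_opNorm _ _)
  set a := ‖S₁‖ * ‖x‖ with ha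
  set b := ‖S₂‖ * ‖y‖ with hb
  have h2 : ‖S₁ x + S₂ y + e‖ ^ 2 ≤ 3 * (a ^ 2 + b ^ 2 + ‖e‖ ^ 2) := by
    have := pow_le_pow_left₀ (norm_nonneg _) h 2
    nlinarith [sq_nonneg (a - b), sq_nonneg (a - ‖e‖), sq_nonneg (b - ‖e‖)]
  refine h2.trans ?_
  rw [ha, hb, mul_pow, mul_pow]
  have p1 : 0 ≤ ‖S₁‖ ^ 2 * ‖y‖ ^ 2 := by positivity
  have p2 : 0 ≤ ‖S₂‖ ^ 2 * ‖x‖ ^ 2 := by positivity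
  have p3 : 0 ≤ ‖e‖ ^ 2 * (‖x‖ ^ 2 + ‖y‖ ^ 2) := by positivity
  nlinarith [sq_nonneg ‖S₁‖, sq_nonneg ‖S₂‖]

theorem norm_affine_sub_le {V E : Type*} [NormedAddCommGroup V] [NormedSpace ℂ V]
    [NormedAddCommGroup E] [NormedSpace ℂ E] (S₁ S₂ : V →L[ℂ] E) (e : E) (z z' : V × V) :
    ‖(S₁ z.1 + S₂ z.2 + e) - (S₁ z'.1 + S₂ z'.2 + e)‖ ≤ (‖S₁‖ + ‖S₂‖) * ‖z - z'‖ := by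
  have e1 : (S₁ z.1 + S₂ z.2 + e) - (S₁ z'.1 + S₂ z'.2 + e) =
      S₁ (z - z').1 + S₂ (z - z').2 := by
    simp only [Prod.fst_sub, Prod.snd_sub, map_sub]; abel
  rw [e1, add_mul]
  refine (norm_add_le _ _).trans (add_le_add ?_ ?_)
  · exact (S₁.le_opNorm _).trans (by gcongr; exact norm_fst_le _)
  · exact (S₂.le_opNorm _).trans (by gcongr; exact norm_snd_le _)

/-- Global solution of the coupled system in which `N` is evaluated at the retraction of `v(t)`
onto the ball of radius `R(t)`. At each time the truncated nonlinearity is globally Lipschitz,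
so Picard iteration applies. -/
theorem exists_truncated_solution [CompleteSpace V]
    (hB : B.IsPositive) (hBd : DenseRange B) (hJd : DenseRange J)
    (hBJ : ∀ x y, inner ℂ (B x) y = inner ℂ (J x) (J y))
    {α₁ α₂ : ℂ} (hα₁ : 0 < α₁.re) (hα₂ : 0 ≤ α₂.re) (hk : 0 ≤ k) (hl : 0 ≤ l)
    (hN : ∀ u v, ‖N u - N v‖ ≤ k * (‖u‖ + ‖v‖) ^ 2 * ‖u - v‖)
    (Y₁ Y₂ : V →L[ℂ] H) (y₀ : H) (G₁ G₂ : V →L[ℂ] V) (g₀ v₀ φ₀ : V)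
    {R : ℝ → ℝ} (hRc : Continuous R) (hR0 : ∀ t, 0 < R t) (hRm : Monotone R) :
    ∃ u : ℝ → V × V, Continuous u ∧
      IsLinearSolution B α₁ J v₀ (fun t => α₁ • ((Y₁ (u t).1 + Y₂ (u t).2 + y₀) -
        (l : ℂ) • N (radialRetraction (R t) (u t).1))) (fun t => (u t).1) ∧
      IsLinearSolution B α₂ (ContinuousLinearMap.id ℂ V) φ₀
        (fun t => G₁ (u t).1 + G₂ (u t).2 + g₀) (fun t => (u t).2) := by
  have hα0 : α₁ ≠ 0 := by rintro rfl; simp at hα₁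
  have hβ : 0 < (α₁⁻¹).re := by
    rw [Complex.inv_re]; exact div_pos hα₁ (Complex.normSq_pos.2 hα0)
  have hNc := continuous_of_norm_sub_le hN
  let F : (ℝ → V × V) → ℝ → H := fun u t =>
    α₁ • ((Y₁ (u t).1 + Y₂ (u t).2 + y₀) - (l : ℂ) • N (radialRetraction (R t) (u t).1))
  let G : (ℝ → V × V) → ℝ → V := fun u t => G₁ (u t).1 + G₂ (u t).2 + g₀
  have hFc : ∀ u, Continuous u → Continuous (F u) := by
    intro u hu
    have h1 := continuous_radialRetraction hRc hR0 (continuous_fst.comp hu)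
    have h2 := hNc.comp h1
    exact (((by fun_prop : Continuous fun t => Y₁ (u t).1 + Y₂ (u t).2 + y₀)).sub
      (h2.const_smul (l : ℂ))).const_smul α₁
  have hGc : ∀ u, Continuous u → Continuous (G u) := fun u hu => by fun_prop
  obtain ⟨C₁, hC₁, hst₁⟩ : ∃ C₁, 0 ≤ C₁ ∧ StabilityEstimate B α₁ J C₁ :=
    ⟨_, by positivity, stabilityEstimate_parabolic hBJ hα₁⟩
  have hst₂ : StabilityEstimate B α₂ (ContinuousLinearMap.id ℂ V) 1 :=
    stabilityEstimate_id hB hα₂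
  let a : ℝ → ℝ := fun t => ‖α₁‖ * ((‖Y₁‖ + ‖Y₂‖) + l * (8 * k * R t ^ 2))
  have ha0 : ∀ t, 0 ≤ a t := fun t => by positivity
  have hac : Continuous a := by fun_prop
  have ham : Monotone a := by
    intro s t hst
    have h1 := hRm hst
    have h2 := (hR0 s).le
    simp only [a]
    gcongr
  let b : ℝ := ‖G₁‖ + ‖G₂‖
  have hb0 : 0 ≤ b := by positivity
  have hFlip : ∀ u₁ u₂ t, ‖F u₁ t - F u₂ t‖ ≤ a t * ‖u₁ t - u₂ t‖ := by
    intro u₁ u₂ t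
    have e : F u₁ t - F u₂ t = α₁ • (((Y₁ (u₁ t).1 + Y₂ (u₁ t).2 + y₀) -
        (Y₁ (u₂ t).1 + Y₂ (u₂ t).2 + y₀)) - (l : ℂ) • (N (radialRetraction (R t) (u₁ t).1) -
        N (radialRetraction (R t) (u₂ t).1))) := by
      simp only [F]; module
    rw [e, norm_smul]
    simp only [a]
    rw [mul_assoc]
    refine mul_le_mul_of_nonneg_left ?_ (norm_nonneg _)
    refine (norm_sub_le _ _).trans ?_
    rw [add_mul]
    refine add_le_add (norm_affine_sub_le _ _ _ _ _) ?_
    rw [norm_smul, Complex.norm_real, Real.norm_eq_abs, abs_of_nonneg hl, mul_assoc]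
    refine mul_le_mul_of_nonneg_left ?_ hl
    refine (hN _ _).trans ?_
    have h1 := norm_radialRetraction_le (hR0 t) (u₁ t).1
    have h2 := norm_radialRetraction_le (hR0 t) (u₂ t).1
    have h3 : ‖radialRetraction (R t) (u₁ t).1 - radialRetraction (R t) (u₂ t).1‖ ≤
        2 * ‖u₁ t - u₂ t‖ :=
      (norm_radialRetraction_sub_le (hR0 t) _ _).trans (by
        gcongr; exact norm_fst_le (u₁ t - u₂ t))
    calc _ ≤ k * (R t + R t) ^ 2 * (2 * ‖u₁ t - u₂ t‖) := by gcongr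
      _ = _ := by ring
  have hGlip : ∀ u₁ u₂ t, ‖G u₁ t - G u₂ t‖ ≤ b * ‖u₁ t - u₂ t‖ := fun u₁ u₂ t =>
    norm_affine_sub_le _ _ _ _ _
  have hFdef : ∀ u, F u = fun t => α₁ • ((Y₁ (u t).1 + Y₂ (u t).2 + y₀) -
    (l : ℂ) • N (radialRetraction (R t) (u t).1)) := fun _ => rfl
  have hGdef : ∀ u, G u = fun t => G₁ (u t).1 + G₂ (u t).2 + g₀ := fun _ => rfl
  clear_value a b F G
  let Rel : (ℝ → V × V) → (ℝ → V × V) → Prop := fun u u' =>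
    IsLinearSolution B α₁ J v₀ (F u) (fun t => (u' t).1) ∧
      IsLinearSolution B α₂ (ContinuousLinearMap.id ℂ V) φ₀ (G u) (fun t => (u' t).2)
  have hRel : ∀ u₁ u₂ u₁' u₂', Continuous u₁ → Continuous u₂ → Rel u₁ u₁' → Rel u₂ u₂' →
      ∀ t, 0 ≤ t → ‖u₁' t - u₂' t‖ ^ 2 ≤
        Real.exp t * (2 * C₁ * a t ^ 2 + 2 * 1 * b ^ 2) *
          ∫ s in (0 : ℝ)..t, ‖u₁ s - u₂ s‖ ^ 2 := by
    intro u₁ u₂ u₁' u₂' hu₁ hu₂ h₁ h₂ t ht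
    have hd : Continuous fun s => ‖u₁ s - u₂ s‖ ^ 2 := (hu₁.sub hu₂).norm.pow 2
    have e1 := h₁.1.norm_sub_sq_le hC₁ hst₁ (hFc _ hu₁) (hFc _ hu₂) h₂.1 ht
    have e2 := h₁.2.norm_sub_sq_le zero_le_one hst₂ (hGc _ hu₁) (hGc _ hu₂) h₂.2 ht
    rw [sub_self, norm_zero, zero_pow two_ne_zero, zero_add] at e1 e2
    have i1 : ∫ s in (0 : ℝ)..t, ‖F u₁ s - F u₂ s‖ ^ 2 ≤
        a t ^ 2 * ∫ s in (0 : ℝ)..t, ‖u₁ s - u₂ s‖ ^ 2 := by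
      rw [← intervalIntegral.integral_const_mul]
      refine intervalIntegral.integral_mono_on ht
        ((((hFc _ hu₁).sub (hFc _ hu₂)).norm.pow 2).intervalIntegrable 0 t)
        ((continuous_const.mul hd).intervalIntegrable 0 t) fun s hs => ?_
      rw [← mul_pow]
      refine pow_le_pow_left₀ (norm_nonneg _) ((hFlip _ _ s).trans ?_) 2
      exact mul_le_mul_of_nonneg_right (ham hs.2) (norm_nonneg _)
    have i2 : ∫ s in (0 : ℝ)..t, ‖G u₁ s - G u₂ s‖ ^ 2 ≤
        b ^ 2 * ∫ s in (0 : ℝ)..t, ‖u₁ s - u₂ s‖ ^ 2 := by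
      rw [← intervalIntegral.integral_const_mul]
      refine intervalIntegral.integral_mono_on ht
        ((((hGc _ hu₁).sub (hGc _ hu₂)).norm.pow 2).intervalIntegrable 0 t)
        ((continuous_const.mul hd).intervalIntegrable 0 t) fun s hs => ?_
      rw [← mul_pow]
      exact pow_le_pow_left₀ (norm_nonneg _) (hGlip _ _ s) 2
    have hmax : ‖u₁' t - u₂' t‖ ^ 2 ≤
        ‖(u₁' t).1 - (u₂' t).1‖ ^ 2 + ‖(u₁' t).2 - (u₂' t).2‖ ^ 2 := by
      rw [Prod.norm_def, Prod.fst_sub, Prod.snd_sub]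
      rcases max_choice ‖(u₁' t).1 - (u₂' t).1‖ ‖(u₁' t).2 - (u₂' t).2‖ with h | h <;>
        rw [h] <;> nlinarith [sq_nonneg ‖(u₁' t).1 - (u₂' t).1‖,
          sq_nonneg ‖(u₁' t).2 - (u₂' t).2‖]
    have i3 := mul_le_mul_of_nonneg_left i1 (mul_nonneg two_pos.le hC₁)
    have i4 := mul_le_mul_of_nonneg_left ((add_le_add i3
      (mul_le_mul_of_nonneg_left i2 (by norm_num : (0 : ℝ) ≤ 2 * 1)))) (Real.exp_pos t).le
    refine (hmax.trans (add_le_add e1 e2)).trans ?_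
    rw [← mul_add]
    refine i4.trans (le_of_eq ?_)
    ring
  obtain ⟨u, hu, hv, hφ⟩ := exists_fixedPoint_of_causal_bound Rel (v₀, φ₀)
    (fun u hu => by
      obtain ⟨v, hv⟩ := exists_isLinearSolution hB hBd hα₁.le hJd hC₁ hst₁ v₀ (hFc u hu)
      obtain ⟨φ, hφ⟩ := exists_isLinearSolution hB hBd hα₂ (G := ContinuousLinearMap.id ℂ V)
        denseRange_id zero_le_one hst₂ φ₀ (hGc u hu)
      exact ⟨fun t => (v t, φ t), hv, hφ⟩)
    (fun u u' _ h => ⟨h.1.continuous.prodMk h.2.continuous, fun t ht =>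
      Prod.ext (h.1.eq_of_nonpos t ht) (h.2.eq_of_nonpos t ht)⟩)
    (by fun_prop) (fun t => by positivity) (by
      intro s _ t _ hst
      have h1 := ham hst
      have h2 := ha0 s
      dsimp only
      gcongr) hRel
  rw [hFdef] at hv
  rw [hGdef] at hφ
  exact ⟨u, hu, hv, hφ⟩

/-- The growth bound for the coupled system on every interval `[0, τ]` on which the forcing of
the first equation is not truncated. It depends on the data only, not on the truncation. -/
theorem a_priori_bound [CompleteSpace V] (hB : B.IsPositive)
    (hBJ : ∀ x y, inner ℂ (B x) y = inner ℂ (J x) (J y))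
    {α₁ α₂ : ℂ} (hα₁ : 0 < α₁.re) (hα₂ : 0 ≤ α₂.re) (hk : 0 ≤ k) (hl : 0 ≤ l)
    (hN : ∀ u v, ‖N u - N v‖ ≤ k * (‖u‖ + ‖v‖) ^ 2 * ‖u - v‖)
    (hΦ : ∀ (u : ℝ → V) (u' : V) (t : ℝ), HasDerivAt u u' t →
      HasDerivAt (fun s => Φ (u s)) (inner ℂ (N (u t)) (J u')).re t)
    (hΦ0 : ∀ u, 0 ≤ Φ u) (hΦc : Continuous Φ)
    (Y₁ Y₂ : V →L[ℂ] H) (y₀ : H) (G₁ G₂ : V →L[ℂ] V) (g₀ : V) {v₀ φ₀ : V}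
    {F : ℝ → H} {v φ : ℝ → V} (hv : IsLinearSolution B α₁ J v₀ F v)
    (hφ : IsLinearSolution B α₂ (ContinuousLinearMap.id ℂ V) φ₀
      (fun t => G₁ (v t) + G₂ (φ t) + g₀) φ) {τ : ℝ} (hτ : 0 ≤ τ)
    (hF : ∀ s, 0 ≤ s → s ≤ τ →
      α₁⁻¹ • F s = (Y₁ (v s) + Y₂ (φ s) + y₀) - (l : ℂ) • N (v s)) :
    1 + (‖v τ‖ ^ 2 + ‖φ τ‖ ^ 2) ≤
      (‖v₀‖ ^ 2 + 2 * l * Φ v₀ + ‖φ₀‖ ^ 2 + 1) * Real.exp τ *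
        Real.exp ((((α₁⁻¹).re)⁻¹ * (3 * (‖Y₁‖ ^ 2 + ‖Y₂‖ ^ 2 + ‖y₀‖ ^ 2)) +
          2 * (3 * (‖G₁‖ ^ 2 + ‖G₂‖ ^ 2 + ‖g₀‖ ^ 2))) * (Real.exp τ - 1)) := by
  have hα0 : α₁ ≠ 0 := by rintro rfl; simp at hα₁
  have hβ : 0 < (α₁⁻¹).re := by
    rw [Complex.inv_re]; exact div_pos hα₁ (Complex.normSq_pos.2 hα0)
  have hvc := hv.continuous
  have hφc := hφ.continuous
  have hst₂ : StabilityEstimate B α₂ (ContinuousLinearMap.id ℂ V) 1 :=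
    stabilityEstimate_id hB hα₂
  have hΦv := hΦ0 v₀
  let Z : ℝ → ℝ := fun t => ‖v t‖ ^ 2 + ‖φ t‖ ^ 2
  have hZ0 : ∀ t, 0 ≤ Z t := fun t => by positivity
  have hZc : Continuous Z := by fun_prop
  have h1Z : Continuous fun s => 1 + Z s := continuous_const.add hZc
  have hYc : Continuous fun s => Y₁ (v s) + Y₂ (φ s) + y₀ := by fun_prop
  have hGc : Continuous fun s => G₁ (v s) + G₂ (φ s) + g₀ := by fun_prop
  have iY := fun s => norm_affine_sq_le Y₁ Y₂ y₀ (v s) (φ s)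
  have iG := fun s => norm_affine_sq_le G₁ G₂ g₀ (v s) (φ s)
  have hAY : 0 ≤ 3 * (‖Y₁‖ ^ 2 + ‖Y₂‖ ^ 2 + ‖y₀‖ ^ 2) := by positivity
  have hAG : 0 ≤ 3 * (‖G₁‖ ^ 2 + ‖G₂‖ ^ 2 + ‖g₀‖ ^ 2) := by positivity
  generalize 3 * (‖Y₁‖ ^ 2 + ‖Y₂‖ ^ 2 + ‖y₀‖ ^ 2) = AY at hAY iY ⊢
  generalize 3 * (‖G₁‖ ^ 2 + ‖G₂‖ ^ 2 + ‖g₀‖ ^ 2) = AG at hAG iG ⊢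
  refine one_add_le_of_le_exp_mul_integral hZc (by positivity) hτ fun t ht htτ => ?_
  have e1 := hv.energy_le hBJ hα₁ hk hl hN hΦ hΦ0 hΦc hYc ht
    fun s hs hst => hF s hs (hst.trans htτ)
  have e2 := hφ.norm_sq_le zero_le_one hst₂ hGc ht
  have i1 : ∫ s in (0 : ℝ)..t, ‖Y₁ (v s) + Y₂ (φ s) + y₀‖ ^ 2 ≤
      AY * ∫ s in (0 : ℝ)..t, (1 + Z s) := by
    rw [← intervalIntegral.integral_const_mul]
    exact intervalIntegral.integral_mono_on ht ((hYc.norm.pow 2).intervalIntegrable 0 t)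
      ((continuous_const.mul h1Z).intervalIntegrable 0 t) fun s _ => iY s
  have i2 : ∫ s in (0 : ℝ)..t, ‖G₁ (v s) + G₂ (φ s) + g₀‖ ^ 2 ≤
      AG * ∫ s in (0 : ℝ)..t, (1 + Z s) := by
    rw [← intervalIntegral.integral_const_mul]
    exact intervalIntegral.integral_mono_on ht ((hGc.norm.pow 2).intervalIntegrable 0 t)
      ((continuous_const.mul h1Z).intervalIntegrable 0 t) fun s _ => iG s
  have hI : 0 ≤ ∫ s in (0 : ℝ)..t, (1 + Z s) :=
    intervalIntegral.integral_nonneg ht fun s _ => by linarith [hZ0 s]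
  have e3 : ‖v t‖ ^ 2 ≤ Real.exp t * (‖v₀‖ ^ 2 + 2 * l * Φ v₀ +
      ((α₁⁻¹).re)⁻¹ * (AY * ∫ s in (0 : ℝ)..t, (1 + Z s))) :=
    calc _ ≤ ‖v₀‖ ^ 2 + 2 * l * Φ v₀ +
          ((α₁⁻¹).re)⁻¹ * (AY * ∫ s in (0 : ℝ)..t, (1 + Z s)) := e1.trans (by gcongr)
      _ ≤ _ := le_mul_of_one_le_left (by positivity) (Real.one_le_exp ht)
  have e4 : ‖φ t‖ ^ 2 ≤
      Real.exp t * (‖φ₀‖ ^ 2 + 2 * 1 * (AG * ∫ s in (0 : ℝ)..t, (1 + Z s))) :=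
    e2.trans (by gcongr)
  refine (add_le_add e3 e4).trans (le_of_eq ?_)
  ring

/-- Global solution of the coupled system with a locally Lipschitz nonlinearity that derives from
a nonnegative potential. -/
theorem exists_coupled_solution [CompleteSpace V]
    (hB : B.IsPositive) (hBd : DenseRange B) (hJd : DenseRange J)
    (hBJ : ∀ x y, inner ℂ (B x) y = inner ℂ (J x) (J y))
    {α₁ α₂ : ℂ} (hα₁ : 0 < α₁.re) (hα₂ : 0 ≤ α₂.re) (hk : 0 ≤ k) (hl : 0 ≤ l)
    (hN : ∀ u v, ‖N u - N v‖ ≤ k * (‖u‖ + ‖v‖) ^ 2 * ‖u - v‖)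
    (hΦ : ∀ (u : ℝ → V) (u' : V) (t : ℝ), HasDerivAt u u' t →
      HasDerivAt (fun s => Φ (u s)) (inner ℂ (N (u t)) (J u')).re t)
    (hΦ0 : ∀ u, 0 ≤ Φ u) (hΦc : Continuous Φ)
    (Y₁ Y₂ : V →L[ℂ] H) (y₀ : H) (G₁ G₂ : V →L[ℂ] V) (g₀ v₀ φ₀ : V) :
    ∃ v φ : ℝ → V,
      IsLinearSolution B α₁ J v₀
        (fun t => α₁ • ((Y₁ (v t) + Y₂ (φ t) + y₀) - (l : ℂ) • N (v t))) v ∧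
      IsLinearSolution B α₂ (ContinuousLinearMap.id ℂ V) φ₀
        (fun t => G₁ (v t) + G₂ (φ t) + g₀) φ := by
  have hα0 : α₁ ≠ 0 := by rintro rfl; simp at hα₁
  have hβ : 0 < (α₁⁻¹).re := by
    rw [Complex.inv_re]; exact div_pos hα₁ (Complex.normSq_pos.2 hα0)
  have hap := fun (F : ℝ → H) (v φ : ℝ → V) => a_priori_bound (v₀ := v₀) (φ₀ := φ₀) (F := F)
    (v := v) (φ := φ) hB hBJ hα₁ hα₂ hk hl hN hΦ hΦ0 hΦc Y₁ Y₂ y₀ G₁ G₂ g₀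
  have hC : 0 ≤ ((α₁⁻¹).re)⁻¹ * (3 * (‖Y₁‖ ^ 2 + ‖Y₂‖ ^ 2 + ‖y₀‖ ^ 2)) +
      2 * (3 * (‖G₁‖ ^ 2 + ‖G₂‖ ^ 2 + ‖g₀‖ ^ 2)) := by positivity
  have hKv : ‖v₀‖ ≤ ‖v₀‖ ^ 2 + 2 * l * Φ v₀ + ‖φ₀‖ ^ 2 + 1 := by
    have h1 : 0 ≤ 2 * l * Φ v₀ := by have := hΦ0 v₀; positivity
    nlinarith [sq_nonneg (‖v₀‖ - 1), sq_nonneg ‖φ₀‖]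
  have hK : 0 < ‖v₀‖ ^ 2 + 2 * l * Φ v₀ + ‖φ₀‖ ^ 2 + 1 := by
    have := hΦ0 v₀; positivity
  generalize ‖v₀‖ ^ 2 + 2 * l * Φ v₀ + ‖φ₀‖ ^ 2 + 1 = K at hap hKv hK
  generalize ((α₁⁻¹).re)⁻¹ * (3 * (‖Y₁‖ ^ 2 + ‖Y₂‖ ^ 2 + ‖y₀‖ ^ 2)) +
      2 * (3 * (‖G₁‖ ^ 2 + ‖G₂‖ ^ 2 + ‖g₀‖ ^ 2)) = C at hap hC
  -- the truncation radius is the a priori bound itself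
  let R : ℝ → ℝ := fun t => K * Real.exp (max t 0) * Real.exp (C * (Real.exp (max t 0) - 1))
  have hRc : Continuous R := by fun_prop
  have hR0 : ∀ t, 0 < R t := fun t => by positivity
  have hRm : Monotone R := by
    intro s t hst
    simp only [R]
    gcongr
  have hR0v : ∀ t ≤ 0, ‖v₀‖ ≤ R t := by
    intro t ht
    have : R t = K := by simp [R, ht]
    rwa [this]
  obtain ⟨u, hu, hv, hφ⟩ := exists_truncated_solution hB hBd hJd hBJ hα₁ hα₂ hk hl hN
    Y₁ Y₂ y₀ G₁ G₂ g₀ v₀ φ₀ hRc hR0 hRm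
  have hv0 : ∀ t ≤ 0, (u t).1 = v₀ := fun t ht => hv.eq_of_nonpos t ht
  -- the a priori bound shows that the truncation is never active
  have hbound : ∀ t, 0 ≤ t → ‖(u t).1‖ ≤ R t := by
    intro t ht
    refine le_of_forall_le_imp_lt (f := fun t => ‖(u t).1‖) hv.continuous.norm hRc
      (by rw [hv0 0 le_rfl]; exact hR0v 0 le_rfl) (fun τ hτ hle => ?_) ht
    have hfin := hap _ _ _ hv hφ hτ fun s hs hst => by
      rw [smul_smul, inv_mul_cancel₀ hα0, one_smul,
        radialRetraction_eq_self (hR0 s) (hle s hs hst)]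
    have hRτ : R τ = K * Real.exp τ * Real.exp (C * (Real.exp τ - 1)) := by
      simp [R, hτ]
    rw [← hRτ] at hfin
    by_contra hcon
    push Not at hcon
    nlinarith [sq_nonneg ‖(u τ).2‖, sq_nonneg ‖(u τ).1‖]
  refine ⟨fun t => (u t).1, fun t => (u t).2, ?_, hφ⟩
  have hret : ∀ t, radialRetraction (R t) (u t).1 = (u t).1 := by
    intro t
    refine radialRetraction_eq_self (hR0 t) ?_
    rcases le_total 0 t with ht | ht
    · exact hbound t ht
    · rw [hv0 t ht]
      exact hR0v t ht
  simpa only [hret] using hv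

end Coupled

/-! ### Density and injectivity of the embedding of `H¹₀` in `L²` -/

section Space

variable {Ω : Set R3}

theorem IsTestFunction.memLp {θ : R3 → ℂ} (hθ : IsTestFunction Ω θ) (p : ENNReal) :
    MemLp θ p (volume.restrict Ω) :=
  (hθ.smooth.continuous.memLp_of_hasCompactSupport hθ.compact).restrict Ω

theorem IsTestFunction.continuous_classicalGrad {θ : R3 → ℂ} (hθ : IsTestFunction Ω θ) :
    Continuous (classicalGrad θ) := by
  have h : Continuous (fderiv ℝ θ) := hθ.smooth.continuous_fderiv (by simp)
  unfold classicalGrad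
  fun_prop

theorem support_classicalGrad_subset (θ : R3 → ℂ) :
    Function.support (classicalGrad θ) ⊆ tsupport θ := by
  intro x hx
  by_contra hcon
  have : fderiv ℝ θ x = 0 := by
    by_contra h
    exact hcon (support_fderiv_subset ℝ h)
  apply hx
  ext i
  simp [classicalGrad, this]

theorem IsTestFunction.memLp_classicalGrad {θ : R3 → ℂ} (hθ : IsTestFunction Ω θ) :
    MemLp (classicalGrad θ) 2 (volume.restrict Ω) := by
  refine (hθ.continuous_classicalGrad.memLp_of_hasCompactSupport ?_).restrict Ω
  exact hθ.compact.mono' (support_classicalGrad_subset θ)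

theorem IsTestFunction.exists_toL2_eq {θ : R3 → ℂ} (hθ : IsTestFunction Ω θ) :
    ∃ u : H10 Ω, toL2 Ω u = (hθ.memLp 2).toLp θ := by
  let p : WithLp 2 (L2 Ω × L2Vec Ω) :=
    WithLp.toLp 2 ((hθ.memLp 2).toLp θ, hθ.memLp_classicalGrad.toLp _)
  have hp : p ∈ testPairs Ω := ⟨θ, hθ, (hθ.memLp 2).coeFn_toLp, hθ.memLp_classicalGrad.coeFn_toLp⟩
  exact ⟨⟨p, (testPairs Ω).le_topologicalClosure hp⟩, rfl⟩

theorem isTestFunction_ofReal {η : R3 → ℝ} (h : ContDiff ℝ ∞ η) (hc : HasCompactSupport η)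
    (hs : tsupport η ⊆ Ω) : IsTestFunction Ω (fun x => (η x : ℂ)) where
  smooth := Complex.ofRealCLM.contDiff.comp h
  compact := hc.comp_left (g := fun r : ℝ => (r : ℂ)) (by simp)
  support_subset := (closure_mono (by
    intro x hx
    simpa using hx)).trans hs

/-- A function orthogonal to all test functions vanishes. -/
theorem denseRange_toL2 (hΩ : IsBoundedSmoothDomain Ω) : DenseRange (toL2 Ω) := by
  have hfin : IsFiniteMeasure (volume.restrict Ω) :=
    ⟨by simpa using hΩ.isBounded.measure_lt_top⟩
  have hbot : (LinearMap.range (toL2 Ω : H10 Ω →ₗ[ℂ] L2 Ω))ᗮ = ⊥ := by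
    rw [Submodule.eq_bot_iff]
    intro w hw
    have hint : Integrable w (volume.restrict Ω) := (Lp.memLp w).integrable (by norm_num)
    have h0 := hΩ.isOpen.ae_eq_zero_of_integral_contDiff_smul_eq_zero
      (hint.locallyIntegrable.locallyIntegrableOn Ω) fun η h hc hs => by
        have hθ := isTestFunction_ofReal h hc hs
        obtain ⟨u, hu⟩ := hθ.exists_toL2_eq
        have h1 : inner ℂ (toL2 Ω u) w = 0 := hw _ ⟨u, rfl⟩
        rw [hu, L2.inner_def] at h1
        rw [← h1]
        refine integral_congr_ae ?_
        filter_upwards [(hθ.memLp 2).coeFn_toLp] with x hx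
        rw [hx]
        simp [mul_comm]
    rw [Lp.eq_zero_iff_ae_eq_zero]
    filter_upwards [h0, ae_restrict_mem hΩ.isOpen.measurableSet] with x hx hxΩ
    exact hx hxΩ
  have := (Submodule.topologicalClosure_eq_top_iff).2 hbot
  exact Submodule.dense_iff_topologicalClosure_eq_top.2 this

theorem integral_smul_fderiv_eq {η : R3 → ℝ} (h : ContDiff ℝ ∞ η)
    (hc : HasCompactSupport η) (hs : tsupport η ⊆ Ω) {θ : R3 → ℂ} (hθ : IsTestFunction Ω θ)
    (e : R3) : ∫ x in Ω, η x • fderiv ℝ θ x e = -∫ x in Ω, fderiv ℝ η x e • θ x := by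
  have hdc : Continuous fun x => fderiv ℝ η x e :=
    (h.continuous_fderiv (by simp)).clm_apply continuous_const
  have hdcomp : HasCompactSupport fun x => fderiv ℝ η x e := hc.fderiv_apply (𝕜 := ℝ) _
  have hθd : Continuous fun x => fderiv ℝ θ x e :=
    (hθ.smooth.continuous_fderiv (by simp)).clm_apply continuous_const
  rw [setIntegral_eq_integral_of_forall_compl_eq_zero (s := Ω) fun x hx => by
      rw [image_eq_zero_of_notMem_tsupport fun hm => hx (hs hm), zero_smul],
    setIntegral_eq_integral_of_forall_compl_eq_zero (s := Ω) fun x hx => by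
      rw [image_eq_zero_of_notMem_tsupport fun hm => hx (hθ.support_subset hm), smul_zero]]
  refine integral_smul_fderiv_eq_neg_fderiv_smul_of_integrable ?_ ?_ ?_
    (fun x _ => h.differentiable (by simp) x) (fun x _ => hθ.smooth.differentiable (by simp) x)
  · exact (hdc.smul hθ.smooth.continuous).integrable_of_hasCompactSupport hdcomp.smul_right
  · exact (h.continuous.smul hθd).integrable_of_hasCompactSupport hc.smul_right
  · exact (h.continuous.smul hθ.smooth.continuous).integrable_of_hasCompactSupport hc.smul_right

/-- Taking a coordinate is a bounded operator from `L²(Ω; ℂ³)` to `L²(Ω)`. -/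
theorem exists_coordinate_L2 (i : Fin 3) : ∃ π : L2Vec Ω →L[ℂ] L2 Ω,
    ∀ g : L2Vec Ω, π g =ᵐ[volume.restrict Ω] fun x => g x i :=
  ⟨(EuclideanSpace.proj i : EuclideanSpace ℂ (Fin 3) →L[ℂ] ℂ).compLpL 2 (volume.restrict Ω),
    fun g => ContinuousLinearMap.coeFn_compLpL
      (EuclideanSpace.proj i : EuclideanSpace ℂ (Fin 3) →L[ℂ] ℂ) g⟩

/-- The second component of an element of `H¹₀(Ω)` is the weak gradient of the first one. -/
theorem integral_smul_grad_eq {η : R3 → ℝ} (h : ContDiff ℝ ∞ η)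
    (hc : HasCompactSupport η) (hs : tsupport η ⊆ Ω) (i : Fin 3) (u : H10 Ω) :
    ∫ x in Ω, η x • grad Ω u x i =
      -∫ x in Ω, fderiv ℝ η x (EuclideanSpace.single i 1) • toL2 Ω u x := by
  have hdc : Continuous fun x => fderiv ℝ η x (EuclideanSpace.single i (1 : ℝ)) :=
    (h.continuous_fderiv (by simp)).clm_apply continuous_const
  have hη2 : MemLp η 2 (volume.restrict Ω) :=
    (h.continuous.memLp_of_hasCompactSupport hc).restrict Ω
  have hd2 : MemLp (fun x => fderiv ℝ η x (EuclideanSpace.single i (1 : ℝ))) 2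
      (volume.restrict Ω) :=
    (hdc.memLp_of_hasCompactSupport (hc.fderiv_apply (𝕜 := ℝ) _)).restrict Ω
  obtain ⟨π, hπ⟩ := exists_coordinate_L2 (Ω := Ω) i
  let S : Set (WithLp 2 (L2 Ω × L2Vec Ω)) :=
    {p | smulIntegralL hη2 (π (WithLp.sndL 2 ℂ (L2 Ω) (L2Vec Ω) p)) =
      -smulIntegralL hd2 (WithLp.fstL 2 ℂ (L2 Ω) (L2Vec Ω) p)}
  have hclosed : IsClosed S := by
    refine isClosed_eq ?_ ?_
    · exact (smulIntegralL hη2).continuous.comp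
        (π.continuous.comp (WithLp.sndL 2 ℂ (L2 Ω) (L2Vec Ω)).continuous)
    · exact ((smulIntegralL hd2).continuous.comp
        (WithLp.fstL 2 ℂ (L2 Ω) (L2Vec Ω)).continuous).neg
  have htest : (testPairs Ω : Set (WithLp 2 (L2 Ω × L2Vec Ω))) ⊆ S := by
    rintro p ⟨θ, hθ, h1, h2⟩
    change smulIntegralL hη2 (π p.snd) = -smulIntegralL hd2 p.fst
    rw [smulIntegralL_apply, smulIntegralL_apply]
    refine Eq.trans ?_ ((integral_smul_fderiv_eq h hc hs hθ
      (EuclideanSpace.single i (1 : ℝ))).trans ?_)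
    · refine integral_congr_ae ?_
      filter_upwards [hπ p.snd, h2] with x hx hx2
      rw [hx, hx2]
      rfl
    · congr 1
      refine integral_congr_ae ?_
      filter_upwards [h1] with x hx
      rw [hx]
  have hu : smulIntegralL hη2 (π (grad Ω u)) = -smulIntegralL hd2 (toL2 Ω u) :=
    closure_minimal htest hclosed u.2
  rw [smulIntegralL_apply, smulIntegralL_apply] at hu
  rw [← hu]
  refine integral_congr_ae ?_
  filter_upwards [hπ (grad Ω u)] with x hx
  rw [hx]

/-- A function determines its weak gradient, so `H¹₀(Ω)`, defined as a space of pairs, embeds in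
`L²(Ω)`. -/
theorem toL2_injective (hΩ : IsBoundedSmoothDomain Ω) : Function.Injective (toL2 Ω) := by
  have hfin : IsFiniteMeasure (volume.restrict Ω) :=
    ⟨by simpa using hΩ.isBounded.measure_lt_top⟩
  refine (injective_iff_map_eq_zero (toL2 Ω)).2 fun u hu => ?_
  have hg : grad Ω u = 0 := by
    have hcoord : ∀ i : Fin 3, ∀ᵐ x ∂volume.restrict Ω, grad Ω u x i = 0 := by
      intro i
      have hint : Integrable (grad Ω u) (volume.restrict Ω) :=
        (Lp.memLp (grad Ω u)).integrable (by norm_num)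
      have hint' : Integrable (fun x => grad Ω u x i) (volume.restrict Ω) :=
        (EuclideanSpace.proj i : EuclideanSpace ℂ (Fin 3) →L[ℂ] ℂ).integrable_comp hint
      have h0 := hΩ.isOpen.ae_eq_zero_of_integral_contDiff_smul_eq_zero
        (hint'.locallyIntegrable.locallyIntegrableOn Ω) fun η h hc hs => by
          rw [integral_smul_grad_eq h hc hs i u, hu, neg_eq_zero]
          refine integral_eq_zero_of_ae ?_
          filter_upwards [Lp.coeFn_zero ℂ 2 (volume.restrict Ω)] with x hx
          rw [hx, Pi.zero_apply, smul_zero]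
      filter_upwards [h0, ae_restrict_mem hΩ.isOpen.measurableSet] with x hx hxΩ
      exact hx hxΩ
    rw [Lp.eq_zero_iff_ae_eq_zero]
    filter_upwards [ae_all_iff.2 hcoord] with x hx
    ext i
    exact hx i
  apply Subtype.ext
  apply WithLp.ofLp_injective
  exact Prod.ext hu hg

end Space

/-! ### The Sobolev embedding of `H¹₀` in `L⁶` -/

section Sobolev

variable {Ω : Set R3}

theorem norm_fderiv_le_classicalGrad (θ : R3 → ℂ) (x : R3) :
    ‖fderiv ℝ θ x‖ ≤ 3 * ‖classicalGrad θ x‖ := by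
  refine ContinuousLinearMap.opNorm_le_bound _ (by positivity) fun w => ?_
  have hw : w = ∑ i, w i • EuclideanSpace.single i (1 : ℝ) := by
    ext j
    simp [Fin.sum_univ_three]
    fin_cases j <;> simp
  have h1 : ∀ i, ‖w i • fderiv ℝ θ x (EuclideanSpace.single i (1 : ℝ))‖ ≤
      ‖classicalGrad θ x‖ * ‖w‖ := by
    intro i
    rw [norm_smul, mul_comm]
    gcongr
    · exact PiLp.norm_apply_le (classicalGrad θ x) i
    · exact PiLp.norm_apply_le w i
  calc ‖fderiv ℝ θ x w‖ = ‖∑ i, w i • fderiv ℝ θ x (EuclideanSpace.single i (1 : ℝ))‖ := by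
        conv_lhs => rw [hw, map_sum]
        simp only [map_smul]
    _ ≤ ∑ i : Fin 3, ‖classicalGrad θ x‖ * ‖w‖ := norm_sum_le_of_le _ fun i _ => h1 i
    _ = _ := by simp; ring

/-- The Gagliardo–Nirenberg–Sobolev inequality for test functions. -/
theorem exists_eLpNorm_testPairs_le (Ω : Set R3) :
    ∃ C : NNReal, ∀ p ∈ testPairs Ω,
      eLpNorm p.fst 6 (volume.restrict Ω) ≤ C * ‖p.snd‖ₑ := by
  refine ⟨SNormLESNormFDerivOfEqConst ℂ (volume : Measure R3) 2 * 3, ?_⟩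
  rintro p ⟨θ, hθ, h1, h2⟩
  have hS := eLpNorm_le_eLpNorm_fderiv_of_eq (F := ℂ) (volume : Measure R3) (u := θ)
    (p := 2) (p' := 6) (hθ.smooth.of_le (by simp)) hθ.compact (by norm_num) (by simp)
    (by simp; norm_num)
  have hG : eLpNorm (fderiv ℝ θ) 2 volume ≤ (3 : NNReal) • eLpNorm (classicalGrad θ) 2 volume :=
    eLpNorm_le_nnreal_smul_eLpNorm_of_ae_le_mul
      (Eventually.of_forall fun x => norm_fderiv_le_classicalGrad θ x) 2
  have hr : eLpNorm (classicalGrad θ) 2 volume = ‖p.snd‖ₑ := by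
    rw [Lp.enorm_def, eLpNorm_congr_ae h2, eLpNorm_restrict_eq_of_support_subset]
    exact (support_classicalGrad_subset θ).trans hθ.support_subset
  rw [ENNReal.coe_mul, mul_assoc, ← hr]
  calc eLpNorm p.fst 6 (volume.restrict Ω) = eLpNorm θ 6 (volume.restrict Ω) :=
        eLpNorm_congr_ae h1
    _ ≤ eLpNorm θ 6 volume := eLpNorm_mono_measure _ Measure.restrict_le_self
    _ ≤ _ := hS
    _ ≤ _ := mul_le_mul_right hG _

/-- The Sobolev inequality passes to the closure by Fatou's lemma along an a.e. convergent
subsequence. -/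
theorem exists_eLpNorm_toL2_le (Ω : Set R3) :
    ∃ C : NNReal, ∀ u : H10 Ω, eLpNorm (toL2 Ω u) 6 (volume.restrict Ω) ≤ C * ‖grad Ω u‖ₑ := by
  obtain ⟨C, hC⟩ := exists_eLpNorm_testPairs_le Ω
  refine ⟨C, fun u => ?_⟩
  obtain ⟨p, hp, hlim⟩ := mem_closure_iff_seq_limit.1 (u.2 : (u : WithLp 2 (L2 Ω × L2Vec Ω)) ∈
    closure (testPairs Ω : Set (WithLp 2 (L2 Ω × L2Vec Ω))))
  have h1 : Tendsto (fun n => (p n).fst) atTop (𝓝 (toL2 Ω u)) :=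
    ((WithLp.fstL 2 ℂ (L2 Ω) (L2Vec Ω)).continuous.tendsto _).comp hlim
  have h2 : Tendsto (fun n => (p n).snd) atTop (𝓝 (grad Ω u)) :=
    ((WithLp.sndL 2 ℂ (L2 Ω) (L2Vec Ω)).continuous.tendsto _).comp hlim
  obtain ⟨ns, hns, hae⟩ := (tendstoInMeasure_of_tendsto_Lp h1).exists_seq_tendsto_ae
  refine (Lp.eLpNorm_lim_le_liminf_eLpNorm (fun n => Lp.aestronglyMeasurable _) _ hae).trans ?_
  have h3 : Tendsto (fun n => (C : ENNReal) * ‖(p (ns n)).snd‖ₑ) atTop (𝓝 (C * ‖grad Ω u‖ₑ)) :=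
    ENNReal.Tendsto.const_mul ((h2.comp hns.tendsto_atTop).enorm) (Or.inr ENNReal.coe_ne_top)
  rw [← h3.liminf_eq]
  exact liminf_le_liminf (Eventually.of_forall fun n => hC _ (hp (ns n)))

instance fact_one_le_six : Fact ((1 : ENNReal) ≤ 6) := ⟨by norm_num⟩

theorem exists_sobolevEmbedding (Ω : Set R3) :
    ∃ S : H10 Ω →L[ℝ] Lp ℂ 6 (volume.restrict Ω),
      ∀ u, S u =ᵐ[volume.restrict Ω] toL2 Ω u := by
  obtain ⟨C, hC⟩ := exists_eLpNorm_toL2_le Ω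
  have hmem : ∀ u, MemLp (toL2 Ω u) 6 (volume.restrict Ω) := fun u =>
    ⟨Lp.aestronglyMeasurable _, (hC u).trans_lt (ENNReal.mul_lt_top ENNReal.coe_lt_top
      enorm_lt_top)⟩
  let S : H10 Ω →ₗ[ℝ] Lp ℂ 6 (volume.restrict Ω) :=
    { toFun := fun u => (hmem u).toLp _
      map_add' := fun u v => by
        rw [← MemLp.toLp_add, MemLp.toLp_eq_toLp_iff, map_add]
        exact Lp.coeFn_add _ _
      map_smul' := fun r u => by
        rw [RingHom.id_apply, ← MemLp.toLp_const_smul, MemLp.toLp_eq_toLp_iff]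
        have : toL2 Ω (r • u) = r • toL2 Ω u := (toL2 Ω).map_smul_of_tower r u
        rw [this]
        exact Lp.coeFn_smul _ _ }
  refine ⟨S.mkContinuous (C * ‖grad Ω‖) fun u => ?_, fun u => (hmem u).coeFn_toLp⟩
  change ‖(hmem u).toLp _‖ ≤ _
  rw [Lp.norm_toLp]
  have h1 := ENNReal.toReal_mono (ENNReal.mul_ne_top ENNReal.coe_ne_top enorm_ne_top) (hC u)
  rw [ENNReal.toReal_mul, ENNReal.coe_toReal, toReal_enorm] at h1
  refine h1.trans ?_
  rw [mul_assoc]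
  gcongr
  exact (grad Ω).le_opNorm u

end Sobolev

/-! ### The cubic nonlinearity -/

section Cubic

variable {Ω : Set R3}

instance fact_one_le_three : Fact ((1 : ENNReal) ≤ 3) := ⟨by norm_num⟩

instance holderTriple_six_six_three : ENNReal.HolderTriple 6 6 3 where
  inv_add_inv_eq_inv := by
    have h : ((3 : NNReal) : ENNReal)⁻¹ = ((6 : NNReal) : ENNReal)⁻¹ +
        ((6 : NNReal) : ENNReal)⁻¹ := by
      rw [← ENNReal.coe_inv (by norm_num), ← ENNReal.coe_inv (by norm_num), ← ENNReal.coe_add]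
      congr 1
      rw [← NNReal.coe_inj]
      push_cast
      norm_num
    simpa using h.symm

instance holderTriple_three_six_two : ENNReal.HolderTriple 3 6 2 where
  inv_add_inv_eq_inv := by
    have h : ((2 : NNReal) : ENNReal)⁻¹ = ((3 : NNReal) : ENNReal)⁻¹ +
        ((6 : NNReal) : ENNReal)⁻¹ := by
      rw [← ENNReal.coe_inv (by norm_num), ← ENNReal.coe_inv (by norm_num),
        ← ENNReal.coe_inv (by norm_num), ← ENNReal.coe_add]
      congr 1
      rw [← NNReal.coe_inj]
      push_cast
      norm_num
    simpa using h.symm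

/-- Local Lipschitz bound for a cubic map given by two bounded bilinear maps, which stand for the
Hölder products `L⁶ × L⁶ → L³` and `L³ × L⁶ → L²`. -/
theorem exists_cubic_lipschitz {E F₆ F₃ F₂ : Type*} [NormedAddCommGroup E] [NormedSpace ℝ E]
    [NormedAddCommGroup F₆] [NormedSpace ℝ F₆] [NormedAddCommGroup F₃] [NormedSpace ℝ F₃]
    [NormedAddCommGroup F₂] [NormedSpace ℝ F₂] (S : E →L[ℝ] F₆) (S₁ : F₆ →L[ℝ] F₆ →L[ℝ] F₃)
    (S₂ : F₃ →L[ℝ] F₆ →L[ℝ] F₂) :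
    ∃ k : ℝ, 0 ≤ k ∧ ∀ u v, ‖S₂ (S₁ (S u) (S u)) (S u) - S₂ (S₁ (S v) (S v)) (S v)‖ ≤
      k * (‖u‖ + ‖v‖) ^ 2 * ‖u - v‖ := by
  refine ⟨‖S₂‖ * ‖S₁‖ * ‖S‖ ^ 3, by positivity, fun u v => ?_⟩
  set k := ‖S₂‖ * ‖S₁‖ * ‖S‖ ^ 3 with hk
  have hb : ∀ x y z, ‖S₂ (S₁ (S x) (S y)) (S z)‖ ≤ k * ‖x‖ * ‖y‖ * ‖z‖ := fun x y z => by
    calc _ ≤ ‖S₂‖ * ‖S₁ (S x) (S y)‖ * ‖S z‖ := S₂.le_opNorm₂ _ _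
      _ ≤ ‖S₂‖ * (‖S₁‖ * (‖S‖ * ‖x‖) * (‖S‖ * ‖y‖)) * (‖S‖ * ‖z‖) := by
        gcongr
        · refine (S₁.le_opNorm₂ _ _).trans ?_
          gcongr <;> exact S.le_opNorm _
        · exact S.le_opNorm _
      _ = _ := by rw [hk]; ring
  have h : S₂ (S₁ (S u) (S u)) (S u) - S₂ (S₁ (S v) (S v)) (S v) =
      S₂ (S₁ (S (u - v)) (S u)) (S u) + S₂ (S₁ (S v) (S (u - v))) (S u) +
        S₂ (S₁ (S v) (S v)) (S (u - v)) := by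
    simp only [map_sub, sub_apply]
    abel
  have h1 := norm_add₃_le (a := S₂ (S₁ (S (u - v)) (S u)) (S u))
    (b := S₂ (S₁ (S v) (S (u - v))) (S u)) (c := S₂ (S₁ (S v) (S v)) (S (u - v)))
  have h2 := hb (u - v) u u
  have h3 := hb v (u - v) u
  have h4 := hb v v (u - v)
  have h5 : 0 ≤ k * ‖u‖ * ‖v‖ * ‖u - v‖ := by positivity
  rw [h]
  nlinarith

theorem hasDerivAt_cubic {E F₆ F₃ F₂ : Type*} [NormedAddCommGroup E] [NormedSpace ℝ E]
    [NormedAddCommGroup F₆] [NormedSpace ℝ F₆] [NormedAddCommGroup F₃] [NormedSpace ℝ F₃]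
    [NormedAddCommGroup F₂] [NormedSpace ℝ F₂] (S : E →L[ℝ] F₆) (S₁ : F₆ →L[ℝ] F₆ →L[ℝ] F₃)
    (S₂ : F₃ →L[ℝ] F₆ →L[ℝ] F₂) {u : ℝ → E} {u' : E} {t : ℝ} (hu : HasDerivAt u u' t) :
    HasDerivAt (fun s => S₂ (S₁ (S (u s)) (S (u s))) (S (u s)))
      (S₂ (S₁ (S u') (S (u t))) (S (u t)) + S₂ (S₁ (S (u t)) (S u')) (S (u t)) +
        S₂ (S₁ (S (u t)) (S (u t))) (S u')) t := by
  have hS := S.hasFDerivAt.comp_hasDerivAt t hu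
  have h1 := (S₁.hasFDerivAt.comp_hasDerivAt t hS).clm_apply hS
  have h2 := (S₂.hasFDerivAt.comp_hasDerivAt t h1).clm_apply hS
  simpa using h2

theorem re_inner_eq_of_ae {f g f' g' : L2 Ω} (h : ∀ᵐ x ∂volume.restrict Ω,
    (inner ℂ (f x) (g x)).re = (inner ℂ (f' x) (g' x)).re) :
    (inner ℂ f g).re = (inner ℂ f' g').re := by
  rw [L2.inner_def, L2.inner_def]
  have h1 := integral_re (L2.integrable_inner (𝕜 := ℂ) f g)
  have h2 := integral_re (L2.integrable_inner (𝕜 := ℂ) f' g')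
  simp only [RCLike.re_eq_complex_re] at h1 h2
  rw [← h1, ← h2]
  exact integral_congr_ae h

/-- The cubic term `N u = |u|² u` as a locally Lipschitz map from `H¹₀` to `L²`, and the chain
rule for its potential `¼ Re ⟨N u, u⟩ = ¼ ∫ |u|⁴`. -/
theorem exists_cubicNonlinearity (Ω : Set R3) :
    ∃ (N : H10 Ω → L2 Ω) (k : ℝ), 0 ≤ k ∧
      (∀ u, N u =ᵐ[volume.restrict Ω] fun x => ((‖toL2 Ω u x‖ ^ 2 : ℝ) : ℂ) * toL2 Ω u x) ∧
      (∀ u v, ‖N u - N v‖ ≤ k * (‖u‖ + ‖v‖) ^ 2 * ‖u - v‖) ∧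
      ∀ (u : ℝ → H10 Ω) (u' : H10 Ω) (t : ℝ), HasDerivAt u u' t →
        HasDerivAt (fun s => (1 / 4 : ℝ) * (inner ℂ (N (u s)) (toL2 Ω (u s))).re)
          (inner ℂ (N (u t)) (toL2 Ω u')).re t := by
  obtain ⟨S, hS⟩ := exists_sobolevEmbedding Ω
  let b₁ : ℂ →L[ℝ] ℂ →L[ℝ] ℂ :=
    (ContinuousLinearMap.mul ℝ ℂ).bilinearComp (ContinuousLinearMap.id ℝ ℂ)
      (Complex.conjCLE : ℂ →L[ℝ] ℂ)
  obtain ⟨S₁, hS₁⟩ : ∃ S₁ : Lp ℂ 6 (volume.restrict Ω) →L[ℝ] Lp ℂ 6 (volume.restrict Ω) →L[ℝ]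
      Lp ℂ 3 (volume.restrict Ω), ∀ f g, S₁ f g =ᵐ[volume.restrict Ω] fun x => f x * conj (g x) :=
    ⟨b₁.holderL (volume.restrict Ω) 6 6 3, fun f g => b₁.coeFn_holder f g⟩
  obtain ⟨S₂, hS₂⟩ : ∃ S₂ : Lp ℂ 3 (volume.restrict Ω) →L[ℝ] Lp ℂ 6 (volume.restrict Ω) →L[ℝ]
      Lp ℂ 2 (volume.restrict Ω), ∀ f g, S₂ f g =ᵐ[volume.restrict Ω] fun x => f x * g x :=
    ⟨(ContinuousLinearMap.mul ℝ ℂ).holderL (volume.restrict Ω) 3 6 2, fun f g =>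
      (ContinuousLinearMap.mul ℝ ℂ).coeFn_holder f g⟩
  obtain ⟨k, hk, hN⟩ := exists_cubic_lipschitz S S₁ S₂
  have hD := fun (u : ℝ → H10 Ω) u' t (hu : HasDerivAt u u' t) => hasDerivAt_cubic S S₁ S₂ hu
  obtain ⟨T, hTd⟩ : ∃ T : H10 Ω → H10 Ω → H10 Ω → L2 Ω,
    T = fun u v w => S₂ (S₁ (S u) (S v)) (S w) := ⟨_, rfl⟩
  have hT : ∀ u v w, T u v w =ᵐ[volume.restrict Ω]
      fun x => toL2 Ω u x * conj (toL2 Ω v x) * toL2 Ω w x := fun u v w => by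
    rw [hTd]
    filter_upwards [hS₂ (S₁ (S u) (S v)) (S w), hS₁ (S u) (S v), hS u, hS v, hS w]
      with x h1 h2 h3 h4 h5
    rw [h1, h2, h3, h4, h5]
  replace hN : ∀ u v, ‖T u u u - T v v v‖ ≤ k * (‖u‖ + ‖v‖) ^ 2 * ‖u - v‖ := fun u v => by
    rw [hTd]; exact hN u v
  replace hD : ∀ (u : ℝ → H10 Ω) u' t, HasDerivAt u u' t → HasDerivAt (fun s => T (u s) (u s) (u s))
      (T u' (u t) (u t) + T (u t) u' (u t) + T (u t) (u t) u') t := fun u u' t hu => by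
    rw [hTd]; exact hD u u' t hu
  clear hTd hS₁ hS₂ hS S₁ S₂ S
  refine ⟨fun u => T u u u, k, hk, fun u => ?_, hN, ?_⟩
  · filter_upwards [hT u u u] with x hx
    rw [hx, Complex.mul_conj, Complex.normSq_eq_norm_sq]
  · intro u u' t hu
    have h1 := hD u u' t hu
    have hJ : HasDerivAt (fun s => toL2 Ω (u s)) (toL2 Ω u') t :=
      ((toL2 Ω).restrictScalars ℝ).hasFDerivAt.comp_hasDerivAt t hu
    have h2 := (Complex.reCLM.hasFDerivAt.comp_hasDerivAt t (h1.inner ℂ hJ)).const_mul (1 / 4 : ℝ)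
    refine h2.congr_deriv ?_
    simp only [Complex.reCLM_apply, Complex.add_re, inner_add_left]
    -- each of the four terms of the derivative of `|u|⁴` contributes `|u|² Re (conj u * u')`
    have e1 : (inner ℂ (T u' (u t) (u t)) (toL2 Ω (u t))).re =
        (inner ℂ (T (u t) (u t) (u t)) (toL2 Ω u')).re := by
      refine re_inner_eq_of_ae ?_
      filter_upwards [hT u' (u t) (u t), hT (u t) (u t) (u t)] with x h3 h4
      rw [h3, h4]
      simp
      ring
    have e2 : (inner ℂ (T (u t) u' (u t)) (toL2 Ω (u t))).re =
        (inner ℂ (T (u t) (u t) (u t)) (toL2 Ω u')).re := by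
      refine re_inner_eq_of_ae ?_
      filter_upwards [hT (u t) u' (u t), hT (u t) (u t) (u t)] with x h3 h4
      rw [h3, h4]
      simp
      ring
    have e3 : (inner ℂ (T (u t) (u t) u') (toL2 Ω (u t))).re =
        (inner ℂ (T (u t) (u t) (u t)) (toL2 Ω u')).re := by
      refine re_inner_eq_of_ae ?_
      filter_upwards [hT (u t) (u t) u', hT (u t) (u t) (u t)] with x h3 h4
      rw [h3, h4]
      simp
      ring
    rw [e1, e2, e3]
    ring

end Cubic

/-! ### Weak formulations in time -/

section WeakForm

theorem hasDerivAt_add_integral {E : Type*} [NormedAddCommGroup E] [NormedSpace ℝ E]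
    [CompleteSpace E] {q : ℝ → E} (hq : Continuous q) (y₀ : E) (t : ℝ) :
    HasDerivAt (fun t => y₀ + ∫ s in (0 : ℝ)..t, q s) (q t) t :=
  (intervalIntegral.integral_hasDerivAt_right (hq.intervalIntegrable _ _)
    (hq.stronglyMeasurableAtFilter _ _) hq.continuousAt).const_add y₀

/-- Integration by parts in time against a function `ξ` which is `C¹` up to the endpoints and
vanishes at `T`. -/
theorem integral_conj_deriv_mul {y q : ℝ → ℂ} {y₀ : ℂ} (hq : Continuous q)
    (hy : ∀ t, 0 ≤ t → y t = y₀ + ∫ s in (0 : ℝ)..t, q s) {T : ℝ} (hT : 0 < T) {ξ : ℝ → ℂ}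
    (hξ : ContDiffOn ℝ 1 ξ (Icc 0 T)) (hξT : ξ T = 0) :
    ∫ t in (0 : ℝ)..T, (conj (derivWithin ξ (Icc 0 T) t) * y t + conj (ξ t) * q t) =
      -(conj (ξ 0) * y₀) := by
  have hI : uIcc 0 T = Icc 0 T := uIcc_of_le hT.le
  have h := intervalIntegral.integral_deriv_mul_eq_sub_of_hasDerivWithinAt (a := 0) (b := T)
    (u := fun t => conj (ξ t)) (u' := fun t => conj (derivWithin ξ (Icc 0 T) t))
    (v := fun t => y₀ + ∫ s in (0 : ℝ)..t, q s) (v' := q)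
    (fun t ht => by
      rw [hI] at ht ⊢
      exact Complex.conjCLE.toContinuousLinearMap.hasFDerivAt.comp_hasDerivWithinAt t
        ((hξ.differentiableOn (by simp)) t ht).hasDerivWithinAt)
    (fun t _ => (hasDerivAt_add_integral hq y₀ t).hasDerivWithinAt)
    (by
      refine ContinuousOn.intervalIntegrable ?_
      rw [hI]
      exact Complex.continuous_conj.comp_continuousOn
        (hξ.continuousOn_derivWithin (uniqueDiffOn_Icc hT) le_rfl))
    (hq.intervalIntegrable 0 T)
  rw [hξT] at h
  simp only [map_zero, zero_mul, intervalIntegral.integral_same, add_zero, zero_sub] at h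
  rw [← h]
  refine intervalIntegral.integral_congr fun t ht => ?_
  rw [hI] at ht
  simp only [hy t ht.1]

/-- The weak formulation of `d y' = r - l`, `y(0) = y₀`, where `q` is the derivative of `y`. -/
theorem integral_weak_form {y q l r : ℝ → ℂ} {y₀ d : ℂ} (hq : Continuous q)
    (hy : ∀ t, 0 ≤ t → y t = y₀ + ∫ s in (0 : ℝ)..t, q s)
    (hr : Continuous r) (hl : ∀ t, l t = r t - d * q t)
    {T : ℝ} (hT : 0 < T) {ξ : ℝ → ℂ} (hξ : ContDiffOn ℝ 1 ξ (Icc 0 T)) (hξT : ξ T = 0) :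
    ∫ t in (0 : ℝ)..T, (-d * (conj (derivWithin ξ (Icc 0 T) t) * y t) + conj (ξ t) * l t) =
      (∫ t in (0 : ℝ)..T, conj (ξ t) * r t) + d * (conj (ξ 0) * y₀) := by
  have hI : uIcc 0 T = Icc 0 T := uIcc_of_le hT.le
  have hyc : ContinuousOn y (Icc 0 T) := by
    have h : Continuous fun t => y₀ + ∫ s in (0 : ℝ)..t, q s :=
      continuous_iff_continuousAt.2 fun t => (hasDerivAt_add_integral hq y₀ t).continuousAt
    exact h.continuousOn.congr fun t ht => hy t ht.1
  have h1 : IntervalIntegrable (fun t => conj (ξ t) * r t) volume 0 T := by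
    refine ContinuousOn.intervalIntegrable ?_
    rw [hI]
    exact (Complex.continuous_conj.comp_continuousOn hξ.continuousOn).mul hr.continuousOn
  have h2 : IntervalIntegrable
      (fun t => conj (derivWithin ξ (Icc 0 T) t) * y t + conj (ξ t) * q t) volume 0 T := by
    refine ContinuousOn.intervalIntegrable ?_
    rw [hI]
    exact ((Complex.continuous_conj.comp_continuousOn
      (hξ.continuousOn_derivWithin (uniqueDiffOn_Icc hT) le_rfl)).mul hyc).add
      ((Complex.continuous_conj.comp_continuousOn hξ.continuousOn).mul hq.continuousOn)
  have h3 := integral_conj_deriv_mul hq hy hT hξ hξT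
  calc _ = ∫ t in (0 : ℝ)..T, (conj (ξ t) * r t -
        d * (conj (derivWithin ξ (Icc 0 T) t) * y t + conj (ξ t) * q t)) :=
        intervalIntegral.integral_congr fun t _ => by simp only [hl]; ring
    _ = _ := by
      rw [intervalIntegral.integral_sub h1 (h2.const_mul d), intervalIntegral.integral_const_mul,
        h3]
      ring

theorem hasL2WeakTimeDeriv_of_integral {X : Type*} [NormedAddCommGroup X] [NormedSpace ℝ X]
    [CompleteSpace X] {u w : ℝ → X} {u₀ : X} (hw : Continuous w)
    (hu : ∀ t, 0 ≤ t → u t = u₀ + ∫ s in (0 : ℝ)..t, w s) {T : ℝ} (hT : 0 < T) :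
    HasL2WeakTimeDeriv T u w := by
  have hU := hasDerivAt_add_integral hw u₀
  have hUc : Continuous fun t => u₀ + ∫ s in (0 : ℝ)..t, w s :=
    continuous_iff_continuousAt.2 fun t => (hU t).continuousAt
  have heq : EqOn u (fun t => u₀ + ∫ s in (0 : ℝ)..t, w s) (Ioo 0 T) := fun t ht => hu t ht.1.le
  refine ⟨?_, memLp_two_Ioo hw T, fun η hη _ hsupp => ?_⟩
  · refine IntegrableOn.congr_fun ?_ heq.symm measurableSet_Ioo
    exact (hUc.integrableOn_Icc).mono_set Ioo_subset_Icc_self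
  · rw [← integral_Ioo_deriv_smul hT hU hw hη hsupp]
    exact setIntegral_congr_fun measurableSet_Ioo fun t ht => by simp only [heq ht]

/-- For curves of antilinear functionals, the integrated equation may be checked on each vector. -/
theorem hasL2WeakTimeDeriv_clm {E : Type*} [NormedAddCommGroup E] [NormedSpace ℂ E]
    {u w : ℝ → E →L⋆[ℂ] ℂ} {u₀ : E →L⋆[ℂ] ℂ} (hw : Continuous w)
    (hu : ∀ ψ t, 0 ≤ t → u t ψ = u₀ ψ + ∫ s in (0 : ℝ)..t, w s ψ) {T : ℝ} (hT : 0 < T) :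
    HasL2WeakTimeDeriv T u w := by
  refine hasL2WeakTimeDeriv_of_integral (u₀ := u₀) hw (fun t ht => ?_) hT
  ext ψ
  have h := ((ContinuousLinearMap.apply' ℂ (starRingEnd ℂ) ψ).restrictScalars ℝ
    ).intervalIntegral_comp_comm (hw.intervalIntegrable (μ := volume) 0 t)
  rw [hu ψ t ht, add_apply]
  congr 1

variable {V H : Type*} [NormedAddCommGroup V] [InnerProductSpace ℂ V] [CompleteSpace V]
  [NormedAddCommGroup H] [InnerProductSpace ℂ H] [CompleteSpace H]

/-- The orthogonal complement of the range of `J† J` is its kernel, which is the kernel of `J`. -/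
theorem denseRange_adjoint_comp_self {J : V →L[ℂ] H} (hJ : Function.Injective J) :
    DenseRange ((ContinuousLinearMap.adjoint J).comp J) := by
  have h1 := ((ContinuousLinearMap.adjoint J).comp J).orthogonal_range
  have h2 : (ContinuousLinearMap.adjoint ((ContinuousLinearMap.adjoint J).comp J)) =
      (ContinuousLinearMap.adjoint J).comp J := by
    rw [ContinuousLinearMap.adjoint_comp, ContinuousLinearMap.adjoint_adjoint]
  rw [h2, ContinuousLinearMap.ker_adjoint_comp_self] at h1
  have h3 : J.ker = ⊥ := LinearMap.ker_eq_bot.2 hJ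
  rw [h3, ← Submodule.topologicalClosure_eq_top_iff] at h1
  exact Submodule.dense_iff_topologicalClosure_eq_top.2 h1

/-- The coupled system for the operator `B = J† J`, with its equations in weak form. -/
theorem exists_coupled_weak_solution {J : V →L[ℂ] H} (hJ : Function.Injective J)
    (hJd : DenseRange J) {N : V → H} {Φ : V → ℝ} {k l : ℝ} {α₁ α₂ : ℂ} (hα₁ : 0 < α₁.re)
    (hα₂ : 0 ≤ α₂.re) (hk : 0 ≤ k) (hl : 0 ≤ l)
    (hN : ∀ u v, ‖N u - N v‖ ≤ k * (‖u‖ + ‖v‖) ^ 2 * ‖u - v‖)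
    (hΦ : ∀ (u : ℝ → V) (u' : V) (t : ℝ), HasDerivAt u u' t →
      HasDerivAt (fun s => Φ (u s)) (inner ℂ (N (u t)) (J u')).re t)
    (hΦ0 : ∀ u, 0 ≤ Φ u) (hΦc : Continuous Φ)
    (Y₁ Y₂ : V →L[ℂ] H) (y₀ : H) (G₁ G₂ : V →L[ℂ] V) (g₀ v₀ φ₀ : V) :
    ∃ v φ : ℝ → V, Continuous v ∧ Continuous φ ∧ v 0 = v₀ ∧ φ 0 = φ₀ ∧
      (∀ ψ t, 0 ≤ t → inner ℂ (J ψ) (J (v t)) = inner ℂ (J ψ) (J v₀) +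
        ∫ s in (0 : ℝ)..t, (inner ℂ (J ψ)
          (α₁ • ((Y₁ (v s) + Y₂ (φ s) + y₀) - (l : ℂ) • N (v s))) - α₁ * inner ℂ ψ (v s))) ∧
      (∀ ψ t, 0 ≤ t → inner ℂ (J ψ) (J (φ t)) = inner ℂ (J ψ) (J φ₀) +
        ∫ s in (0 : ℝ)..t, (inner ℂ (J ψ) (J (G₁ (v s) + G₂ (φ s) + g₀)) -
          α₂ * inner ℂ ψ (φ s))) ∧
      ∀ T, 0 < T → ∃ w : ℝ → H, HasL2WeakTimeDeriv T (fun t => J (v t)) w := by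
  have hBJ : ∀ x y, inner ℂ (((ContinuousLinearMap.adjoint J).comp J) x) y =
      inner ℂ (J x) (J y) := fun x y => ContinuousLinearMap.adjoint_inner_left J y (J x)
  obtain ⟨v, φ, hv, hφ⟩ := exists_coupled_solution J.isPositive_adjoint_comp_self
    (denseRange_adjoint_comp_self hJ) hJd hBJ hα₁ hα₂ hk hl hN hΦ hΦ0 hΦc Y₁ Y₂ y₀ G₁ G₂ g₀ v₀ φ₀
  have hNc := continuous_of_norm_sub_le hN
  have hvc := hv.continuous
  have hφc := hφ.continuous
  refine ⟨v, φ, hvc, hφc, hv.eq_of_nonpos 0 le_rfl, hφ.eq_of_nonpos 0 le_rfl, fun ψ t ht => ?_,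
    fun ψ t ht => ?_, fun T hT => hv.exists_hasL2WeakTimeDeriv hBJ hα₁ hT⟩
  · exact hv.weak_eq hBJ (Q := ContinuousLinearMap.id ℂ H) (fun _ => rfl) (by fun_prop) ψ ht
  · exact hφ.weak_eq hBJ (Q := J) (fun _ => rfl) (by fun_prop) ψ ht

end WeakForm

/-! ### The Ginzburg–Landau system -/

section System

variable {Ω : Set R3}

theorem inner_eq_add_grad (ψ u : H10 Ω) :
    inner ℂ ψ u = inner ℂ (toL2 Ω ψ) (toL2 Ω u) + inner ℂ (grad Ω ψ) (grad Ω u) :=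
  WithLp.prod_inner_apply (𝕜 := ℂ) (ψ : WithLp 2 (L2 Ω × L2Vec Ω)) u

instance completeSpace_H10 : CompleteSpace (H10 Ω) :=
  (testPairs Ω).isClosed_topologicalClosure.completeSpace_coe

theorem cubicPairing_eq_inner {N : H10 Ω → L2 Ω}
    (hN : ∀ u, N u =ᵐ[volume.restrict Ω] fun x => ((‖toL2 Ω u x‖ ^ 2 : ℝ) : ℂ) * toL2 Ω u x)
    (v ψ : H10 Ω) : cubicPairing Ω v ψ = inner ℂ (toL2 Ω ψ) (N v) := by
  rw [cubicPairing, L2.inner_def]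
  refine integral_congr_ae ?_
  filter_upwards [hN v] with x hx
  rw [hx, RCLike.inner_apply]

theorem re_inner_cubic_nonneg {N : H10 Ω → L2 Ω}
    (hN : ∀ u, N u =ᵐ[volume.restrict Ω] fun x => ((‖toL2 Ω u x‖ ^ 2 : ℝ) : ℂ) * toL2 Ω u x)
    (u : H10 Ω) : 0 ≤ (inner ℂ (N u) (toL2 Ω u)).re := by
  rw [L2.inner_def]
  have h1 := integral_re (L2.integrable_inner (𝕜 := ℂ) (N u) (toL2 Ω u))
  simp only [RCLike.re_eq_complex_re] at h1
  rw [← h1]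
  refine integral_nonneg_of_ae ?_
  filter_upwards [hN u] with x hx
  rw [hx]
  simp [-Complex.ofReal_pow]
  have : 0 ≤ (toL2 Ω u x).re * (toL2 Ω u x).re + (toL2 Ω u x).im * (toL2 Ω u x).im := by
    nlinarith [mul_self_nonneg (toL2 Ω u x).re, mul_self_nonneg (toL2 Ω u x).im]
  nlinarith [mul_nonneg (sq_nonneg ‖toL2 Ω u x‖) this]

/-- The Ginzburg–Landau system with abstract spaces `V` and `H`, embedding `J`, gradient `D` and
nonlinearity `N`: there are global solutions whose equations, tested with `ψ`, have the form of
the system. -/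
theorem exists_solution_system {V H H' : Type*} [NormedAddCommGroup V] [InnerProductSpace ℂ V]
    [CompleteSpace V] [NormedAddCommGroup H] [InnerProductSpace ℂ H] [CompleteSpace H]
    [NormedAddCommGroup H'] [InnerProductSpace ℂ H'] {J : V →L[ℂ] H} {D : V →L[ℂ] H'}
    (hJ : Function.Injective J) (hJd : DenseRange J)
    (hJD : ∀ ψ u, inner ℂ ψ u = inner ℂ (J ψ) (J u) + inner ℂ (D ψ) (D u))
    {N : V → H} {Φ : V → ℝ} {k : ℝ} (hk : 0 ≤ k)
    (hN : ∀ u v, ‖N u - N v‖ ≤ k * (‖u‖ + ‖v‖) ^ 2 * ‖u - v‖)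
    (hΦ : ∀ (u : ℝ → V) (u' : V) (t : ℝ), HasDerivAt u u' t →
      HasDerivAt (fun s => Φ (u s)) (inner ℂ (N (u t)) (J u')).re t)
    (hΦ0 : ∀ u, 0 ≤ Φ u) (hΦc : Continuous Φ) (P : Coefficients)
    (hb : 0 < P.b) (hc : 0 < P.c) (hm : 0 < P.m) (hd : 0 < P.d.im) (f h v₀ φ₀ : V) :
    ∃ v φ : ℝ → V, Continuous v ∧ Continuous φ ∧ v 0 = v₀ ∧ φ 0 = φ₀ ∧
      (∀ T, 0 < T → ∃ w : ℝ → H, HasL2WeakTimeDeriv T (fun t => J (v t)) w) ∧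
      (∃ w : ℝ → V → ℂ, (∀ ψ, Continuous fun t => w t ψ) ∧
        (∀ ψ t, 0 ≤ t → inner ℂ (J ψ) (J (v t)) =
          inner ℂ (J ψ) (J v₀) + ∫ s in (0 : ℝ)..t, w s ψ) ∧
        ∀ ψ t, P.d * w t ψ =
          Complex.I * ((P.a : ℂ) - 1 / P.U) * inner ℂ (J ψ) (J (v t))
          + Complex.I * P.g / P.U * inner ℂ (J ψ) (J (φ t))
          - Complex.I * P.c / (4 * P.m) * inner ℂ (D ψ) (D (v t))
          - Complex.I * P.b * inner ℂ (J ψ) (N (v t)) + inner ℂ (J ψ) (J f)) ∧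
      ∃ w : ℝ → V →L⋆[ℂ] ℂ, Continuous w ∧
        (∀ ψ t, 0 ≤ t → inner ℂ (J ψ) (J (φ t)) =
          inner ℂ (J ψ) (J φ₀) + ∫ s in (0 : ℝ)..t, w s ψ) ∧
        ∀ ψ t, w t ψ = Complex.I * P.g / P.U * inner ℂ (J ψ) (J (v t))
          - Complex.I * ((P.g : ℂ) ^ 2 / P.U + 2 * P.ν - 2 * P.μ) * inner ℂ (J ψ) (J (φ t))
          - Complex.I / (4 * P.m) * inner ℂ (D ψ) (D (φ t))
          - P.γ * inner ℂ (J ψ) (J (φ t)) + inner ℂ (J ψ) (J h) := by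
  have hNc := continuous_of_norm_sub_le hN
  have hd0 : P.d ≠ 0 := by rintro h; simp [h] at hd
  have hm0 : (P.m : ℂ) ≠ 0 := by exact_mod_cast hm.ne'
  have hc0 : (P.c : ℂ) ≠ 0 := by exact_mod_cast hc.ne'
  -- `u_t = -α B⁻¹ u + F`, where `B⁻¹ = 1 - Δ`: the coefficient of `Δ` fixes `α`, and `F`
  -- compensates for the zeroth-order part of `B⁻¹`; `κ` and `l` are chosen so that `d α₁ κ = 1` and
  -- `d α₁ l = i b`
  obtain ⟨α₁, hα₁⟩ : ∃ α₁ : ℂ, α₁ = Complex.I * P.c / (4 * P.m) / P.d := ⟨_, rfl⟩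
  obtain ⟨α₂, hα₂⟩ : ∃ α₂ : ℂ, α₂ = Complex.I / (4 * P.m) := ⟨_, rfl⟩
  obtain ⟨κ, hκ⟩ : ∃ κ : ℂ, κ = (4 * P.m) / (Complex.I * P.c) := ⟨_, rfl⟩
  obtain ⟨l, hl⟩ : ∃ l : ℝ, l = 4 * P.m * P.b / P.c := ⟨_, rfl⟩
  have e1 : P.d * α₁ = Complex.I * P.c / (4 * P.m) := by
    rw [hα₁]; field_simp
  have e2 : P.d * α₁ * κ = 1 := by
    rw [e1, hκ]
    have := Complex.I_ne_zero
    field_simp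
  have e3 : P.d * α₁ * l = Complex.I * P.b := by
    rw [e1, hl]; push_cast; field_simp
  have hα₁re : 0 < α₁.re := by
    have : α₁ = ((P.c / (4 * P.m) : ℝ) : ℂ) * (Complex.I / P.d) := by
      rw [hα₁]; push_cast; ring
    rw [this, Complex.re_ofReal_mul, Complex.div_re]
    have := Complex.normSq_pos.2 hd0
    simp only [Complex.I_re, Complex.I_im, zero_mul, zero_div, one_mul, zero_add]
    positivity
  have hα₂re : 0 ≤ α₂.re := by
    have : α₂ = Complex.I * ((1 / (4 * P.m) : ℝ) : ℂ) := by
      rw [hα₂]; push_cast; ring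
    rw [this, Complex.I_mul_re]
    simp
  have hl0 : 0 ≤ l := by rw [hl]; positivity
  obtain ⟨p, hp⟩ : ∃ p : ℂ, p = Complex.I * ((P.a : ℂ) - 1 / P.U) := ⟨_, rfl⟩
  obtain ⟨q, hq⟩ : ∃ q : ℂ, q = Complex.I * P.g / P.U := ⟨_, rfl⟩
  obtain ⟨r, hr⟩ : ∃ r : ℂ, r = Complex.I * ((P.g : ℂ) ^ 2 / P.U + 2 * P.ν - 2 * P.μ) := ⟨_, rfl⟩
  obtain ⟨v, φ, hvc, hφc, hv0, hφ0, hv, hφ, hvt⟩ := exists_coupled_weak_solution hJ hJd hα₁re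
    hα₂re hk hl0 hN hΦ hΦ0 hΦc ((κ * (p + P.d * α₁)) • J) ((κ * q) • J) (κ • J f)
    (q • ContinuousLinearMap.id ℂ V) ((α₂ - P.γ - r) • ContinuousLinearMap.id ℂ V) h v₀ φ₀
  rw [← hp, ← hq, ← e1, ← hα₂, ← hr]
  refine ⟨v, φ, hvc, hφc, hv0, hφ0, hvt, ⟨_, fun ψ => ?_, hv, fun ψ t => ?_⟩,
    fun t => (innerSLFlip ℂ (J (q • v t + (α₂ - P.γ - r) • φ t + h))).comp J -
      α₂ • innerSLFlip ℂ (φ t), ?_, fun ψ t ht => ?_, fun ψ t => ?_⟩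
  · exact (continuous_const.inner (by fun_prop)).sub
      (continuous_const.mul (continuous_const.inner hvc))
  · rw [hJD]
    simp only [smul_apply, inner_smul_right, inner_add_right, inner_sub_right]
    linear_combination ((p + P.d * α₁) * inner ℂ (J ψ) (J (v t)) +
      q * inner ℂ (J ψ) (J (φ t)) + inner ℂ (J ψ) (J f)) * e2 - inner ℂ (J ψ) (N (v t)) * e3
  · have h1 : Continuous fun x : H => (innerSLFlip ℂ x).comp J :=
      ((ContinuousLinearMap.compSL V H ℂ (RingHom.id ℂ) (starRingEnd ℂ)).flip J).continuous.comp
        (innerSLFlip ℂ (E := H)).continuous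
    exact (h1.comp (by fun_prop)).sub (((innerSLFlip ℂ (E := V)).continuous.comp hφc).const_smul α₂)
  · exact hφ ψ t ht
  · rw [sub_apply, smul_apply, ContinuousLinearMap.comp_apply, innerSLFlip_apply_apply,
      innerSLFlip_apply_apply, hJD]
    simp only [map_add, map_smul, inner_smul_right, inner_add_right, smul_eq_mul]
    ring

end System

end GinzburgLandau

end


open GinzburgLandau in
theorem theorem2p1 (Ω : Set GinzburgLandau.R3) (hΩ : GinzburgLandau.IsBoundedSmoothDomain Ω)
    (P : GinzburgLandau.Coefficients)
    (hU : 0 < P.U) (hb : 0 < P.b) (hc : 0 < P.c) (hm : 0 < P.m) (haU : P.a * P.U < 1)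
    (hγ : 0 < P.γ) (hd : 0 < P.d.im)
    (f h : GinzburgLandau.H10 Ω) (v₀ φ₀ : GinzburgLandau.H10 Ω) :
    ∃ v φ : ℝ → GinzburgLandau.H10 Ω,
      v 0 = v₀ ∧ φ 0 = φ₀ ∧
      ∀ T : ℝ, 0 < T → GinzburgLandau.IsWeakSolution Ω P f h v₀ φ₀ T v φ := by
  obtain ⟨N, k, hk, hNae, hNlip, hNd⟩ := exists_cubicNonlinearity Ω
  have hNc := continuous_of_norm_sub_le hNlip
  obtain ⟨v, φ, hvc, hφc, hv0, hφ0, hvt, ⟨w, hw, hwi, hwe⟩, z, hz, hzi, hze⟩ :=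
    exists_solution_system (toL2_injective hΩ) (denseRange_toL2 hΩ) inner_eq_add_grad (N := N)
      (Φ := fun u => (1 / 4 : ℝ) * (inner ℂ (N u) (toL2 Ω u)).re) hk hNlip hNd
      (fun u => mul_nonneg (by norm_num) (re_inner_cubic_nonneg hNae u))
      (continuous_const.mul (Complex.continuous_re.comp (hNc.inner (toL2 Ω).continuous)))
      P hb hc hm hd f h v₀ φ₀
  refine ⟨v, φ, hv0, hφ0, fun T hT => ⟨hvc.continuousOn, hφc.continuousOn, hvt T hT,
    ⟨z, hasL2WeakTimeDeriv_clm (u₀ := toHm1 Ω φ₀) hz hzi hT⟩, fun ψ ξ hξ hξT => ?_,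
    fun ψ ξ hξ hξT => ?_⟩⟩
  · have h1 := integral_weak_form (d := P.d) (r := fun _ => inner ℂ (toL2 Ω ψ) (toL2 Ω f)) (hw ψ)
      (hwi ψ) continuous_const (fun t => rfl) hT hξ hξT
    simp only [inner_smul_left, cubicPairing_eq_inner hNae, map_smul]
    rw [← h1]
    refine intervalIntegral.integral_congr fun t _ => ?_
    simp only [hwe]
    ring
  · have h1 := integral_weak_form (d := 1) (r := fun _ => inner ℂ (toL2 Ω ψ) (toL2 Ω h))
      ((ContinuousLinearMap.apply' ℂ (starRingEnd ℂ) ψ).continuous.comp hz)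
      (hzi ψ) continuous_const (fun t => rfl) hT hξ hξT
    simp only [inner_smul_left]
    rw [← one_mul (conj (ξ 0) * _), ← h1]
    refine intervalIntegral.integral_congr fun t _ => ?_
    simp only [Function.comp_apply, ContinuousLinearMap.apply_apply', hze]
    ring
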